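/- Let $d\in\{1,2,3\}$, $k\ge 2$, and let $V\in L^\infty(\mathbb R^d)$ be complex valued with compact support. On $H^1(\mathbb R^d)\times L^2(\mathbb R^d)$ let $$U_0(t)=\begin{bmatrix}\cos(t|D|)&\frac{\sin(t|D|)}{|D|}\\ \Delta\frac{\sin(t|D|)}{|D|}&\cos(t|D|)\end{bmatrix},\qquad \mathbf V=\begin{bmatrix}0&0\\V&0\end{bmatrix},\qquad (\Lambda F)(t)=\int_0^tU_0(t-s)F(s)\,ds,$$ where $D=-i\nabla$, let $W_{k,V}(t)=\bigl((\Lambda\mathbf V)^kU_0\bigr)(t)$ be the $k$-th Duhamel term, and for $\phi\in C_c^\infty(\mathbb R)$ let $\langle\phi,W_{k,V}\rangle=\int_{\mathbb R}\phi(t)\,W_{k,V}(t)\,dt$. For $u'=(u_2,\dots,u_k)\in\mathbb R^{d(k-1)}$ put $u_1=u_{k+1}=0$ and $f(u')=\sum_{j=1}^k|u_{j+1}-u_j|$. Let $\sigma_k$ be the positive measure on $\mathbb R^{d(k-1)}$ given by $$d\sigma_k(u')=\begin{cases}\dfrac{1}{2^{k-1}k!}\,\bigl(1-f(u')\bigr)_+^{k-1}\,du',&d=1,\\[2ex]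 \dfrac{2}{k(2\pi)^k}\displaystyle\int_{s_1+\dots+s_k=1,\ s_j\ge0}\ \prod_{j=1}^k\bigl(s_j^2-|u_{j+1}-u_j|^2\bigr)_+^{-1/2}\,ds\;du',&d=2,\\[2ex] \dfrac{2}{k(4\pi)^k}\;\delta\bigl(1-f(u')\bigr)\displaystyle\prod_{j=1}^k|u_{j+1}-u_j|^{-1}\,du',&d=3,\end{cases}$$ where $ds$ is Lebesgue measure in $(s_1,\dots,s_{k-1})$. Then $\sigma_k$ is finite, and there is a function $a_{k,V}$, continuous on $[0,\infty)$, with the following properties. 1. For all $t\ge0$, $$a_{k,V}(t)=\int_{\mathbb R^{d(k-1)}}\int_{\mathbb R^d}V(u_1)\prod_{j=2}^kV(u_1+tu_j)\,du_1\,d\sigma_k(u'),$$ where now $u_1$ denotes the integration variable in $\mathbb R^d$. 2. For every even $\phi\in C_c^\infty(\mathbb R)$ the operator $\langle\phi,W_{k,V}\rangle$ is bounded and of trace class on $H^1\times L^2$, and $$\operatorname{trace}\langle\phi,W_{k,V}\rangle=\int_0^\infty t^{2k-d}\,a_{k,V}(t)\,\phi(t)\,dt.$$ 3. Whenever $1\le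 p_j\le\infty$ and $\sum_{j=1}^kp_j^{-1}=1$, one has for all $t\ge0$ $$|a_{k,V}(t)|\le\Bigl(\int d\sigma_k\Bigr)\prod_{j=1}^k\|V\|_{L^{p_j}(\mathbb R^d)}.$$ -/

import Mathlib

open MeasureTheory FourierTransform LineDeriv
open scoped SchwartzMap ENNReal

noncomputable section

namespace WaveTrace

/-! ### Trace class operators -/

/-- A bounded operator on a Hilbert space is of trace class if it is an absolutely convergent
series of operators of rank one, `T = ∑ ⟪aₙ, ·⟫ bₙ` with `∑ ‖aₙ‖ ‖bₙ‖ < ∞`. -/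
def IsTraceClass {H : Type} [NormedAddCommGroup H] [InnerProductSpace ℂ H]
    (T : H →L[ℂ] H) : Prop :=
  ∃ a b : ℕ → H, Summable (fun n => ‖a n‖ * ‖b n‖) ∧
    ∀ x : H, HasSum (fun n => inner ℂ (a n) x • b n) (T x)

/-- `T` is of trace class and its trace is `z`: the series `∑ ⟪eᵢ, T eᵢ⟫` converges to `z` for
every Hilbert basis `e`. -/
def HasTrace {H : Type} [NormedAddCommGroup H] [InnerProductSpace ℂ H]
    (T : H →L[ℂ] H) (z : ℂ) : Prop :=
  IsTraceClass T ∧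
    ∀ (ι : Type) (e : HilbertBasis ι ℂ H), HasSum (fun i => inner ℂ (e i) (T (e i))) z

/-! ### Function spaces -/

/-- `ℝ^d` with its Euclidean norm and Lebesgue measure. -/
abbrev E (d : ℕ) : Type := EuclideanSpace ℝ (Fin d)

/-- `L²(ℝ^d)`, complex valued. -/
abbrev L2 (d : ℕ) : Type := Lp ℂ 2 (volume : Measure (E d))

/-- `L^∞(ℝ^d)`, complex valued. -/
abbrev Linfty (d : ℕ) : Type := Lp ℂ ∞ (volume : Measure (E d))

/-- The `j`-th standard unit vector. -/
abbrev stdVec {d : ℕ} (j : Fin d) : E d := EuclideanSpace.single j (1 : ℝ)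

/-- `L²(ℝ^d) × L²(ℝ^d)^d` with its Hilbert space norm, the ambient space of `H¹(ℝ^d)`. -/
abbrev Jet (d : ℕ) : Type := WithLp 2 (L2 d × PiLp 2 (fun _ : Fin d => L2 d))

/-- `x ↦ ∂ⱼ x₀ - xⱼ` with the derivative in the sense of tempered distributions. -/
def jetDefect {d : ℕ} (j : Fin d) : Jet d →L[ℂ] 𝓢'(E d, ℂ) :=
  LineDeriv.lineDerivOpCLM ℂ 𝓢'(E d, ℂ) (stdVec j) ∘L
      Lp.toTemperedDistributionCLM ℂ volume 2 ∘L WithLp.fstL 2 ℂ (L2 d) _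
    - Lp.toTemperedDistributionCLM ℂ volume 2 ∘L
      PiLp.proj 2 (fun _ : Fin d => L2 d) j ∘L WithLp.sndL 2 ℂ (L2 d) _

/-- The Sobolev space `H¹(ℝ^d)`, as the space of all `(f, ∂₁ f, …, ∂_d f)` where `f ∈ L²` and its
weak derivatives `∂ⱼ f` are in `L²`, with `‖f‖²_{H¹} = ‖f‖² + ∑ ‖∂ⱼ f‖²`. -/
def H1 (d : ℕ) : Submodule ℂ (Jet d) := ⨅ j : Fin d, (jetDefect j).ker

theorem mem_H1_iff {d : ℕ} (x : Jet d) :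
    x ∈ H1 d ↔ ∀ j : Fin d, ∂_{stdVec j} (x.fst : 𝓢'(E d, ℂ)) = (x.snd j : 𝓢'(E d, ℂ)) := by
  simp [H1, jetDefect, sub_eq_zero]

theorem isClosed_H1 (d : ℕ) : IsClosed (H1 d : Set (Jet d)) := by
  have h : (H1 d : Set (Jet d)) = ⋂ j : Fin d, (fun x => jetDefect j x) ⁻¹' {0} := by
    ext x; simp [H1]
  rw [h]
  exact isClosed_iInter fun j => isClosed_singleton.preimage (jetDefect j).continuous

instance (d : ℕ) : CompleteSpace (H1 d) := (isClosed_H1 d).completeSpace_coe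

/-- `H¹(ℝ^d) × L²(ℝ^d)` with its Hilbert space norm. -/
abbrev Energy (d : ℕ) : Type := WithLp 2 (H1 d × L2 d)

/-- The function `f ∈ L²` underlying an element of `H¹`. -/
def H1.val {d : ℕ} : H1 d →L[ℂ] L2 d := WithLp.fstL 2 ℂ (L2 d) _ ∘L (H1 d).subtypeL

/-- The weak derivative `∂ⱼ f ∈ L²` of an element of `H¹`. -/
def H1.deriv {d : ℕ} (j : Fin d) : H1 d →L[ℂ] L2 d :=
  PiLp.proj 2 (fun _ : Fin d => L2 d) j ∘L WithLp.sndL 2 ℂ (L2 d) _ ∘L (H1 d).subtypeL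

/-! ### Multiplication operators and Fourier multipliers -/

/-- Multiplication by a bounded function. -/
def mulL2 {d : ℕ} (V : Linfty d) : L2 d →L[ℂ] L2 d :=
  (ContinuousLinearMap.mul ℂ ℂ).holderL (volume : Measure (E d)) ∞ 2 2 V

theorem coeFn_mulL2 {d : ℕ} (V : Linfty d) (f : L2 d) :
    mulL2 V f =ᵐ[volume] fun x => V x * f x :=
  ContinuousLinearMap.coeFn_holder (ContinuousLinearMap.mul ℂ ℂ) V f

/-- The Fourier multiplier `f ↦ 𝓕⁻¹ (m 𝓕 f)` on `L²`, where `𝓕 f ξ = ∫ exp (-2πi⟨x, ξ⟩) f x dx`. -/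
def multiplier {d : ℕ} (m : BoundedContinuousFunction (E d) ℂ) : L2 d →L[ℂ] L2 d :=
  ((Lp.fourierTransformₗᵢ (E d) ℂ).symm : L2 d →L[ℂ] L2 d) ∘L
    mulL2 (MemLp.toLp m m.memLp_top) ∘L
    ((Lp.fourierTransformₗᵢ (E d) ℂ) : L2 d →L[ℂ] L2 d)

theorem fourier_multiplier {d : ℕ} (m : BoundedContinuousFunction (E d) ℂ) (f : L2 d) :
    (𝓕 (multiplier m f) : L2 d) =ᵐ[volume] fun ξ => m ξ * (𝓕 f : L2 d) ξ := by
  have h : (𝓕 (multiplier m f) : L2 d) = mulL2 (MemLp.toLp m m.memLp_top) (𝓕 f) :=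
    (Lp.fourierTransformₗᵢ (E d) ℂ).apply_symm_apply _
  rw [h]
  filter_upwards [coeFn_mulL2 (MemLp.toLp m m.memLp_top) (𝓕 f), MemLp.coeFn_toLp m.memLp_top]
    with ξ h1 h2
  rw [h1, h2]

/-- The symbol `cos (2π t |ξ|)` of `cos (t |D|)`, `D = -i∇`. -/
def cosSymbol (d : ℕ) (t : ℝ) : BoundedContinuousFunction (E d) ℂ :=
  BoundedContinuousFunction.ofNormedAddCommGroup
    (fun ξ => ((Real.cos (t * (2 * Real.pi * ‖ξ‖)) : ℝ) : ℂ)) (by fun_prop) 1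
    (fun ξ => by
      rw [Complex.norm_real]
      exact Real.abs_cos_le_one _)

/-- The symbol `sin (2π t |ξ|) / (2π |ξ|)` of `sin (t |D|) / |D|`. -/
def sinSymbol (d : ℕ) (t : ℝ) : BoundedContinuousFunction (E d) ℂ :=
  BoundedContinuousFunction.ofNormedAddCommGroup
    (fun ξ => ((t * Real.sinc (t * (2 * Real.pi * ‖ξ‖)) : ℝ) : ℂ))
    (by
      have := Real.continuous_sinc
      fun_prop) |t|
    (fun ξ => by
      rw [Complex.norm_real, Real.norm_eq_abs, abs_mul]
      exact mul_le_of_le_one_right (abs_nonneg _) (Real.abs_sinc_le_one _))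

/-- The symbol `2πi ξⱼ sin (2π t |ξ|) / (2π |ξ|)` of `∂ⱼ sin (t |D|) / |D|`. -/
def gradSinSymbol {d : ℕ} (j : Fin d) (t : ℝ) : BoundedContinuousFunction (E d) ℂ :=
  BoundedContinuousFunction.ofNormedAddCommGroup
    (fun ξ => 2 * Real.pi * Complex.I * ((ξ j : ℝ) : ℂ) * sinSymbol d t ξ)
    (by
      have := (sinSymbol d t).continuous
      fun_prop) 1
    (fun ξ => by
      have h1 : |ξ j| ≤ ‖ξ‖ := by
        simpa using PiLp.norm_apply_le ξ j
      have h2 : ∀ x : ℝ, |x * Real.sinc x| ≤ 1 := fun x => by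
        by_cases hx : x = 0
        · simp [hx]
        · rw [Real.sinc_of_ne_zero hx, mul_div_cancel₀ _ hx]
          exact Real.abs_sin_le_one x
      have h3 : ‖2 * Real.pi * Complex.I * ((ξ j : ℝ) : ℂ) * sinSymbol d t ξ‖
          = |ξ j| * (2 * Real.pi * |t * Real.sinc (t * (2 * Real.pi * ‖ξ‖))|) := by
        simp [sinSymbol, abs_of_pos Real.pi_pos]
        ring
      rw [h3]
      calc _ ≤ ‖ξ‖ * (2 * Real.pi * |t * Real.sinc (t * (2 * Real.pi * ‖ξ‖))|) := by
            gcongr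
        _ = |t * (2 * Real.pi * ‖ξ‖) * Real.sinc (t * (2 * Real.pi * ‖ξ‖))| := by
            simp [abs_mul, abs_of_pos Real.pi_pos]
            ring
        _ ≤ 1 := h2 _)

/-! ### The free wave group -/

/-- Weak derivatives in `L²` on the Fourier side. -/
theorem lineDeriv_eq_iff {d : ℕ} (j : Fin d) (f g : L2 d) :
    ∂_{stdVec j} (f : 𝓢'(E d, ℂ)) = (g : 𝓢'(E d, ℂ)) ↔
      (𝓕 g : L2 d) =ᵐ[volume]
        fun ξ => 2 * Real.pi * Complex.I * ((ξ j : ℝ) : ℂ) * (𝓕 f : L2 d) ξ := by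
  have hT : Function.HasTemperateGrowth
      (fun ξ : E d => (Complex.ofReal (inner ℝ ξ (stdVec j)))) := by fun_prop
  have key : ∀ u : 𝓢(E d, ℂ),
      ((2 * Real.pi * Complex.I) • TemperedDistribution.smulLeftCLM ℂ
        (fun ξ : E d => (Complex.ofReal (inner ℝ ξ (stdVec j)))) ((𝓕 f : L2 d) : 𝓢'(E d, ℂ))) u
      = ∫ ξ, u ξ • (2 * Real.pi * Complex.I * ((ξ j : ℝ) : ℂ) * (𝓕 f : L2 d) ξ) := by
    intro u
    rw [smul_apply, TemperedDistribution.smulLeftCLM_apply_apply,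
      Lp.toTemperedDistribution_apply, smul_eq_mul, ← integral_const_mul]
    refine integral_congr_ae (Filter.Eventually.of_forall fun ξ => ?_)
    have hin : inner ℝ ξ (stdVec j) = ξ j := by simp [stdVec, EuclideanSpace.inner_single_right]
    simp only [SchwartzMap.smulLeftCLM_apply_apply hT, hin, smul_eq_mul]
    ring
  have h0 : ∂_{stdVec j} (f : 𝓢'(E d, ℂ)) = (g : 𝓢'(E d, ℂ)) ↔
      (2 * Real.pi * Complex.I) • TemperedDistribution.smulLeftCLM ℂ
        (fun ξ : E d => (Complex.ofReal (inner ℝ ξ (stdVec j)))) ((𝓕 f : L2 d) : 𝓢'(E d, ℂ))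
      = ((𝓕 g : L2 d) : 𝓢'(E d, ℂ)) := by
    rw [← Lp.fourier_toTemperedDistribution_eq, ← Lp.fourier_toTemperedDistribution_eq,
      ← TemperedDistribution.fourier_lineDerivOp_eq]
    exact ((fourierEquiv ℂ 𝓢'(E d, ℂ)).injective.eq_iff).symm
  rw [h0]
  constructor
  · intro h
    have hf : LocallyIntegrable
        (fun ξ => 2 * Real.pi * Complex.I * ((ξ j : ℝ) : ℂ) * (𝓕 f : L2 d) ξ) volume := by
      have h1 := ((Lp.memLp (𝓕 f : L2 d)).locallyIntegrable (by norm_num))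
      rw [← locallyIntegrableOn_univ] at h1 ⊢
      exact h1.continuousOn_mul (by fun_prop) isOpen_univ.isLocallyClosed
    refine ae_eq_of_integral_contDiff_smul_eq
      ((Lp.memLp (𝓕 g : L2 d)).locallyIntegrable (by norm_num)) hf ?_
    intro u hu hc
    have hg₁ : HasCompactSupport (Complex.ofRealCLM ∘ u) := hc.comp_left rfl
    have hg₂ : ContDiff ℝ ((⊤ : ℕ∞) : WithTop ℕ∞) (Complex.ofRealCLM ∘ u) := by fun_prop
    have h2 := key (hg₁.toSchwartzMap hg₂)
    rw [h] at h2
    simpa [Lp.toTemperedDistribution_apply] using h2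
  · intro h
    ext u
    rw [key, Lp.toTemperedDistribution_apply]
    refine integral_congr_ae ?_
    filter_upwards [h] with ξ hξ
    rw [hξ]

/-- The map `x ↦ (A x, B₁ x, …, B_d x)`. -/
def mkJet {d : ℕ} {X : Type} [AddCommGroup X] [Module ℂ X] [TopologicalSpace X] (A : X →L[ℂ] L2 d)
    (B : Fin d → X →L[ℂ] L2 d) : X →L[ℂ] Jet d :=
  ((WithLp.prodContinuousLinearEquiv 2 ℂ (L2 d) (PiLp 2 (fun _ : Fin d => L2 d))).symm :
      _ →L[ℂ] Jet d) ∘L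
    A.prod (((PiLp.continuousLinearEquiv 2 ℂ (fun _ : Fin d => L2 d)).symm :
      _ →L[ℂ] PiLp 2 (fun _ : Fin d => L2 d)) ∘L ContinuousLinearMap.pi B)

/-- `cos (t |D|)` on `H¹`. -/
def cosH1 {d : ℕ} (t : ℝ) : H1 d →L[ℂ] H1 d :=
  (mkJet (multiplier (cosSymbol d t) ∘L H1.val)
    (fun j => multiplier (cosSymbol d t) ∘L H1.deriv j)).codRestrict (H1 d) (by
      intro x
      rw [mem_H1_iff]
      intro j
      refine (lineDeriv_eq_iff j (multiplier (cosSymbol d t) (H1.val x))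
        (multiplier (cosSymbol d t) (H1.deriv j x))).2 ?_
      have hx := (lineDeriv_eq_iff j (H1.val x) (H1.deriv j x)).1 ((mem_H1_iff _).1 x.2 j)
      filter_upwards [hx, fourier_multiplier (cosSymbol d t) (H1.val x),
        fourier_multiplier (cosSymbol d t) (H1.deriv j x)] with ξ h1 h2 h3
      rw [h2, h3, h1]
      ring)

/-- `sin (t |D|) / |D|` as a map from `L²` to `H¹`. -/
def sinH1 {d : ℕ} (t : ℝ) : L2 d →L[ℂ] H1 d :=
  (mkJet (multiplier (sinSymbol d t)) (fun j => multiplier (gradSinSymbol j t))).codRestrict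
    (H1 d) (by
      intro x
      rw [mem_H1_iff]
      intro j
      refine (lineDeriv_eq_iff j (multiplier (sinSymbol d t) x)
        (multiplier (gradSinSymbol j t) x)).2 ?_
      filter_upwards [fourier_multiplier (sinSymbol d t) x,
        fourier_multiplier (gradSinSymbol j t) x] with ξ h2 h3
      rw [h2, h3]
      simp only [gradSinSymbol, BoundedContinuousFunction.coe_ofNormedAddCommGroup]
      ring)

/-- `Δ sin (t |D|) / |D| = ∑ⱼ (∂ⱼ sin (t |D|) / |D|) ∂ⱼ` as a map from `H¹` to `L²`. -/
def laplacianSin {d : ℕ} (t : ℝ) : H1 d →L[ℂ] L2 d :=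
  ∑ j : Fin d, multiplier (gradSinSymbol j t) ∘L H1.deriv j

/-- The map `x ↦ (A x, B x)` into `H¹ × L²`. -/
def mkEnergy {d : ℕ} {X : Type} [AddCommGroup X] [Module ℂ X] [TopologicalSpace X] (A : X →L[ℂ] H1 d)
    (B : X →L[ℂ] L2 d) : X →L[ℂ] Energy d :=
  ((WithLp.prodContinuousLinearEquiv 2 ℂ (H1 d) (L2 d)).symm : _ →L[ℂ] Energy d) ∘L A.prod B

/-- The free wave group
`U₀(t) (f, g) = (cos (t|D|) f + sin (t|D|)/|D| g, Δ sin (t|D|)/|D| f + cos (t|D|) g)`. -/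
def freeWave {d : ℕ} (t : ℝ) : Energy d →L[ℂ] Energy d :=
  mkEnergy
    (cosH1 t ∘L WithLp.fstL 2 ℂ (H1 d) (L2 d) + sinH1 t ∘L WithLp.sndL 2 ℂ (H1 d) (L2 d))
    (laplacianSin t ∘L WithLp.fstL 2 ℂ (H1 d) (L2 d) +
      multiplier (cosSymbol d t) ∘L WithLp.sndL 2 ℂ (H1 d) (L2 d))

/-- `𝐕 (f, g) = (0, V f)`. -/
def potential {d : ℕ} (V : Linfty d) : Energy d →L[ℂ] Energy d :=
  mkEnergy 0 (mulL2 V ∘L H1.val ∘L WithLp.fstL 2 ℂ (H1 d) (L2 d))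

/-- The `k`-th Duhamel term `W_{k,V}(t) h = ((Λ 𝐕)^k U₀ h)(t)`, where
`(Λ F)(t) = ∫₀ᵗ U₀(t - s) F(s) ds`. -/
def duhamel {d : ℕ} (V : Linfty d) : ℕ → ℝ → Energy d → Energy d
  | 0, t, h => freeWave t h
  | k + 1, t, h => ∫ s in (0 : ℝ)..t, freeWave (t - s) (potential V (duhamel V k s h))

/-- `T` is the operator `⟨φ, W_{k,V}⟩ = ∫ φ(t) W_{k,V}(t) dt` on `H¹ × L²`. -/
def IsSmearedDuhamel {d : ℕ} (V : Linfty d) (k : ℕ) (φ : ℝ → ℂ)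
    (T : Energy d →L[ℂ] Energy d) : Prop :=
  ∀ h : Energy d, T h = ∫ t : ℝ, φ t • duhamel V k t h

/-! ### The measures `σ_k` -/

/-- For `u = (u₂, …, u_k)`, the closed polygon `u₁ = 0, u₂, …, u_k, u_{k+1} = 0`; here
`vertex u i` is `u_{i+1}` for `0 ≤ i ≤ k`. -/
def vertex {d k : ℕ} (u : Fin (k - 1) → E d) (i : ℕ) : E d :=
  if h : 1 ≤ i ∧ i < k then u ⟨i - 1, by omega⟩ else 0

/-- The length `|u_{i+2} - u_{i+1}|` of the `i`-th side, `0 ≤ i < k`. -/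
def side {d k : ℕ} (u : Fin (k - 1) → E d) (i : ℕ) : ℝ := ‖vertex u (i + 1) - vertex u i‖

/-- `f(u) = |u₂| + |u₃ - u₂| + ⋯ + |u_k - u_{k-1}| + |u_k|`. -/
def perimeter {d k : ℕ} (u : Fin (k - 1) → E d) : ℝ := ∑ i ∈ Finset.range k, side u i

/-- The barycentric coordinates `(s₁, …, s_{k-1}, 1 - s₁ - ⋯ - s_{k-1})`. -/
def bary {k : ℕ} (s : Fin (k - 1) → ℝ) (i : ℕ) : ℝ :=
  if h : i < k - 1 then s ⟨i, h⟩ else 1 - ∑ j, s j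

/-- The simplex `s₁ + ⋯ + s_k = 1`, `sⱼ ≥ 0`, in the coordinates `s₁, …, s_{k-1}`. -/
def simplex (k : ℕ) : Set (Fin (k - 1) → ℝ) := {s | ∀ i < k, 0 ≤ bary s i}

/-- Dimension one: `(2^{k-1} k!)⁻¹ (1 - f(u))₊^{k-1} du`. -/
def sigmaOne (d k : ℕ) : Measure (Fin (k - 1) → E d) :=
  volume.withDensity fun u =>
    ENNReal.ofReal ((2 ^ (k - 1) * (k.factorial : ℝ))⁻¹ * (max (1 - perimeter u) 0) ^ (k - 1))

/-- Dimension two: `2 / (k (2π)^k) ∫_simplex ∏ⱼ (sⱼ² - |u_{j+1} - uⱼ|²)₊^{-1/2} ds du`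
(`Real.sqrt` vanishes on negative numbers and `0⁻¹ = 0`). -/
def sigmaTwo (d k : ℕ) : Measure (Fin (k - 1) → E d) :=
  volume.withDensity fun u =>
    ENNReal.ofReal (2 / ((k : ℝ) * (2 * Real.pi) ^ k)) *
      ∫⁻ s in simplex k,
        ∏ i ∈ Finset.range k, ENNReal.ofReal (Real.sqrt (bary s i ^ 2 - side u i ^ 2))⁻¹

/-- Dimension three: `2 / (k (4π)^k) δ(1 - f(u)) w(u) du`, where
`w(u) = (|u₂| |u₃ - u₂| ⋯ |u_k - u_{k-1}| |u_k|)⁻¹`. As `f` is homogeneous of degree `1` and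
`w(u) du` is homogeneous of degree `3(k-1) - k = 2k - 3`, the measure `ν = δ(1 - f(u)) w(u) du`,
given by `∫ h(u) w(u) du = ∫₀^∞ t^{2k-4} ∫ h(tu) dν(u) dt`, is `2k - 3` times the image of
`w(u) du` restricted to `f < 1` under the radial projection `u ↦ u / f(u)` onto `f = 1`. -/
def sigmaThree (d k : ℕ) : Measure (Fin (k - 1) → E d) :=
  ENNReal.ofReal ((2 * (k : ℝ) - 3) * (2 / (k * (4 * Real.pi) ^ k))) •
    Measure.map (fun u => (perimeter u)⁻¹ • u)
      ((volume.withDensity fun u =>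
          ENNReal.ofReal (∏ i ∈ Finset.range k, side u i)⁻¹).restrict {u | perimeter u < 1})

/-- The measure `σ_k` on `ℝ^{d(k-1)}`, for `d = 1, 2, 3`: in all three cases it is
`(2/k) ∫_simplex S(s₁, u₂) S(s₂, u₃ - u₂) ⋯ S(s_k, -u_k) ds du`, where `S(s, x)` is the kernel
of `sin (s|D|)/|D|`, which is `1_{|x| ≤ s} / 2`, `(s² - |x|²)₊^{-1/2} / (2π)` and
`δ(s - |x|) / (4π|x|)` respectively. -/
def sigma (d k : ℕ) : Measure (Fin (k - 1) → E d) :=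
  if d = 1 then sigmaOne d k else if d = 2 then sigmaTwo d k else sigmaThree d k

end WaveTrace

end

/-! ### Trace class operators built from integrals of rank one operators. -/

noncomputable section

namespace WaveTrace

/-! Write `r = (z² - Δ)⁻¹` and `R(z)` for the Laplace transform of the free group. The Laplace
transform turns the iterated convolution `W_k` into `R (𝐕 R)^k`, and applied to `(f, g)` this ends
in `r (z f + g)`. Fourier inversion of `e^t φ(t)` writes `φ(t) = ∫ ψ(w) e^{-z t} dw` on the line `z
= 1 - 2πiw` with `ψ` Schwartz, so `∫₀^∞ φ W_k dt` is a superposition of these Laplace transforms.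
Time reversal `J (f, g) = (f, -g)` conjugates `W_k(t)` into `W_k(-t)`; for even `φ` the half line `t
< 0` therefore contributes the `J`-conjugate of the half line `t > 0`, which has the same trace.

Trace class: for `d ≤ 3` the symbol `(z² + |2πξ|²)⁻¹` is in `L²`, so the Green function with pole
`x` is an `L²` vector. As `k ≥ 2`, the product contains `r V r`, which is an integral over `x` of
rank one operators with coefficient `V(x)`. Growth in `w` is polynomial and is absorbed by `ψ`.
Hence the smeared operator is an integral of rank one operators over `(w, x)` with square integrable
vectors, a product of two Hilbert-Schmidt operators, and its trace is the integral of the inner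
products (`hasTrace_innerL2`, `IsLaplaceFamily.exists_hasTrace`).

Value: pairing the two ends produces `2 z r² = -∂_z r`, so one Green function on a closed polygon of
`k` Green functions is differentiated. Rotating the polygon shows that `k` times the trace is the
integral of the correlation of `V` against minus the `z`-derivative of the whole product
(`natCast_mul_integral_closedChain`). The kernel of `r` is the Laplace transform in `s` of the wave
kernel `S(s, x)` (`fourier_waveGreen`, obtained from the heat kernel for real `z` and continued
analytically). Minus the derivative of the product is thus the Laplace transform of `∏ S(s_j,
u_{j+1} - u_j)` with the extra factor `t = s_1 + ⋯ + s_k`. Homogeneity of `S` of degree `1 - d` then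
splits off the power `t^{2k-d}` and leaves the measure `σ_k` (`lintegral_polygonMeasure`). This
gives twice the trace at `z` as the Laplace transform of `t^{2k-d} a(t)` (`two_mul_bornTrace`), and
integrating against `ψ` restores `φ`.

The same polar identity tested on `e^{-t}` shows that `σ_k` is finite, because Green functions lie
in `L¹ ∩ L²`. Continuity of `a` then follows from continuity of translations in `L¹`, and the bound
is Hölder's inequality for the correlation function. -/

theorem enorm_sq_eq_tsum {H : Type} [NormedAddCommGroup H] [InnerProductSpace ℂ H]
    {ι : Type*} (e : HilbertBasis ι ℂ H) (x : H) :
    ∑' i, ‖inner ℂ (e i) x‖ₑ ^ 2 = ‖x‖ₑ ^ 2 := by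
  have h := e.hasSum_inner_mul_inner x x
  have h2 : HasSum (fun i => ‖inner ℂ (e i) x‖ ^ 2) (‖x‖ ^ 2) := by
    have h3 := Complex.hasSum_re h
    convert h3 using 1
    · ext i
      rw [← inner_conj_symm x (e i), Complex.conj_mul']
      norm_cast
    · rw [inner_self_eq_norm_sq_to_K]
      norm_cast
  have h4 := h2.tsum_eq
  rw [← ofReal_norm, ← ENNReal.ofReal_pow (norm_nonneg _), ← h4,
    ENNReal.ofReal_tsum_of_nonneg (fun i => by positivity) h2.summable]
  refine tsum_congr fun i => ?_
  rw [← ofReal_norm, ← ENNReal.ofReal_pow (norm_nonneg _)]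

/-- Orthonormal vectors lie `√2` apart, so balls of radius `1/2` around them are disjoint.
Countability permits exchanging sums over a basis with integrals, and reindexing by `ℕ`. -/
theorem countable_of_orthonormal {H : Type} [NormedAddCommGroup H] [InnerProductSpace ℂ H]
    [SecondCountableTopology H] {ι : Type*} {v : ι → H} (hv : Orthonormal ℂ v) : Countable ι := by
  have h : (Set.univ : Set ι).PairwiseDisjoint (fun i => Metric.ball (v i) (1 / 2)) := by
    intro i _ j _ hij
    refine Metric.ball_disjoint_ball ?_
    have h1 : ‖v i - v j‖ ^ 2 = 2 := by
      rw [@norm_sub_sq ℂ, hv.1, hv.1, hv.2 hij]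
      norm_num
    rw [dist_eq_norm]
    nlinarith [norm_nonneg (v i - v j)]
  exact Set.countable_univ_iff.1 (h.countable_of_isOpen (fun i _ => Metric.isOpen_ball)
    fun i _ => ⟨v i, Metric.mem_ball_self (by norm_num)⟩)

section RankOne

variable {X : Type} [MeasurableSpace X] {μ : Measure X}
  {H : Type} [NormedAddCommGroup H] [InnerProductSpace ℂ H]

/-- The map `h ↦ (x ↦ ⟪k x, h⟫)` into `L²`. -/
def innerL2 {k : X → H} (hk : MemLp k 2 μ) : H →L[ℂ] Lp ℂ 2 μ :=
  LinearMap.mkContinuous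
    { toFun := fun h => (hk.inner_const h).toLp _
      map_add' := fun a b => by
        rw [← MemLp.toLp_add]
        simp only [inner_add_right]
        rfl
      map_smul' := fun c a => by
        rw [RingHom.id_apply, ← MemLp.toLp_const_smul]
        simp only [inner_smul_right]
        rfl } (eLpNorm k 2 μ).toReal (fun h => by
      simp only [LinearMap.coe_mk, AddHom.coe_mk, Lp.norm_toLp]
      have h1 : eLpNorm (fun x => inner ℂ (k x) h) 2 μ ≤ ENNReal.ofReal ‖h‖ * eLpNorm k 2 μ :=
        eLpNorm_le_mul_eLpNorm_of_ae_le_mul (Filter.Eventually.of_forall fun x => by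
          rw [mul_comm]; exact norm_inner_le_norm _ _) 2
      have h2 := ENNReal.toReal_mono (ENNReal.mul_ne_top ENNReal.ofReal_ne_top hk.2.ne) h1
      rwa [ENNReal.toReal_mul, ENNReal.toReal_ofReal (norm_nonneg _), mul_comm] at h2)

theorem coeFn_innerL2 {k : X → H} (hk : MemLp k 2 μ) (h : H) :
    innerL2 hk h =ᵐ[μ] fun x => inner ℂ (k x) h :=
  MemLp.coeFn_toLp (hk.inner_const h)

theorem inner_innerL2 {k l : X → H} (hk : MemLp k 2 μ) (hl : MemLp l 2 μ) (h h' : H) :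
    inner ℂ (innerL2 hl h') (innerL2 hk h) = ∫ x, inner ℂ (k x) h * inner ℂ h' (l x) ∂μ := by
  rw [L2.inner_def]
  refine integral_congr_ae ?_
  filter_upwards [coeFn_innerL2 hk h, coeFn_innerL2 hl h'] with x h1 h2
  rw [h1, h2, RCLike.inner_apply, inner_conj_symm]

theorem integrable_inner_smul {k l : X → H} (hk : MemLp k 2 μ) (hl : MemLp l 2 μ) (h : H) :
    Integrable (fun x => inner ℂ (k x) h • l x) μ :=
  memLp_one_iff_integrable.1 (hl.smul (hk.inner_const h))

theorem integrable_inner_of_memLp {k l : X → H} (hk : MemLp k 2 μ) (hl : MemLp l 2 μ) :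
    Integrable (fun x => inner ℂ (k x) (l x)) μ :=
  (hk.norm.integrable_mul hl.norm).mono' (hk.1.inner hl.1)
    (Filter.Eventually.of_forall fun _ => norm_inner_le_norm _ _)

/-- This factors an integral of rank one operators through `L²(μ)`. -/
theorem innerL2_adjoint_comp_apply {k l : X → H} (hk : MemLp k 2 μ) (hl : MemLp l 2 μ) [CompleteSpace H] (h : H) :
    ((innerL2 hl).adjoint ∘L innerL2 hk) h = ∫ x, inner ℂ (k x) h • l x ∂μ := by
  have hint := integrable_inner_smul hk hl h
  refine ext_inner_left ℂ fun h' => ?_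
  rw [ContinuousLinearMap.comp_apply, ContinuousLinearMap.adjoint_inner_right, inner_innerL2,
    ← integral_inner hint]
  simp only [inner_smul_right]

theorem lintegral_enorm_sq_lt_top {H : Type} [NormedAddCommGroup H] {k : X → H} (hk : MemLp k 2 μ) : ∫⁻ x, ‖k x‖ₑ ^ 2 ∂μ < ∞ := by
  have := lintegral_rpow_enorm_lt_top_of_eLpNorm_lt_top (by norm_num) (by norm_num) hk.2
  simpa using this

variable [SecondCountableTopology H]

/-- Tonelli, then Parseval in `H` at each point: `innerL2` is a Hilbert-Schmidt operator. -/
theorem tsum_enorm_innerL2 {k : X → H} (hk : MemLp k 2 μ) {ι : Type*}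
    (e : HilbertBasis ι ℂ H) :
    ∑' i, ‖innerL2 hk (e i)‖ₑ ^ 2 = ∫⁻ x, ‖k x‖ₑ ^ 2 ∂μ := by
  have := countable_of_orthonormal e.orthonormal
  have h1 : ∀ i, ‖innerL2 hk (e i)‖ₑ ^ 2 = ∫⁻ x, ‖inner ℂ (e i) (k x)‖ₑ ^ 2 ∂μ := by
    intro i
    rw [Lp.enorm_def, eLpNorm_eq_lintegral_rpow_enorm_toReal (by norm_num) (by norm_num)]
    rw [← ENNReal.rpow_natCast, ← ENNReal.rpow_mul]
    norm_num
    refine lintegral_congr_ae ?_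
    filter_upwards [coeFn_innerL2 hk (e i)] with x hx
    rw [hx, ← inner_conj_symm, RCLike.enorm_conj]
  simp_rw [h1]
  rw [← lintegral_tsum]
  · exact lintegral_congr fun x => enorm_sq_eq_tsum e _
  · intro i
    exact ((aestronglyMeasurable_const.inner hk.1).enorm.pow_const 2)

variable [CompleteSpace H]

/-- The double sum of `|⟪f j, A (e i)⟫|²` can be taken in either order, so the adjoint is
Hilbert-Schmidt too. -/
theorem summable_adjoint_innerL2 {k : X → H} (hk : MemLp k 2 μ) {ι : Type*}
    (f : HilbertBasis ι ℂ (Lp ℂ 2 μ)) :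
    Summable fun j => ‖(innerL2 hk).adjoint (f j)‖ ^ 2 := by
  obtain ⟨w, e, -⟩ := exists_hilbertBasis ℂ H
  have h1 : ∑' j, ‖(innerL2 hk).adjoint (f j)‖ₑ ^ 2 < ∞ := by
    have h2 : ∀ j, ‖(innerL2 hk).adjoint (f j)‖ₑ ^ 2
        = ∑' i, ‖inner ℂ (f j) (innerL2 hk (e i))‖ₑ ^ 2 := fun j => by
      rw [← enorm_sq_eq_tsum e]
      refine tsum_congr fun i => ?_
      rw [ContinuousLinearMap.adjoint_inner_right, ← inner_conj_symm, RCLike.enorm_conj]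
    simp_rw [h2]
    rw [ENNReal.tsum_comm]
    simp_rw [enorm_sq_eq_tsum f]
    rw [tsum_enorm_innerL2 hk e]
    exact lintegral_enorm_sq_lt_top hk
  have h3 := ENNReal.summable_toReal h1.ne
  simpa using h3

/-- An integral of rank one operators `⟪k x, ·⟫ l x` with `k`, `l` square integrable is of trace
class. -/
theorem hasTrace_innerL2 [SecondCountableTopology (Lp ℂ 2 μ)] {k l : X → H}
    (hk : MemLp k 2 μ) (hl : MemLp l 2 μ) :
    HasTrace ((innerL2 hl).adjoint ∘L innerL2 hk) (∫ x, inner ℂ (k x) (l x) ∂μ) := by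
  constructor
  -- A basis `f` of the intermediate `L²` space is inserted between the two factors; `a j` and `b j`
  -- are its images under the two adjoints. Its index set is then embedded in `ℕ`, with zero terms
  -- elsewhere.
  · obtain ⟨w, f, -⟩ := exists_hilbertBasis ℂ (Lp ℂ 2 μ)
    have := countable_of_orthonormal f.orthonormal
    obtain ⟨g, hg⟩ := exists_injective_nat w
    set a : w → H := fun j => (innerL2 hk).adjoint (f j) with ha
    set b : w → H := fun j => (innerL2 hl).adjoint (f j) with hb
    have hsum : Summable fun j => ‖a j‖ * ‖b j‖ := by
      refine Summable.of_nonneg_of_le (fun _ => by positivity) (fun j => ?_)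
        ((summable_adjoint_innerL2 hk f).add (summable_adjoint_innerL2 hl f))
      nlinarith [sq_nonneg (‖a j‖ - ‖b j‖), sq_nonneg ‖a j‖, sq_nonneg ‖b j‖]
    refine ⟨Function.extend g a 0, Function.extend g b 0, ?_, fun x => ?_⟩
    · rw [← hg.summable_iff]
      · simpa [Function.comp_def, hg.extend_apply] using hsum
      · intro n hn
        rw [Function.extend_apply' _ _ _ (by simpa using hn)]
        simp
    · rw [← hg.hasSum_iff]
      · simp only [Function.comp_def, hg.extend_apply]
        have h1 := (f.hasSum_repr (innerL2 hk x)).mapL (innerL2 hl).adjoint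
        have h2 : (fun j => inner ℂ (a j) x • b j)
            = fun j => (innerL2 hl).adjoint (f.repr (innerL2 hk x) j • f j) := by
          ext j
          rw [map_smul, f.repr_apply_apply, ha]
          simp only [ContinuousLinearMap.adjoint_inner_left]
          rfl
        rw [h2]
        exact h1
      · intro n hn
        rw [Function.extend_apply' _ _ _ (by simpa using hn)]
        simp
  · intro ι e
    have := countable_of_orthonormal e.orthonormal
    have h0 : ∀ i, inner ℂ (e i) (((innerL2 hl).adjoint ∘L innerL2 hk) (e i))
        = ∫ x, inner ℂ (k x) (e i) * inner ℂ (e i) (l x) ∂μ := fun i => by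
      rw [ContinuousLinearMap.comp_apply, ContinuousLinearMap.adjoint_inner_right,
        inner_innerL2]
    simp_rw [h0]
    have hs : ∀ {k : X → H} (hk : MemLp k 2 μ), Summable fun i => ‖innerL2 hk (e i)‖ ^ 2 := by
      intro k hk
      have h1 := tsum_enorm_innerL2 hk e
      have h3 := ENNReal.summable_toReal (h1.trans_lt (lintegral_enorm_sq_lt_top hk)).ne
      simpa using h3
    have hint : ∀ i, Integrable (fun x => inner ℂ (k x) (e i) * inner ℂ (e i) (l x)) μ := by
      intro i
      have h1 := L2.integrable_inner (𝕜 := ℂ) (innerL2 hl (e i)) (innerL2 hk (e i))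
      refine h1.congr ?_
      filter_upwards [coeFn_innerL2 hk (e i), coeFn_innerL2 hl (e i)] with x h1 h2
      rw [h1, h2, RCLike.inner_apply, inner_conj_symm]
    -- The sum over the basis is taken under the integral, where it is Parseval's identity for `k x`
    -- and `l x`. Absolute convergence comes from `|a b| ≤ |a|² + |b|²` and the Hilbert-Schmidt
    -- sums.
    have key := hasSum_integral_of_summable_integral_norm hint ?_
    · simp_rw [fun x => (e.hasSum_inner_mul_inner (k x) (l x)).tsum_eq] at key
      exact key
    · refine Summable.of_nonneg_of_le (fun _ => integral_nonneg fun _ => norm_nonneg _)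
        (fun i => ?_) ((hs hk).add (hs hl))
      have hn : ∀ {k : X → H} (hk : MemLp k 2 μ), ‖innerL2 hk (e i)‖ ^ 2
          = ∫ x, ‖inner ℂ (k x) (e i)‖ ^ 2 ∂μ := by
        intro k hk
        have h1 : ((‖innerL2 hk (e i)‖ ^ 2 : ℝ) : ℂ)
            = ((∫ x, ‖inner ℂ (k x) (e i)‖ ^ 2 ∂μ : ℝ) : ℂ) := by
          have h2 := inner_innerL2 hk hk (e i) (e i)
          rw [inner_self_eq_norm_sq_to_K] at h2
          push_cast
          refine h2.trans ?_
          rw [← integral_complex_ofReal]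
          refine integral_congr_ae (Filter.Eventually.of_forall fun x => ?_)
          simp only
          rw [← inner_conj_symm (e i), Complex.mul_conj']
          push_cast; rfl
        exact_mod_cast h1
      have hi : ∀ {k : X → H} (hk : MemLp k 2 μ),
          Integrable (fun x => ‖inner ℂ (k x) (e i)‖ ^ 2) μ := fun hk =>
        (hk.inner_const (e i)).integrable_norm_pow (by norm_num)
      rw [hn hk, hn hl, ← integral_add (hi hk) (hi hl)]
      refine integral_mono (hint i).norm ((hi hk).add (hi hl)) fun x => ?_
      simp only [norm_mul]
      rw [← norm_inner_symm (l x)]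
      nlinarith [sq_nonneg (‖inner ℂ (k x) (e i)‖ - ‖inner ℂ (l x) (e i)‖),
        sq_nonneg ‖inner ℂ (k x) (e i)‖, sq_nonneg ‖inner ℂ (l x) (e i)‖]

end RankOne

theorem HasTrace.add {H : Type} [NormedAddCommGroup H] [InnerProductSpace ℂ H]
    {S T : H →L[ℂ] H} {z w : ℂ} (hS : HasTrace S z) (hT : HasTrace T w) :
    HasTrace (S + T) (z + w) := by
  constructor
  · obtain ⟨a, b, h1, h2⟩ := hS.1
    obtain ⟨a', b', h1', h2'⟩ := hT.1
    let φ := Equiv.natSumNatEquivNat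
    refine ⟨fun n => Sum.elim a a' (φ.symm n), fun n => Sum.elim b b' (φ.symm n), ?_, fun x => ?_⟩
    · rw [← φ.summable_iff]
      simp only [Function.comp_def, Equiv.symm_apply_apply]
      exact Summable.sum _ h1 h1'
    · rw [← φ.hasSum_iff]
      simp only [Function.comp_def, Equiv.symm_apply_apply]
      exact HasSum.sum (h2 x) (h2' x)
  · intro ι e
    simpa [inner_add_right] using (hS.2 ι e).add (hT.2 ι e)

end WaveTrace

end

/-! ### Continuity of Fourier multipliers in a parameter, and the `L²` transform against the `L¹`
transform. -/

noncomputable section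

namespace WaveTrace

open Filter Topology

theorem tendsto_toLp_two_of_dominated {X T : Type} [MeasurableSpace X] {μ : Measure X}
    {l : Filter T} [l.IsCountablyGenerated] {F : T → X → ℂ} {f : X → ℂ} {G : X → ℝ}
    (hF : ∀ t, MemLp (F t) 2 μ) (hf : MemLp f 2 μ) (hG : MemLp G 2 μ)
    (hb : ∀ᶠ t in l, ∀ᵐ x ∂μ, ‖F t x - f x‖ ≤ G x)
    (hl : ∀ᵐ x ∂μ, Tendsto (fun t => F t x) l (𝓝 (f x))) :
    Tendsto (fun t => (hF t).toLp) l (𝓝 hf.toLp) := by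
  rw [Lp.tendsto_Lp_iff_tendsto_eLpNorm'']
  have h1 : Tendsto (fun t => ∫⁻ x, ‖F t x - f x‖ₑ ^ 2 ∂μ) l (𝓝 (∫⁻ _, 0 ∂μ)) := by
    refine tendsto_lintegral_filter_of_dominated_convergence' (fun x => ‖G x‖ₑ ^ 2)
      (Eventually.of_forall fun t => (((hF t).1.sub hf.1).enorm.pow_const 2)) ?_ ?_ ?_
    · filter_upwards [hb] with t ht
      filter_upwards [ht] with x hx
      gcongr
      rw [enorm_le_iff_norm_le]
      exact hx.trans (le_abs_self _)
    · exact (lintegral_enorm_sq_lt_top hG).ne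
    · filter_upwards [hl] with x hx
      have h2 : Tendsto (fun t => F t x - f x) l (𝓝 0) := by
        simpa using hx.sub_const (f x)
      have h3 := (ENNReal.continuous_pow 2).tendsto _ |>.comp ((continuous_enorm.tendsto _).comp h2)
      simpa [Function.comp_def] using h3
  have h2 : ∀ t, eLpNorm (F t - f) 2 μ = (∫⁻ x, ‖F t x - f x‖ₑ ^ 2 ∂μ) ^ (1 / 2 : ℝ) := by
    intro t
    rw [eLpNorm_eq_lintegral_rpow_enorm_toReal (by norm_num) (by norm_num)]
    norm_num
  simp_rw [h2]
  have h3 := ((ENNReal.continuous_rpow_const (y := 1 / 2)).tendsto _).comp h1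
  simpa [Function.comp_def] using h3

/-- Strong continuity with locally bounded norms gives joint continuity. Norm continuity would be
too much to ask of the wave group. -/
theorem continuous_clm_uncurry {T X Y : Type*} [TopologicalSpace T] [NormedAddCommGroup X]
    [NormedSpace ℂ X] [NormedAddCommGroup Y] [NormedSpace ℂ Y] {A : T → X →L[ℂ] Y} {C : T → ℝ}
    (hA : ∀ x, Continuous fun t => A t x) (hC : Continuous C) (hb : ∀ t, ‖A t‖ ≤ C t) :
    Continuous fun p : T × X => A p.1 p.2 := by
  rw [continuous_iff_continuousAt]
  rintro ⟨t, x⟩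
  rw [ContinuousAt, tendsto_iff_norm_sub_tendsto_zero]
  have h1 : Tendsto (fun p : T × X => C p.1 * ‖p.2 - x‖ + ‖A p.1 x - A t x‖) (𝓝 (t, x))
      (𝓝 (C t * ‖x - x‖ + ‖A t x - A t x‖)) := by
    refine Continuous.tendsto (f := fun p : T × X => C p.1 * ‖p.2 - x‖ + ‖A p.1 x - A t x‖) ?_ _
    have := hA x
    fun_prop
  simp only [sub_self, norm_zero, mul_zero, add_zero] at h1
  refine squeeze_zero (fun _ => norm_nonneg _) (fun p => ?_) h1
  calc ‖A p.1 p.2 - A t x‖ = ‖A p.1 (p.2 - x) + (A p.1 x - A t x)‖ := by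
        rw [map_sub]; congr 1; abel
    _ ≤ _ := (norm_add_le _ _).trans (by
        gcongr
        exact (A p.1).le_of_opNorm_le (hb _) _)

section Multiplier

variable {d : ℕ}

theorem memLp_bcf_mul (m : BoundedContinuousFunction (E d) ℂ) (u : L2 d) :
    MemLp (fun ξ => m ξ * u ξ) 2 volume := by
  refine (Lp.memLp (mulL2 (MemLp.toLp m m.memLp_top) u)).ae_eq ?_
  filter_upwards [coeFn_mulL2 (MemLp.toLp m m.memLp_top) u, MemLp.coeFn_toLp m.memLp_top]
    with ξ h1 h2
  rw [h1, h2]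

theorem multiplier_eq (m : BoundedContinuousFunction (E d) ℂ) (f : L2 d) :
    multiplier m f = 𝓕⁻ ((memLp_bcf_mul m (𝓕 f)).toLp _) := by
  have h : mulL2 (MemLp.toLp m m.memLp_top) (𝓕 f) = (memLp_bcf_mul m (𝓕 f)).toLp _ := by
    ext1
    filter_upwards [coeFn_mulL2 (MemLp.toLp m m.memLp_top) (𝓕 f), MemLp.coeFn_toLp m.memLp_top,
      MemLp.coeFn_toLp (memLp_bcf_mul m (𝓕 f))] with ξ h1 h2 h3
    rw [h1, h2, h3]
  rw [← h]
  rfl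

theorem norm_multiplier_apply_le {m : BoundedContinuousFunction (E d) ℂ} {C : ℝ}
    (hm : ∀ ξ, ‖m ξ‖ ≤ C) (f : L2 d) : ‖multiplier m f‖ ≤ C * ‖f‖ := by
  rw [← Lp.norm_fourier_eq, ← Lp.norm_fourier_eq f]
  refine Lp.norm_le_mul_norm_of_ae_le_mul ?_
  filter_upwards [fourier_multiplier m f] with ξ h
  rw [h, norm_mul]
  gcongr
  exact hm ξ

theorem norm_multiplier_le {m : BoundedContinuousFunction (E d) ℂ} {C : ℝ}
    (hm : ∀ ξ, ‖m ξ‖ ≤ C) : ‖multiplier m‖ ≤ C :=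
  ContinuousLinearMap.opNorm_le_bound _ ((norm_nonneg _).trans (hm 0))
    (norm_multiplier_apply_le hm)

theorem inner_multiplier (m : BoundedContinuousFunction (E d) ℂ) (g f : L2 d) :
    inner ℂ g (multiplier m f)
      = ∫ ξ, m ξ * ((starRingEnd ℂ) ((𝓕 g : L2 d) ξ) * (𝓕 f : L2 d) ξ) := by
  rw [← Lp.inner_fourier_eq, L2.inner_def]
  refine integral_congr_ae ?_
  filter_upwards [fourier_multiplier m f] with ξ h
  rw [h, RCLike.inner_apply]
  ring

theorem L2_ext_fourier {f g : L2 d} (h : (𝓕 f : L2 d) =ᵐ[volume] (𝓕 g : L2 d)) : f = g :=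
  (Lp.fourierTransformₗᵢ (E d) ℂ).injective (Lp.ext h)

theorem continuous_multiplier_apply {T : Type} [TopologicalSpace T] [FirstCountableTopology T]
    {m : T → BoundedContinuousFunction (E d) ℂ} (hm : ∀ ξ, Continuous fun t => m t ξ) {C : T → ℝ}
    (hC : Continuous C) (hb : ∀ t ξ, ‖m t ξ‖ ≤ C t) (f : L2 d) :
    Continuous fun t => multiplier (m t) f := by
  simp_rw [multiplier_eq]
  refine (Lp.fourierTransformₗᵢ (E d) ℂ).symm.continuous.comp ?_
  rw [continuous_iff_continuousAt]
  intro t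
  refine tendsto_toLp_two_of_dominated (G := fun ξ => (2 * C t + 1) * ‖(𝓕 f : L2 d) ξ‖)
    (fun t => memLp_bcf_mul (m t) (𝓕 f)) (memLp_bcf_mul (m t) (𝓕 f))
    ((Lp.memLp (𝓕 f : L2 d)).norm.const_mul _) ?_ ?_
  · filter_upwards [hC.continuousAt.eventually_lt continuousAt_const (lt_add_one (C t))] with s hs
    refine Eventually.of_forall fun ξ => ?_
    rw [← sub_mul, norm_mul]
    gcongr
    calc _ ≤ ‖m s ξ‖ + ‖m t ξ‖ := norm_sub_le _ _
      _ ≤ C s + C t := add_le_add (hb _ _) (hb _ _)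
      _ ≤ _ := by linarith
  · exact Eventually.of_forall fun ξ => ((hm ξ).tendsto t).mul_const _

theorem continuous_multiplier {T : Type} [TopologicalSpace T] [FirstCountableTopology T]
    {m : T → BoundedContinuousFunction (E d) ℂ} (hm : ∀ ξ, Continuous fun t => m t ξ) {C : T → ℝ}
    (hC : Continuous C) (hb : ∀ t ξ, ‖m t ξ‖ ≤ C t) :
    Continuous fun p : T × L2 d => multiplier (m p.1) p.2 :=
  continuous_clm_uncurry (fun f => continuous_multiplier_apply hm hC hb f) hC
    fun t => norm_multiplier_le (hb t)

theorem integrable_conj_mul (u v : L2 d) :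
    Integrable (fun ξ => (starRingEnd ℂ) (u ξ) * v ξ) volume := by
  refine (L2.integrable_inner (𝕜 := ℂ) u v).congr (Eventually.of_forall fun ξ => ?_)
  simp only [RCLike.inner_apply, mul_comm]

/-- Pairing with `g` turns the vector integral into a double integral over `t` and `ξ`, and Fubini
applies. Operator identities thereby reduce to scalar integrals of symbols. -/
theorem integral_smul_multiplier {m : ℝ → BoundedContinuousFunction (E d) ℂ}
    (hm : Continuous fun p : ℝ × E d => m p.1 p.2) {C : ℝ → ℝ} (hC : Continuous C)
    (hb : ∀ t ξ, ‖m t ξ‖ ≤ C t) {c : ℝ → ℂ} (hc : Continuous c) {s : Set ℝ}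
    (hi : IntegrableOn (fun t => ‖c t‖ * C t) s) {M : BoundedContinuousFunction (E d) ℂ}
    (hM : ∀ ξ, ∫ t in s, c t * m t ξ = M ξ) (f : L2 d) :
    ∫ t in s, c t • multiplier (m t) f = multiplier M f := by
  have hm0 : ∀ ξ, Continuous fun t => m t ξ := fun ξ => by
    have h1 : Continuous fun t : ℝ => (t, ξ) := by fun_prop
    exact hm.comp h1
  have hcont : Continuous fun t => multiplier (m t) f := continuous_multiplier_apply hm0 hC hb f
  have hint : IntegrableOn (fun t => c t • multiplier (m t) f) s := by
    have h1 : AEStronglyMeasurable (fun t => c t • multiplier (m t) f) (volume.restrict s) :=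
      (hc.smul hcont).aestronglyMeasurable
    refine Integrable.mono' (g := fun t => ‖c t‖ * C t * ‖f‖) (hi.mul_const ‖f‖) h1
      (Eventually.of_forall fun t => ?_)
    rw [norm_smul, mul_assoc]
    gcongr
    exact norm_multiplier_apply_le (hb t) f
  refine ext_inner_left ℂ fun g => ?_
  rw [← integral_inner hint, inner_multiplier]
  simp_rw [inner_smul_right, inner_multiplier, ← integral_const_mul]
  rw [integral_integral_swap]
  · refine integral_congr_ae (Eventually.of_forall fun ξ => ?_)
    simp only
    rw [← hM, ← integral_mul_const]
    simp only [mul_assoc]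
  · have h1 := integrable_conj_mul (𝓕 g) (𝓕 f : L2 d)
    refine (Integrable.mul_prod hi h1.norm).mono' ?_ ?_
    · have h2 : AEStronglyMeasurable (fun p : ℝ × E d => c p.1 * m p.1 p.2)
          ((volume.restrict s).prod volume) :=
        ((hc.comp continuous_fst).mul hm).aestronglyMeasurable
      refine (h2.mul (h1.1.comp_snd)).congr (Eventually.of_forall fun p => ?_)
      simp only [Function.uncurry, Pi.mul_apply, mul_assoc]
    · refine Eventually.of_forall fun p => ?_
      simp only [Function.uncurry]
      rw [norm_mul, norm_mul (m p.1 p.2), mul_assoc]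
      gcongr
      exact hb _ _

/-! ### The Fourier transform on `L²` and on `L¹` -/

theorem ae_eq_of_schwartz {u : L2 d} {g : E d → ℂ} (hg : LocallyIntegrable g)
    (h : ∀ φ : 𝓢(E d, ℂ), ∫ x, φ x • u x = ∫ x, φ x • g x) : u =ᵐ[volume] g := by
  refine ae_eq_of_integral_contDiff_smul_eq ((Lp.memLp u).locallyIntegrable (by norm_num)) hg ?_
  intro φ hφ hc
  have hg₁ : HasCompactSupport (Complex.ofRealCLM ∘ φ) := hc.comp_left rfl
  have hg₂ : ContDiff ℝ ((⊤ : ℕ∞) : WithTop ℕ∞) (Complex.ofRealCLM ∘ φ) := by fun_prop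
  simpa using h (hg₁.toSchwartzMap hg₂)

theorem integral_smul_fourierInv (u : L2 d) (φ : 𝓢(E d, ℂ)) :
    ∫ x, φ x • (𝓕⁻ u : L2 d) x = ∫ ξ, (𝓕⁻ φ : 𝓢(E d, ℂ)) ξ • u ξ := by
  rw [← Lp.toTemperedDistribution_apply, ← Lp.toTemperedDistribution_apply,
    ← Lp.fourierInv_toTemperedDistribution_eq]
  rfl

/-- The two definitions of the transform agree because both are dual to the transform of Schwartz
functions. This is what later identifies an `L²` vector with an explicit kernel. -/
theorem fourierInv_ae_eq_of_fourier_eq {g : E d → ℂ} (hg : Integrable g) {u : L2 d}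
    (h : u =ᵐ[volume] 𝓕 g) : (𝓕⁻ u : L2 d) =ᵐ[volume] g := by
  refine ae_eq_of_schwartz hg.locallyIntegrable fun φ => ?_
  rw [integral_smul_fourierInv]
  have h1 : ∫ ξ, (𝓕⁻ φ : 𝓢(E d, ℂ)) ξ • u ξ = ∫ ξ, (𝓕⁻ φ : 𝓢(E d, ℂ)) ξ • 𝓕 g ξ := by
    refine integral_congr_ae ?_
    filter_upwards [h] with ξ hξ
    rw [hξ]
  rw [h1]
  have h2 := VectorFourier.integral_fourierIntegral_smul_eq_flip (L := innerₗ (E d))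
    (f := (𝓕⁻ φ : 𝓢(E d, ℂ))) (g := g) Real.continuous_fourierChar continuous_inner
    ((𝓕⁻ φ : 𝓢(E d, ℂ)).integrable (μ := volume)) hg
  have h3 : 𝓕 (𝓕⁻ φ : 𝓢(E d, ℂ)) = φ := FourierTransform.fourier_fourierInv_eq φ
  have h4 : ∀ x, φ x = 𝓕 ((𝓕⁻ φ : 𝓢(E d, ℂ)) : E d → ℂ) x := fun x => by
    rw [← SchwartzMap.fourier_coe, h3]
  simp_rw [h4]
  rw [flip_innerₗ] at h2
  exact h2.symm

theorem fourierInv_ae_eq_of_integrable {u : L2 d} {v : E d → ℂ} (hv : Integrable v)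
    (h : u =ᵐ[volume] v) : (𝓕⁻ u : L2 d) =ᵐ[volume] 𝓕⁻ v := by
  have h0 : Continuous (𝓕⁻ v) :=
    VectorFourier.fourierIntegral_continuous Real.continuous_fourierChar
      (by exact continuous_inner.neg) hv
  refine ae_eq_of_schwartz h0.locallyIntegrable fun φ => ?_
  rw [integral_smul_fourierInv]
  have h1 : ∫ ξ, (𝓕⁻ φ : 𝓢(E d, ℂ)) ξ • u ξ = ∫ ξ, (𝓕⁻ φ : 𝓢(E d, ℂ)) ξ • v ξ := by
    refine integral_congr_ae ?_
    filter_upwards [h] with ξ hξ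
    rw [hξ]
  rw [h1]
  have h2 := VectorFourier.integral_fourierIntegral_smul_eq_flip (L := -innerₗ (E d))
    (f := φ) (g := v) Real.continuous_fourierChar (by exact continuous_inner.neg)
    (φ.integrable (μ := volume)) hv
  simp_rw [SchwartzMap.fourierInv_coe]
  refine h2.trans ?_
  have h3 : (-innerₗ (E d)).flip = -innerₗ (E d) := by
    ext x y
    simp [real_inner_comm]
  rw [h3]
  rfl

end Multiplier

end WaveTrace

end

/-! ### The energy space, the free group, the Duhamel terms and time reversal. -/

noncomputable section

namespace WaveTrace

open Filter Topology

variable {d : ℕ}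

/-! ### Components of the energy space -/

instance secondCountableTopology_Lp_two {X : Type} [MeasurableSpace X] {μ : Measure X}
    [IsSeparable μ] : SecondCountableTopology (Lp ℂ 2 μ) := by
  have : Fact ((2 : ℝ≥0∞) ≠ ∞) := ⟨by norm_num⟩
  infer_instance

instance secondCountableTopology_jet : SecondCountableTopology (Jet d) :=
  WithLp.secondCountableTopology 2 _ _

instance secondCountableTopology_H1 : SecondCountableTopology (H1 d) :=
  inferInstanceAs (SecondCountableTopology {x : Jet d // x ∈ H1 d})

instance secondCountableTopology_energy : SecondCountableTopology (Energy d) :=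
  WithLp.secondCountableTopology 2 _ _

instance completeSpace_energy : CompleteSpace (Energy d) := inferInstance

/-- A shortcut for instance search. -/
abbrev energyNormedSpace : NormedSpace ℂ (Energy d) := inferInstance

/-- A shortcut for instance search. -/
abbrev energyNormedSpaceReal : NormedSpace ℝ (Energy d) := inferInstance

/-- A shortcut for instance search. -/
abbrev energyInnerProductSpace : InnerProductSpace ℂ (Energy d) := inferInstance

/-- A shortcut for instance search. -/
abbrev energyInner : Inner ℂ (Energy d) := energyInnerProductSpace.toInner

attribute [local instance] energyNormedSpace energyNormedSpaceReal energyInner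

/-- The first component of `(f, g)`, as an element of `L²`. -/
def Energy.pos : Energy d →L[ℂ] L2 d := H1.val ∘L WithLp.fstL 2 ℂ (H1 d) (L2 d)

/-- The derivatives of the first component of `(f, g)`. -/
def Energy.grad (j : Fin d) : Energy d →L[ℂ] L2 d := H1.deriv j ∘L WithLp.fstL 2 ℂ (H1 d) (L2 d)

/-- The second component of `(f, g)`. -/
def Energy.vel : Energy d →L[ℂ] L2 d := WithLp.sndL 2 ℂ (H1 d) (L2 d)

/-- The vector `(0, g)`. -/
def Energy.inr : L2 d →L[ℂ] Energy d := mkEnergy 0 (ContinuousLinearMap.id ℂ (L2 d))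

theorem norm_withLp_le {α β : Type*} [NormedAddCommGroup α] [NormedAddCommGroup β]
    (x : WithLp 2 (α × β)) : ‖x‖ ≤ ‖x.fst‖ + ‖x.snd‖ := by
  rw [WithLp.prod_norm_eq_of_L2]
  refine Real.sqrt_le_iff.2 ⟨by positivity, ?_⟩
  nlinarith [norm_nonneg x.fst, norm_nonneg x.snd]

theorem norm_fst_le_withLp {α β : Type*} [NormedAddCommGroup α] [NormedAddCommGroup β]
    (x : WithLp 2 (α × β)) : ‖x.fst‖ ≤ ‖x‖ := by
  rw [WithLp.prod_norm_eq_of_L2]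
  exact Real.le_sqrt_of_sq_le (by nlinarith [norm_nonneg x.snd])

theorem norm_snd_le_withLp {α β : Type*} [NormedAddCommGroup α] [NormedAddCommGroup β]
    (x : WithLp 2 (α × β)) : ‖x.snd‖ ≤ ‖x‖ := by
  rw [WithLp.prod_norm_eq_of_L2]
  exact Real.le_sqrt_of_sq_le (by nlinarith [norm_nonneg x.fst])

theorem norm_piLp_le {ι : Type*} [Fintype ι] {β : ι → Type*} [∀ i, NormedAddCommGroup (β i)]
    (x : PiLp 2 β) : ‖x‖ ≤ ∑ i, ‖x i‖ := by
  rw [PiLp.norm_eq_of_L2]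
  refine Real.sqrt_le_iff.2 ⟨by positivity, ?_⟩
  exact Finset.sum_sq_le_sq_sum_of_nonneg fun i _ => norm_nonneg _

theorem norm_energy_le (h : Energy d) :
    ‖h‖ ≤ ‖Energy.pos h‖ + ∑ j, ‖Energy.grad j h‖ + ‖Energy.vel h‖ := by
  refine (norm_withLp_le h).trans ?_
  have h1 : ‖h.fst‖ ≤ ‖(h.fst : Jet d).fst‖ + ‖(h.fst : Jet d).snd‖ :=
    norm_withLp_le (h.fst : Jet d)
  have h2 := norm_piLp_le (h.fst : Jet d).snd
  have h3 : ‖h.fst‖ ≤ ‖Energy.pos h‖ + ∑ j, ‖Energy.grad j h‖ :=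
    h1.trans (add_le_add le_rfl h2)
  exact add_le_add h3 le_rfl

theorem norm_pos_le (h : Energy d) : ‖Energy.pos h‖ ≤ ‖h‖ :=
  (norm_fst_le_withLp (h.fst : Jet d)).trans (norm_fst_le_withLp h)

theorem norm_grad_le (j : Fin d) (h : Energy d) : ‖Energy.grad j h‖ ≤ ‖h‖ :=
  (PiLp.norm_apply_le (h.fst : Jet d).snd j).trans
    ((norm_snd_le_withLp (h.fst : Jet d)).trans (norm_fst_le_withLp h))

theorem norm_vel_le (h : Energy d) : ‖Energy.vel h‖ ≤ ‖h‖ := norm_snd_le_withLp h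

theorem energy_ext {h h' : Energy d} (h1 : Energy.pos h = Energy.pos h')
    (h2 : ∀ j, Energy.grad j h = Energy.grad j h') (h3 : Energy.vel h = Energy.vel h') :
    h = h' := by
  rw [← sub_eq_zero, ← norm_le_zero_iff]
  refine (norm_energy_le _).trans (le_of_eq ?_)
  simp [map_sub, h1, h2, h3]

theorem continuous_energy {T : Type*} [TopologicalSpace T] {F : T → Energy d}
    (h1 : Continuous fun t => Energy.pos (F t)) (h2 : ∀ j, Continuous fun t => Energy.grad j (F t))
    (h3 : Continuous fun t => Energy.vel (F t)) : Continuous F := by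
  rw [continuous_iff_continuousAt]
  intro t
  rw [ContinuousAt, tendsto_iff_norm_sub_tendsto_zero]
  refine squeeze_zero (fun _ => norm_nonneg _) (fun s => norm_energy_le _) ?_
  have h : Continuous fun s => ‖Energy.pos (F s) - Energy.pos (F t)‖
      + ∑ j, ‖Energy.grad j (F s) - Energy.grad j (F t)‖
      + ‖Energy.vel (F s) - Energy.vel (F t)‖ := by fun_prop
  have h4 := h.tendsto t
  simpa [map_sub] using h4

theorem pos_freeWave (t : ℝ) (h : Energy d) : Energy.pos (freeWave t h)
    = multiplier (cosSymbol d t) (Energy.pos h) + multiplier (sinSymbol d t) (Energy.vel h) := rfl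

theorem grad_freeWave (j : Fin d) (t : ℝ) (h : Energy d) : Energy.grad j (freeWave t h)
    = multiplier (cosSymbol d t) (Energy.grad j h)
      + multiplier (gradSinSymbol j t) (Energy.vel h) := rfl

theorem vel_freeWave (t : ℝ) (h : Energy d) : Energy.vel (freeWave t h)
    = (∑ j, multiplier (gradSinSymbol j t) (Energy.grad j h))
      + multiplier (cosSymbol d t) (Energy.vel h) := by
  have : Energy.vel (freeWave t h)
    = laplacianSin t h.fst + multiplier (cosSymbol d t) (Energy.vel h) := rfl
  rw [this, laplacianSin, sum_apply]
  rfl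

theorem potential_apply (V : Linfty d) (h : Energy d) :
    potential V h = Energy.inr (mulL2 V (Energy.pos h)) := rfl

theorem pos_inr (g : L2 d) : Energy.pos (Energy.inr g) = 0 :=
  map_zero (H1.val (d := d))

theorem grad_inr (j : Fin d) (g : L2 d) : Energy.grad j (Energy.inr g) = 0 :=
  map_zero (H1.deriv j)

theorem vel_inr (g : L2 d) : Energy.vel (Energy.inr g) = g := rfl

/-! ### Bounds and continuity of the free group -/

theorem norm_cosSymbol_le (t : ℝ) (ξ : E d) : ‖cosSymbol d t ξ‖ ≤ 1 := by
  simp only [cosSymbol, BoundedContinuousFunction.coe_ofNormedAddCommGroup, Complex.norm_real]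
  exact Real.abs_cos_le_one _

theorem norm_sinSymbol_le (t : ℝ) (ξ : E d) : ‖sinSymbol d t ξ‖ ≤ |t| :=
  (BoundedContinuousFunction.norm_coe_le_norm _ ξ).trans
    (BoundedContinuousFunction.norm_ofNormedAddCommGroup_le _ (abs_nonneg t) _)

theorem norm_gradSinSymbol_le (j : Fin d) (t : ℝ) (ξ : E d) : ‖gradSinSymbol j t ξ‖ ≤ 1 :=
  (BoundedContinuousFunction.norm_coe_le_norm _ ξ).trans
    (BoundedContinuousFunction.norm_ofNormedAddCommGroup_le _ zero_le_one _)

theorem continuous_cosSymbol : Continuous fun p : ℝ × E d => cosSymbol d p.1 p.2 := by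
  simp only [cosSymbol, BoundedContinuousFunction.coe_ofNormedAddCommGroup]
  fun_prop

theorem continuous_sinSymbol : Continuous fun p : ℝ × E d => sinSymbol d p.1 p.2 := by
  simp only [sinSymbol, BoundedContinuousFunction.coe_ofNormedAddCommGroup]
  have := Real.continuous_sinc
  fun_prop

theorem continuous_gradSinSymbol (j : Fin d) :
    Continuous fun p : ℝ × E d => gradSinSymbol j p.1 p.2 := by
  simp only [gradSinSymbol, BoundedContinuousFunction.coe_ofNormedAddCommGroup]
  have := continuous_sinSymbol (d := d)
  fun_prop

/-- The position contributes `1 + |t|`, each derivative `2`, and the velocity `d + 1`; the sum `3 d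
+ 2 + |t|` is at most the constant used. -/
theorem norm_freeWave_apply_le (t : ℝ) (h : Energy d) :
    ‖freeWave t h‖ ≤ (3 * d + 2) * (1 + |t|) * ‖h‖ := by
  have hc : ∀ u : L2 d, ‖multiplier (cosSymbol d t) u‖ ≤ 1 * ‖u‖ :=
    norm_multiplier_apply_le (norm_cosSymbol_le t)
  have hs : ∀ u : L2 d, ‖multiplier (sinSymbol d t) u‖ ≤ |t| * ‖u‖ :=
    norm_multiplier_apply_le (norm_sinSymbol_le t)
  have hg : ∀ j, ∀ u : L2 d, ‖multiplier (gradSinSymbol j t) u‖ ≤ 1 * ‖u‖ := fun j =>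
    norm_multiplier_apply_le (norm_gradSinSymbol_le j t)
  have h0 := norm_nonneg h
  have h1 : ‖Energy.pos (freeWave t h)‖ ≤ 1 * ‖h‖ + |t| * ‖h‖ := by
    rw [pos_freeWave]
    refine (norm_add_le _ _).trans (add_le_add ((hc _).trans ?_) ((hs _).trans ?_))
    · gcongr; exact norm_pos_le h
    · gcongr; exact norm_vel_le h
  have h2 : ∀ j, ‖Energy.grad j (freeWave t h)‖ ≤ 1 * ‖h‖ + 1 * ‖h‖ := fun j => by
    rw [grad_freeWave]
    refine (norm_add_le _ _).trans (add_le_add ((hc _).trans ?_) ((hg j _).trans ?_))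
    · gcongr; exact norm_grad_le j h
    · gcongr; exact norm_vel_le h
  have h3 : ‖Energy.vel (freeWave t h)‖ ≤ (∑ _j : Fin d, 1 * ‖h‖) + 1 * ‖h‖ := by
    rw [vel_freeWave]
    refine (norm_add_le _ _).trans (add_le_add ((norm_sum_le _ _).trans
      (Finset.sum_le_sum fun j _ => (hg j _).trans ?_)) ((hc _).trans ?_))
    · gcongr; exact norm_grad_le j h
    · gcongr; exact norm_vel_le h
  have h4 := Finset.sum_le_sum fun j (_ : j ∈ Finset.univ) => h2 j
  simp only [Finset.sum_const, Finset.card_univ, Fintype.card_fin, nsmul_eq_mul] at h3 h4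
  have h5 : 0 ≤ (3 * d + 1 : ℝ) * (|t| * ‖h‖) := by positivity
  have := norm_energy_le (freeWave t h)
  nlinarith

theorem continuous_freeWave : Continuous fun p : ℝ × Energy d => freeWave p.1 p.2 := by
  refine continuous_clm_uncurry (X := Energy d) (Y := Energy d) (A := freeWave)
    (C := fun t => (3 * d + 2) * (1 + |t|)) (fun h => ?_)
    (by fun_prop) fun t => ContinuousLinearMap.opNorm_le_bound _ (by positivity)
      (norm_freeWave_apply_le t)
  have hm : ∀ {m : ℝ → BoundedContinuousFunction (E d) ℂ},
      (Continuous fun p : ℝ × E d => m p.1 p.2) → ∀ ξ, Continuous fun t => m t ξ := by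
    intro m hm ξ
    have h1 : Continuous fun t : ℝ => (t, ξ) := by fun_prop
    exact hm.comp h1
  have hc : ∀ u : L2 d, Continuous fun t => multiplier (cosSymbol d t) u :=
    continuous_multiplier_apply (hm continuous_cosSymbol) continuous_const norm_cosSymbol_le
  have hs : ∀ u : L2 d, Continuous fun t => multiplier (sinSymbol d t) u :=
    continuous_multiplier_apply (hm continuous_sinSymbol) continuous_abs norm_sinSymbol_le
  have hg : ∀ j, ∀ u : L2 d, Continuous fun t => multiplier (gradSinSymbol j t) u := fun j =>
    continuous_multiplier_apply (hm (continuous_gradSinSymbol j)) continuous_const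
      (norm_gradSinSymbol_le j)
  refine continuous_energy ?_ (fun j => ?_) ?_
  · simp only [pos_freeWave]
    exact (hc _).add (hs _)
  · simp only [grad_freeWave]
    exact (hc _).add (hg j _)
  · simp only [vel_freeWave]
    exact (continuous_finsetSum _ fun j _ => hg j _).add (hc _)

theorem _root_.Continuous.freeWave {T : Type*} [TopologicalSpace T] {a : T → ℝ} {b : T → Energy d}
    (ha : Continuous a) (hb : Continuous b) : Continuous fun t => freeWave (a t) (b t) :=
  Continuous.comp (g := fun p : ℝ × Energy d => WaveTrace.freeWave p.1 p.2) continuous_freeWave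
    (f := fun t => (a t, b t)) (ha.prodMk hb)

theorem continuous_freeWave_apply (h : Energy d) : Continuous fun t => freeWave t h :=
  continuous_id.freeWave continuous_const

/-! ### Bounds and continuity of the Duhamel terms -/

theorem continuous_duhamel (V : Linfty d) (k : ℕ) (h : Energy d) :
    Continuous fun t => duhamel V k t h := by
  induction k with
  | zero => exact continuous_freeWave_apply h
  | succ k ih =>
    simp only [duhamel]
    refine intervalIntegral.continuous_parametric_intervalIntegral_of_continuous ?_ continuous_id
    exact (continuous_fst.sub continuous_snd).freeWave
      (((potential V).continuous.comp ih).comp continuous_snd)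

/-- Each Duhamel integral costs two powers of `1 + t`, one from the group and one from the length of
the interval. Polynomial growth is all that the Laplace transform on `Re z = 1` requires. -/
theorem exists_norm_duhamel_le (V : Linfty d) (k : ℕ) (h : Energy d) :
    ∃ C, 0 ≤ C ∧ ∀ t, 0 ≤ t → ‖duhamel V k t h‖ ≤ C * (1 + t) ^ (2 * k + 1) := by
  induction k with
  | zero =>
    refine ⟨(3 * d + 2) * ‖h‖, by positivity, fun t ht => ?_⟩
    have := norm_freeWave_apply_le t h
    rw [abs_of_nonneg ht] at this
    simpa [duhamel, mul_right_comm] using this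
  | succ k ih =>
    obtain ⟨C, hC, hb⟩ := ih
    refine ⟨(3 * d + 2) * (‖potential V‖ * C), by positivity, fun t ht => ?_⟩
    simp only [duhamel]
    have h1 : ∀ s ∈ Set.uIoc 0 t, ‖freeWave (t - s) (potential V (duhamel V k s h))‖
        ≤ (3 * d + 2) * (‖potential V‖ * C) * (1 + t) ^ (2 * k + 2) := by
      intro s hs
      rw [Set.uIoc_of_le ht] at hs
      refine (norm_freeWave_apply_le _ _).trans ?_
      rw [abs_of_nonneg (sub_nonneg.2 hs.2)]
      have h2 : ‖potential V (duhamel V k s h)‖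
          ≤ ‖potential V‖ * (C * (1 + t) ^ (2 * k + 1)) := by
        refine ((potential V).le_opNorm _).trans ?_
        gcongr
        refine (hb s hs.1.le).trans ?_
        have := hs.1
        have := hs.2
        gcongr
      calc _ ≤ (3 * d + 2) * (1 + t) * (‖potential V‖ * (C * (1 + t) ^ (2 * k + 1))) := by
            have := hs.1
            gcongr
            linarith
        _ = _ := by ring
    refine (intervalIntegral.norm_integral_le_of_norm_le_const h1).trans ?_
    rw [sub_zero, abs_of_nonneg ht]
    calc _ ≤ (3 * d + 2) * (‖potential V‖ * C) * (1 + t) ^ (2 * k + 2) * (1 + t) := by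
          gcongr; linarith
      _ = _ := by ring

/-! ### Time reversal -/

/-- `(f, g) ↦ (f, -g)`. -/
def timeReversal : Energy d →L[ℂ] Energy d :=
  mkEnergy (WithLp.fstL 2 ℂ (H1 d) (L2 d)) (-WithLp.sndL 2 ℂ (H1 d) (L2 d))

theorem pos_timeReversal (h : Energy d) : Energy.pos (timeReversal h) = Energy.pos h := rfl

theorem grad_timeReversal (j : Fin d) (h : Energy d) :
    Energy.grad j (timeReversal h) = Energy.grad j h := rfl

theorem vel_timeReversal (h : Energy d) : Energy.vel (timeReversal h) = -Energy.vel h := rfl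

theorem inner_timeReversal (h h' : Energy d) :
    inner ℂ (timeReversal h) h' = inner ℂ h (timeReversal h') := by
  rw [WithLp.prod_inner_apply, WithLp.prod_inner_apply]
  change inner ℂ h.fst h'.fst + inner ℂ (-h.snd) h'.snd
    = inner ℂ h.fst h'.fst + inner ℂ h.snd (-h'.snd)
  rw [inner_neg_left, inner_neg_right]

theorem timeReversal_timeReversal (h : Energy d) : timeReversal (timeReversal h) = h :=
  energy_ext rfl (fun _ => rfl) (neg_neg _)

theorem multiplier_neg_apply (m : BoundedContinuousFunction (E d) ℂ) (f : L2 d) :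
    multiplier (-m) f = -multiplier m f := by
  refine L2_ext_fourier ?_
  have h1 : (𝓕 (-multiplier m f) : L2 d) = -𝓕 (multiplier m f) :=
    (Lp.fourierTransformₗᵢ (E d) ℂ).map_neg _
  rw [h1]
  filter_upwards [fourier_multiplier m f, fourier_multiplier (-m) f,
    Lp.coeFn_neg (𝓕 (multiplier m f) : L2 d)] with ξ h1 h2 h3
  rw [h2, h3, Pi.neg_apply, h1]
  simp

/-- The diagonal symbols are even in `t` and the off-diagonal ones odd, while conjugation by
`timeReversal` flips exactly the off-diagonal entries. -/
theorem freeWave_neg (t : ℝ) (h : Energy d) :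
    freeWave (-t) h = timeReversal (freeWave t (timeReversal h)) := by
  have h1 : cosSymbol d (-t) = cosSymbol d t := by
    ext ξ; simp [cosSymbol]
  have h2 : sinSymbol d (-t) = -sinSymbol d t := by
    ext ξ; simp [sinSymbol]
  have h3 : ∀ j : Fin d, gradSinSymbol j (-t) = -gradSinSymbol j t := fun j => by
    ext ξ; simp [gradSinSymbol, h2]
  refine energy_ext ?_ (fun j => ?_) ?_
  · rw [pos_timeReversal, pos_freeWave, pos_freeWave, pos_timeReversal, vel_timeReversal, h1, h2,
      multiplier_neg_apply, map_neg]
  · rw [grad_timeReversal, grad_freeWave, grad_freeWave, grad_timeReversal, vel_timeReversal, h1,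
      h3, multiplier_neg_apply, map_neg]
  · rw [vel_timeReversal, vel_freeWave, vel_freeWave, vel_timeReversal, h1, map_neg, neg_add,
      neg_neg, ← Finset.sum_neg_distrib]
    simp only [h3, multiplier_neg_apply, grad_timeReversal]

theorem duhamel_neg (V : Linfty d) (k : ℕ) (t : ℝ) (h : Energy d) :
    duhamel V k (-t) h = timeReversal (duhamel V k t (timeReversal h)) := by
  induction k generalizing t with
  | zero => exact freeWave_neg t h
  | succ k ih =>
    simp only [duhamel]
    have h1 := intervalIntegral.integral_comp_neg (a := 0) (b := t)
      (fun s => freeWave (-t - s) (potential V (duhamel V k s h)))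
    rw [neg_zero] at h1
    rw [intervalIntegral.integral_symm, ← h1, ← intervalIntegral.integral_neg,
      ← timeReversal.intervalIntegral_comp_comm]
    · refine intervalIntegral.integral_congr fun s _ => ?_
      have h2 : -t - -s = -(t - s) := by ring
      -- This sign cancels the one produced by the substitution `s ↦ -s`.
      have h3 : ∀ e : Energy d, timeReversal (potential V (timeReversal e)) = -potential V e := by
        intro e
        refine energy_ext ?_ (fun j => ?_) ?_
        · simp [pos_timeReversal, potential_apply, pos_inr]
        · simp [grad_timeReversal, potential_apply, grad_inr]
        · simp [vel_timeReversal, pos_timeReversal, potential_apply, vel_inr]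
      simp only [ih, h2, freeWave_neg, h3, map_neg, neg_neg]
    · exact (((continuous_const.sub continuous_id).freeWave ((potential V).continuous.comp
        (continuous_duhamel V k _)))).intervalIntegrable _ _

end WaveTrace

end

/-! ### Laplace transforms of the free group and of the Duhamel terms on the line `Re z = 1`. -/

noncomputable section

namespace WaveTrace

open Filter Topology

variable {d : ℕ}

attribute [local instance] energyNormedSpace energyNormedSpaceReal energyInner

/-! ### The resolvent symbol -/

/-- The line `Re z = 1`. -/
def zline (w : ℝ) : ℂ := 1 - 2 * Real.pi * Complex.I * w

theorem zline_re (w : ℝ) : (zline w).re = 1 := by simp [zline]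

theorem norm_zline_sub_one (w : ℝ) : ‖zline w - 1‖ = 2 * Real.pi * |w| := by
  simp [zline, abs_of_pos Real.pi_pos]

theorem norm_zline_le (w : ℝ) : ‖zline w‖ ≤ 1 + 2 * Real.pi * |w| := by
  have := norm_add_le (zline w - 1) 1
  rw [norm_zline_sub_one] at this
  simp only [sub_add_cancel, norm_one] at this
  linarith

theorem continuous_zline : Continuous zline := by unfold zline; fun_prop

theorem norm_cexp_zline (w t : ℝ) : ‖Complex.exp (-zline w * t)‖ = Real.exp (-t) := by
  rw [Complex.norm_exp]; simp [zline_re]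

/-- The symbol of `(z² - Δ)⁻¹`. -/
def greenSymbol (d : ℕ) (z : ℂ) (ξ : E d) : ℂ := (z ^ 2 + ((2 * Real.pi * ‖ξ‖ : ℝ) : ℂ) ^ 2)⁻¹

/-- In `z² + a² = (z + ia)(z - ia)` both factors have real part `z.re`. -/
theorem re_sq_le_norm_sq_add_sq {z : ℂ} (hz : 0 < z.re) (a : ℝ) :
    z.re ^ 2 ≤ ‖z ^ 2 + (a : ℂ) ^ 2‖ := by
  have h1 : z ^ 2 + (a : ℂ) ^ 2 = (z + a * Complex.I) * (z - a * Complex.I) := by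
    ring_nf; simp
  have h2 : z.re ≤ ‖z + a * Complex.I‖ := by
    simpa using Complex.re_le_norm (z + a * Complex.I)
  have h3 : z.re ≤ ‖z - a * Complex.I‖ := by
    simpa using Complex.re_le_norm (z - a * Complex.I)
  rw [h1, norm_mul, sq]
  gcongr

theorem sq_add_sq_ne_zero {z : ℂ} (hz : 0 < z.re) (a : ℝ) : z ^ 2 + (a : ℂ) ^ 2 ≠ 0 := by
  have := re_sq_le_norm_sq_add_sq hz a
  intro h
  rw [h, norm_zero] at this
  nlinarith [pow_pos hz 2]

theorem continuous_greenSymbol {T : Type*} [TopologicalSpace T] {z : T → ℂ} {ξ : T → E d}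
    (hz : Continuous z) (hz' : ∀ t, 0 < (z t).re) (hξ : Continuous ξ) :
    Continuous fun t => greenSymbol d (z t) (ξ t) := by
  unfold greenSymbol
  exact Continuous.inv₀ (by fun_prop) fun t => sq_add_sq_ne_zero (hz' t) _

/-- With `b = 2π|ξ|`, write `1 + b² = (z² + b²) - (z - 1)(z + 1)` and use `|z² + b²| ≥ 1`. The
symbol at `z` is thus compared with the one at `1`, at a cost polynomial in `w`. -/
theorem norm_greenSymbol_zline_le (w : ℝ) (ξ : E d) : ‖greenSymbol d (zline w) ξ‖
    ≤ (1 + 2 * Real.pi * |w|) ^ 2 * (1 + (2 * Real.pi * ‖ξ‖) ^ 2)⁻¹ := by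
  have h1 := re_sq_le_norm_sq_add_sq (z := zline w) (by simp [zline_re]) (2 * Real.pi * ‖ξ‖)
  rw [zline_re, one_pow] at h1
  set N := ‖zline w ^ 2 + ((2 * Real.pi * ‖ξ‖ : ℝ) : ℂ) ^ 2‖ with hN
  set a := 2 * Real.pi * |w| with ha
  have ha0 : 0 ≤ a := by positivity
  have h2 : 1 + (2 * Real.pi * ‖ξ‖) ^ 2 ≤ N + a * (2 + a) := by
    have h3 : ‖((1 + (2 * Real.pi * ‖ξ‖) ^ 2 : ℝ) : ℂ)‖ ≤ N + ‖(zline w - 1) * (zline w + 1)‖ := by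
      refine le_trans (le_of_eq ?_) (norm_sub_le _ _)
      congr 1
      push_cast
      ring
    rw [Complex.norm_real, Real.norm_of_nonneg (by positivity), norm_mul, norm_zline_sub_one,
      ← ha] at h3
    refine h3.trans ?_
    gcongr
    refine (norm_add_le _ _).trans ?_
    rw [norm_one]
    linarith [norm_zline_le w]
  rw [greenSymbol, norm_inv, ← hN]
  have h4 : 0 < 1 + (2 * Real.pi * ‖ξ‖) ^ 2 := by positivity
  rw [inv_le_iff_one_le_mul₀ (by linarith), mul_right_comm, ← div_eq_mul_inv, le_div_iff₀ h4]
  nlinarith [mul_nonneg (mul_nonneg ha0 (by linarith : 0 ≤ 2 + a)) (sub_nonneg.2 h1)]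

theorem norm_greenSymbol_zline_le_one (w : ℝ) (ξ : E d) : ‖greenSymbol d (zline w) ξ‖ ≤ 1 := by
  have h1 := re_sq_le_norm_sq_add_sq (z := zline w) (by simp [zline_re]) (2 * Real.pi * ‖ξ‖)
  rw [zline_re, one_pow] at h1
  rw [greenSymbol, norm_inv]
  exact inv_le_one_of_one_le₀ h1

/-- The symbol of `(z² - Δ)⁻¹` for `z` on the line `Re z = 1`. -/
def resSym (d : ℕ) (w : ℝ) : BoundedContinuousFunction (E d) ℂ :=
  BoundedContinuousFunction.ofNormedAddCommGroup (greenSymbol d (zline w))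
    (continuous_greenSymbol continuous_const (fun _ => by simp [zline_re]) continuous_id) 1
    (norm_greenSymbol_zline_le_one w)

theorem resSym_apply (w : ℝ) (ξ : E d) : resSym d w ξ = greenSymbol d (zline w) ξ := rfl

theorem multiplier_smul_apply (c : ℂ) (m : BoundedContinuousFunction (E d) ℂ) (f : L2 d) :
    multiplier (c • m) f = c • multiplier m f := by
  refine L2_ext_fourier ?_
  have h1 : (𝓕 (c • multiplier m f) : L2 d) = c • 𝓕 (multiplier m f) :=
    (Lp.fourierTransformₗᵢ (E d) ℂ).map_smul _ _
  rw [h1]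
  filter_upwards [fourier_multiplier m f, fourier_multiplier (c • m) f,
    Lp.coeFn_smul c (𝓕 (multiplier m f) : L2 d)] with ξ h1 h2 h3
  rw [h2, h3, Pi.smul_apply, h1]
  simp [mul_assoc]

/-! ### Laplace transforms -/

theorem integrableOn_exp_neg_mul_one_add_pow (n : ℕ) :
    IntegrableOn (fun t : ℝ => Real.exp (-t) * (1 + t) ^ n) (Set.Ioi 0) := by
  have h1 : IntegrableOn (fun t : ℝ => 2 ^ n * n.factorial * Real.exp (1 / 2)
      * Real.exp (-(1 / 2) * t)) (Set.Ioi 0) :=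
    (integrableOn_exp_mul_Ioi (by norm_num) 0).const_mul _
  refine Integrable.mono' h1 (by fun_prop) ?_
  refine (ae_restrict_iff' measurableSet_Ioi).2 (Eventually.of_forall fun t (ht : 0 < t) => ?_)
  rw [Real.norm_of_nonneg (by positivity)]
  -- Half of the exponential decay is spent on the power, through `x^n / n! ≤ e^x` at `x = (1 + t) /
  -- 2`.
  have h2 := Real.pow_div_factorial_le_exp ((1 + t) / 2) (by positivity) n
  rw [div_le_iff₀ (by positivity), div_pow, div_le_iff₀ (by positivity)] at h2
  calc _ ≤ Real.exp (-t) * (Real.exp ((1 + t) / 2) * n.factorial * 2 ^ n) := by gcongr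
    _ = 2 ^ n * n.factorial * (Real.exp (-t) * Real.exp ((1 + t) / 2)) := by ring
    _ = 2 ^ n * n.factorial * (Real.exp (1 / 2) * Real.exp (-(1 / 2) * t)) := by
        rw [← Real.exp_add, ← Real.exp_add]; ring_nf
    _ = _ := by ring

theorem integrableOn_cexp_smul {Y : Type*} [NormedAddCommGroup Y] [NormedSpace ℂ Y] {G : ℝ → Y}
    (hG : Continuous G) {C : ℝ} {n : ℕ} (hb : ∀ t, 0 ≤ t → ‖G t‖ ≤ C * (1 + t) ^ n) (w : ℝ) :
    IntegrableOn (fun t : ℝ => Complex.exp (-zline w * t) • G t) (Set.Ioi 0) := by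
  refine Integrable.mono' ((integrableOn_exp_neg_mul_one_add_pow n).const_mul C)
    (Continuous.aestronglyMeasurable (by fun_prop)) ?_
  refine (ae_restrict_iff' measurableSet_Ioi).2 (Eventually.of_forall fun t (ht : 0 < t) => ?_)
  rw [norm_smul, norm_cexp_zline]
  calc _ ≤ Real.exp (-t) * (C * (1 + t) ^ n) := by gcongr; exact hb t ht.le
    _ = _ := by ring

theorem integrableOn_cexp_freeWave (w : ℝ) (h : Energy d) :
    IntegrableOn (fun t : ℝ => Complex.exp (-zline w * t) • freeWave t h) (Set.Ioi 0) :=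
  integrableOn_cexp_smul (n := 1) (C := (3 * d + 2) * ‖h‖) (continuous_freeWave_apply h)
    (fun t ht => by
      have := norm_freeWave_apply_le t h
      rw [abs_of_nonneg ht] at this
      rw [pow_one]
      linarith) w

/-- An upper bound for the norm of `∫₀^∞ exp (-z t) U₀(t) dt` on the line `Re z = 1`. -/
def waveBound (d : ℕ) : ℝ := ∫ t in Set.Ioi (0 : ℝ), Real.exp (-t) * ((3 * d + 2) * (1 + t) ^ 1)

theorem norm_integral_cexp_freeWave_le (w : ℝ) (h : Energy d) :
    ‖∫ t in Set.Ioi (0 : ℝ), Complex.exp (-zline w * t) • freeWave t h‖ ≤ waveBound d * ‖h‖ := by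
  rw [waveBound, ← integral_mul_const]
  refine norm_integral_le_of_norm_le ?_ ?_
  · refine Integrable.mul_const ?_ _
    refine ((integrableOn_exp_neg_mul_one_add_pow 1).const_mul (3 * d + 2)).congr
      (Eventually.of_forall fun t => ?_)
    simp only
    ring
  · refine (ae_restrict_iff' measurableSet_Ioi).2 (Eventually.of_forall fun t (ht : 0 < t) => ?_)
    rw [norm_smul, norm_cexp_zline, mul_assoc]
    gcongr
    have := norm_freeWave_apply_le t h
    rwa [abs_of_pos ht, ← pow_one (1 + t)] at this

/-- The Laplace transform `∫₀^∞ exp (-z t) U₀(t) dt` of the free group. -/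
def laplaceWave (w : ℝ) : Energy d →L[ℂ] Energy d :=
  LinearMap.mkContinuous
    { toFun := fun h => ∫ t in Set.Ioi (0 : ℝ), Complex.exp (-zline w * t) • freeWave t h
      map_add' := fun a b => by
        simp only [map_add, smul_add]
        exact integral_add (integrableOn_cexp_freeWave w a) (integrableOn_cexp_freeWave w b)
      map_smul' := fun c a => by
        simp only [map_smul, RingHom.id_apply]
        rw [← integral_smul]
        simp only [smul_comm c] }
    (waveBound d) (norm_integral_cexp_freeWave_le w)

theorem laplaceWave_apply (w : ℝ) (h : Energy d) : laplaceWave w h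
    = ∫ t in Set.Ioi (0 : ℝ), Complex.exp (-zline w * t) • freeWave t h := rfl

theorem norm_laplaceWave_apply_le (w : ℝ) (h : Energy d) :
    ‖laplaceWave w h‖ ≤ waveBound d * ‖h‖ := norm_integral_cexp_freeWave_le w h

theorem waveBound_nonneg (d : ℕ) : 0 ≤ waveBound d := by
  refine setIntegral_nonneg measurableSet_Ioi fun t (ht : 0 < t) => ?_
  positivity

theorem continuous_laplaceWave :
    Continuous fun p : ℝ × Energy d => laplaceWave p.1 p.2 := by
  refine continuous_clm_uncurry (X := Energy d) (Y := Energy d) (A := laplaceWave)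
    (C := fun _ => waveBound d) (fun h => ?_) continuous_const
    (fun w => ContinuousLinearMap.opNorm_le_bound _ (waveBound_nonneg d)
      (norm_laplaceWave_apply_le w))
  simp only [laplaceWave_apply]
  -- On the line the modulus of `e^{-z t}` does not depend on `w`, so the integrand at `w = 0` has
  -- the same norm as all the others.
  refine continuous_of_dominated (bound := fun t => ‖Complex.exp (-zline 0 * t) • freeWave t h‖)
    (fun w => (integrableOn_cexp_freeWave w h).1) (fun w => Eventually.of_forall fun t => ?_)
    (integrableOn_cexp_freeWave 0 h).norm (Eventually.of_forall fun t => ?_)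
  · rw [norm_smul, norm_smul, norm_cexp_zline, norm_cexp_zline]
  · have := continuous_zline
    fun_prop

theorem integrableOn_pow_mul_cexp {z : ℂ} (hz : 0 < z.re) (n : ℕ) :
    IntegrableOn (fun t : ℝ => (t : ℂ) ^ n * Complex.exp (-z * t)) (Set.Ioi 0) := by
  have h1 := integrableOn_rpow_mul_exp_neg_mul_rpow (p := 1) (s := n) (b := z.re)
    (by linarith [(Nat.cast_nonneg n : (0 : ℝ) ≤ n)]) one_pos hz
  refine Integrable.mono' h1 (Continuous.aestronglyMeasurable (by fun_prop)) ?_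
  refine (ae_restrict_iff' measurableSet_Ioi).2 (Eventually.of_forall fun t (ht : 0 < t) => ?_)
  rw [norm_mul, Complex.norm_exp, norm_pow, Complex.norm_real, Real.norm_of_nonneg ht.le]
  simp

theorem integral_pow_mul_cexp {z : ℂ} (hz : 0 < z.re) (n : ℕ) :
    ∫ t in Set.Ioi (0 : ℝ), (t : ℂ) ^ n * Complex.exp (-z * t) = n.factorial / z ^ (n + 1) := by
  have hz0 : z ≠ 0 := fun h => by simp [h] at hz
  induction n with
  | zero =>
    simp only [pow_zero, one_mul]
    rw [integral_exp_mul_complex_Ioi (by simpa using hz)]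
    simp
  | succ n ih =>
    have hI := integrableOn_pow_mul_cexp hz
    -- Integration by parts, phrased as the fundamental theorem of calculus for `-z⁻¹ t^{n+1} e^{-z
    -- t}`.
    have hd : ∀ t ∈ Set.Ici (0 : ℝ), HasDerivAt
        (fun t : ℝ => -(z⁻¹ * ((t : ℂ) ^ (n + 1) * Complex.exp (-z * t))))
        ((t : ℂ) ^ (n + 1) * Complex.exp (-z * t)
          - (n + 1) / z * ((t : ℂ) ^ n * Complex.exp (-z * t))) t := by
      intro t _
      have h1 : HasDerivAt (fun t : ℝ => (t : ℂ)) 1 t := Complex.ofRealCLM.hasDerivAt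
      have h2 := ((h1.pow (n + 1)).mul ((h1.const_mul (-z)).cexp)).const_mul z⁻¹
      refine h2.neg.congr_deriv ?_
      simp only [Nat.add_sub_cancel, Pi.pow_apply]
      push_cast
      field_simp
      ring
    have hlim : Tendsto (fun t : ℝ => -(z⁻¹ * ((t : ℂ) ^ (n + 1) * Complex.exp (-z * t)))) atTop
        (𝓝 0) := by
      have h1 := (isLittleO_pow_exp_pos_mul_atTop (n + 1) hz).tendsto_div_nhds_zero
      have h2 : Tendsto (fun t : ℝ => (t : ℂ) ^ (n + 1) * Complex.exp (-z * t)) atTop (𝓝 0) := by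
        rw [tendsto_zero_iff_norm_tendsto_zero]
        refine h1.congr' ?_
        filter_upwards [eventually_ge_atTop 0] with t ht
        rw [norm_mul, Complex.norm_exp, norm_pow, Complex.norm_real, Real.norm_of_nonneg ht]
        simp [Real.exp_neg, div_eq_mul_inv]
      simpa using (h2.const_mul z⁻¹).neg
    have h3 := integral_Ioi_of_hasDerivAt_of_tendsto' hd
      ((hI (n + 1)).sub ((hI n).const_mul _)) hlim
    rw [integral_sub (hI (n + 1)) ((hI n).const_mul _), integral_const_mul, ih, sub_eq_iff_eq_add]
      at h3
    rw [h3, Nat.factorial_succ]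
    simp
    field_simp
    ring

theorem integral_cexp_cos (w a : ℝ) :
    ∫ t in Set.Ioi (0 : ℝ), Complex.exp (-zline w * t) * ((Real.cos (t * a) : ℝ) : ℂ)
      = zline w * (zline w ^ 2 + (a : ℂ) ^ 2)⁻¹ := by
  have hz := zline_re w
  have h0 := sq_add_sq_ne_zero (z := zline w) (by simp [hz]) a
  set z := zline w
  have hp : (-z + a * Complex.I).re < 0 := by simp [hz]
  have hm : (-z - a * Complex.I).re < 0 := by simp [hz]
  have h1 : ∀ t : ℝ, Complex.exp (-z * t) * ((Real.cos (t * a) : ℝ) : ℂ)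
      = (1 / 2) * (Complex.exp ((-z + a * Complex.I) * t)
        + Complex.exp ((-z - a * Complex.I) * t)) := by
    intro t
    rw [Complex.ofReal_cos, Complex.cos]
    have e1 : (-z + a * Complex.I) * t = -z * t + ((t * a : ℝ) : ℂ) * Complex.I := by
      push_cast; ring
    have e2 : (-z - a * Complex.I) * t = -z * t + -((t * a : ℝ) : ℂ) * Complex.I := by
      push_cast; ring
    rw [e1, e2, Complex.exp_add, Complex.exp_add]
    ring
  simp_rw [h1]
  rw [integral_const_mul, integral_add (integrableOn_exp_mul_complex_Ioi hp 0)
    (integrableOn_exp_mul_complex_Ioi hm 0), integral_exp_mul_complex_Ioi hp,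
    integral_exp_mul_complex_Ioi hm]
  have hp0 : -z + a * Complex.I ≠ 0 := fun h => by rw [h] at hp; simp at hp
  have hm0 : -z - a * Complex.I ≠ 0 := fun h => by rw [h] at hm; simp at hm
  have hprod : z ^ 2 + (a : ℂ) ^ 2 = (-z + a * Complex.I) * (-z - a * Complex.I) := by
    ring_nf; simp
  rw [hprod]
  simp only [Complex.ofReal_zero, mul_zero, Complex.exp_zero]
  field_simp
  ring

theorem integral_cexp_sinc (w a : ℝ) :
    ∫ t in Set.Ioi (0 : ℝ), Complex.exp (-zline w * t) * ((t * Real.sinc (t * a) : ℝ) : ℂ)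
      = (zline w ^ 2 + (a : ℂ) ^ 2)⁻¹ := by
  have hz := zline_re w
  have h0 := sq_add_sq_ne_zero (z := zline w) (by simp [hz]) a
  set z := zline w
  -- At zero frequency `t sinc(t a)` is just `t`, and the exponential formula for the sine would
  -- divide by `a`.
  by_cases ha : a = 0
  · subst ha
    simp only [mul_zero, Real.sinc_zero, mul_one]
    have h1 := integral_pow_mul_cexp (z := z) (by simp [hz]) 1
    simp only [pow_one, Nat.factorial_one, Nat.cast_one] at h1
    simp only [mul_comm (Complex.exp _), h1]
    simp
  have hp : (-z + a * Complex.I).re < 0 := by simp [hz]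
  have hm : (-z - a * Complex.I).re < 0 := by simp [hz]
  have ha' : (a : ℂ) ≠ 0 := by exact_mod_cast ha
  have h1 : ∀ t ∈ Set.Ioi (0 : ℝ), Complex.exp (-z * t) * ((t * Real.sinc (t * a) : ℝ) : ℂ)
      = (-Complex.I / (2 * a)) * (Complex.exp ((-z + a * Complex.I) * t)
        - Complex.exp ((-z - a * Complex.I) * t)) := by
    intro t ht
    have ht0 : t ≠ 0 := ne_of_gt ht
    rw [Real.sinc_of_ne_zero (mul_ne_zero ht0 ha)]
    have e0 : t * (Real.sin (t * a) / (t * a)) = Real.sin (t * a) / a := by field_simp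
    rw [e0, Complex.ofReal_div, Complex.ofReal_sin, Complex.sin]
    have e1 : (-z + a * Complex.I) * t = -z * t + ((t * a : ℝ) : ℂ) * Complex.I := by
      push_cast; ring
    have e2 : (-z - a * Complex.I) * t = -z * t + -((t * a : ℝ) : ℂ) * Complex.I := by
      push_cast; ring
    rw [e1, e2, Complex.exp_add, Complex.exp_add]
    field_simp
    ring
  rw [setIntegral_congr_fun measurableSet_Ioi h1, integral_const_mul,
    integral_sub (integrableOn_exp_mul_complex_Ioi hp 0)
    (integrableOn_exp_mul_complex_Ioi hm 0), integral_exp_mul_complex_Ioi hp,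
    integral_exp_mul_complex_Ioi hm]
  have hp0 : -z + a * Complex.I ≠ 0 := fun h => by rw [h] at hp; simp at hp
  have hm0 : -z - a * Complex.I ≠ 0 := fun h => by rw [h] at hm; simp at hm
  have hprod : z ^ 2 + (a : ℂ) ^ 2 = (-z + a * Complex.I) * (-z - a * Complex.I) := by
    ring_nf; simp
  rw [hprod]
  simp only [Complex.ofReal_zero, mul_zero, Complex.exp_zero]
  have h3 : (-z + a * Complex.I) - (-z - a * Complex.I) = 2 * a * Complex.I := by ring
  generalize -z + a * Complex.I = p at *
  generalize -z - a * Complex.I = q at *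
  have h4 : -1 / p - -1 / q = (p - q) * (p * q)⁻¹ := by
    field_simp
    ring
  rw [h4, h3, ← mul_assoc]
  have h5 : -Complex.I / (2 * a) * (2 * a * Complex.I) = 1 := by
    field_simp
    simp
  rw [h5, one_mul]

theorem integral_cexp_smul_cos (w : ℝ) (f : L2 d) :
    ∫ t in Set.Ioi (0 : ℝ), Complex.exp (-zline w * t) • multiplier (cosSymbol d t) f
      = zline w • multiplier (resSym d w) f := by
  rw [← multiplier_smul_apply]
  refine integral_smul_multiplier continuous_cosSymbol (C := fun _ => 1) continuous_const
    norm_cosSymbol_le (by fun_prop) ?_ (fun ξ => ?_) f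
  · simp only [norm_cexp_zline]
    simpa using integrableOn_exp_neg_mul_one_add_pow 0
  · exact integral_cexp_cos w (2 * Real.pi * ‖ξ‖)

theorem integral_cexp_smul_sin (w : ℝ) (f : L2 d) :
    ∫ t in Set.Ioi (0 : ℝ), Complex.exp (-zline w * t) • multiplier (sinSymbol d t) f
      = multiplier (resSym d w) f := by
  refine integral_smul_multiplier continuous_sinSymbol (C := fun t => |t|) continuous_abs
    norm_sinSymbol_le (by fun_prop) ?_ (fun ξ => ?_) f
  · simp only [norm_cexp_zline]
    refine Integrable.mono' (integrableOn_exp_neg_mul_one_add_pow 1)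
      (Continuous.aestronglyMeasurable (by fun_prop)) ?_
    refine (ae_restrict_iff' measurableSet_Ioi).2 (Eventually.of_forall fun t (ht : 0 < t) => ?_)
    rw [norm_mul, Real.norm_eq_abs, Real.norm_eq_abs, abs_abs, abs_of_pos ht,
      abs_of_pos (Real.exp_pos _)]
    gcongr
    linarith
  · exact integral_cexp_sinc w (2 * Real.pi * ‖ξ‖)

theorem integrableOn_cexp_cos (w : ℝ) (f : L2 d) : IntegrableOn
    (fun t : ℝ => Complex.exp (-zline w * t) • multiplier (cosSymbol d t) f) (Set.Ioi 0) := by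
  refine integrableOn_cexp_smul (n := 0) (C := ‖f‖) ?_ (fun t _ => ?_) w
  · refine continuous_multiplier_apply (fun ξ => ?_) continuous_const norm_cosSymbol_le f
    simp only [cosSymbol, BoundedContinuousFunction.coe_ofNormedAddCommGroup]
    fun_prop
  · simpa using norm_multiplier_apply_le (norm_cosSymbol_le t) f

theorem integrableOn_cexp_sin (w : ℝ) (f : L2 d) : IntegrableOn
    (fun t : ℝ => Complex.exp (-zline w * t) • multiplier (sinSymbol d t) f) (Set.Ioi 0) := by
  refine integrableOn_cexp_smul (n := 1) (C := ‖f‖) ?_ (fun t ht => ?_) w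
  · refine continuous_multiplier_apply (fun ξ => ?_) continuous_abs norm_sinSymbol_le f
    simp only [sinSymbol, BoundedContinuousFunction.coe_ofNormedAddCommGroup]
    have := Real.continuous_sinc
    fun_prop
  · have h1 := norm_multiplier_apply_le (norm_sinSymbol_le t) f
    rw [abs_of_nonneg ht] at h1
    nlinarith [norm_nonneg f]

/-- The map `(f, g) ↦ z f + g`. -/
def sourceMap (w : ℝ) : Energy d →L[ℂ] L2 d := zline w • Energy.pos + Energy.vel

/-- The cosine contributes `z r f` and the sine `r g`, so the data enter only through the
combination `z f + g`. -/
theorem pos_laplaceWave (w : ℝ) (h : Energy d) :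
    Energy.pos (laplaceWave w h) = multiplier (resSym d w) (sourceMap w h) := by
  rw [laplaceWave_apply, ← Energy.pos.integral_comp_comm (integrableOn_cexp_freeWave w h)]
  simp only [map_smul, pos_freeWave, smul_add]
  rw [integral_add (integrableOn_cexp_cos w _) (integrableOn_cexp_sin w _),
    integral_cexp_smul_cos, integral_cexp_smul_sin]
  simp [sourceMap]

theorem vel_laplaceWave_inr (w : ℝ) (g : L2 d) :
    Energy.vel (laplaceWave w (Energy.inr g)) = zline w • multiplier (resSym d w) g := by
  rw [laplaceWave_apply, ← Energy.vel.integral_comp_comm (integrableOn_cexp_freeWave w _)]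
  simp only [map_smul, vel_freeWave, grad_inr, map_zero, Finset.sum_const_zero, zero_add, vel_inr]
  exact integral_cexp_smul_cos w g

theorem pos_laplaceWave_inr (w : ℝ) (g : L2 d) :
    Energy.pos (laplaceWave w (Energy.inr g)) = multiplier (resSym d w) g := by
  rw [pos_laplaceWave]
  simp [sourceMap, pos_inr, vel_inr]

/-- One `z` comes from `sourceMap` acting on the position and one from the velocity. The resulting
`2 z` later makes `2 z r²`, minus the derivative of `r` in `z`. -/
theorem sourceMap_laplaceWave_inr (w : ℝ) (g : L2 d) :
    sourceMap w (laplaceWave w (Energy.inr g)) = (2 * zline w) • multiplier (resSym d w) g := by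
  rw [sourceMap, add_apply, smul_apply, pos_laplaceWave_inr, vel_laplaceWave_inr, two_mul,
    add_smul]

-- The Laplace transform takes the convolution over `0 < s < t` to a composition: Fubini on the
-- quadrant of pairs `(s, t - s)`.
set_option maxHeartbeats 1000000 in
theorem integral_cexp_duhamel_succ (V : Linfty d) (k : ℕ) (w : ℝ) (h : Energy d) :
    ∫ t in Set.Ioi (0 : ℝ), Complex.exp (-zline w * t) • duhamel V (k + 1) t h
      = laplaceWave w (potential V
        (∫ t in Set.Ioi (0 : ℝ), Complex.exp (-zline w * t) • duhamel V k t h)) := by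
  obtain ⟨C, hC0, hC⟩ := exists_norm_duhamel_le V k h
  have hcont := continuous_duhamel V k h
  have hD := integrableOn_cexp_smul hcont hC w
  set P : ℝ → Energy d := fun s => potential V (duhamel V k s h) with hP
  have hPc : Continuous P := (potential V).continuous.comp hcont
  set G : ℝ × ℝ → Energy d := fun p =>
    Complex.exp (-zline w * p.1) • Complex.exp (-zline w * p.2) • freeWave p.2 (P p.1) with hG
  have hGc : Continuous G := by
    have h1 : Continuous fun p : ℝ × ℝ => freeWave p.2 (P p.1) :=
      continuous_snd.freeWave (hPc.comp continuous_fst)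
    fun_prop
  set S : Set (ℝ × ℝ) := Set.Ioi 0 ×ˢ Set.Ioi 0 with hS
  have hSm : MeasurableSet S := measurableSet_Ioi.prod measurableSet_Ioi
  have hint : IntegrableOn G S := by
    have h1 : Integrable (fun p : ℝ × ℝ => (‖potential V‖ * C * (Real.exp (-p.1)
        * (1 + p.1) ^ (2 * k + 1))) * ((3 * d + 2) * (Real.exp (-p.2) * (1 + p.2) ^ 1)))
        ((volume.restrict (Set.Ioi 0)).prod (volume.restrict (Set.Ioi 0))) :=
      ((integrableOn_exp_neg_mul_one_add_pow _).const_mul _).mul_prod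
        ((integrableOn_exp_neg_mul_one_add_pow 1).const_mul _)
    rw [Measure.prod_restrict] at h1
    refine Integrable.mono' h1 hGc.aestronglyMeasurable ?_
    refine (ae_restrict_iff' hSm).2 (Eventually.of_forall fun p hp => ?_)
    have hp1 : 0 < p.1 := hp.1
    have hp2 : 0 < p.2 := hp.2
    rw [hG, norm_smul, norm_smul, norm_cexp_zline, norm_cexp_zline]
    have h2 := norm_freeWave_apply_le p.2 (P p.1)
    rw [abs_of_pos hp2] at h2
    have h3 : ‖P p.1‖ ≤ ‖potential V‖ * (C * (1 + p.1) ^ (2 * k + 1)) :=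
      ((potential V).le_opNorm _).trans (by gcongr; exact hC _ hp1.le)
    calc _ ≤ Real.exp (-p.1) * (Real.exp (-p.2) * ((3 * d + 2) * (1 + p.2)
          * (‖potential V‖ * (C * (1 + p.1) ^ (2 * k + 1))))) := by
          gcongr
          refine h2.trans ?_
          gcongr
      _ = _ := by ring
  have hF : Integrable (S.indicator G) (volume.prod volume) :=
    (integrable_indicator_iff hSm).2 hint
  -- The volume preserving shear `(t, s) ↦ (s, t - s)`; the quadrant pulls back to `0 < s < t`.
  have hmp := measurePreserving_prod_sub_swap (volume : Measure ℝ) (volume : Measure ℝ)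
  have hF' : Integrable (fun p : ℝ × ℝ => S.indicator G (p.2, p.1 - p.2)) (volume.prod volume) :=
    hmp.integrable_comp_of_integrable hF
  have e1 : ∫ p, S.indicator G p ∂(volume.prod volume)
      = laplaceWave w (potential V
        (∫ t in Set.Ioi (0 : ℝ), Complex.exp (-zline w * t) • duhamel V k t h)) := by
    rw [integral_indicator hSm, hS, ← Measure.prod_restrict,
      integral_prod G (by rw [Measure.prod_restrict]; exact hint)]
    rw [← (potential V).integral_comp_comm hD]
    have hD' := (potential V).integrable_comp hD
    rw [← (laplaceWave w).integral_comp_comm hD']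
    refine integral_congr_ae (Eventually.of_forall fun s => ?_)
    simp only [hG, map_smul]
    rw [integral_smul, laplaceWave_apply]
  have e2 : ∫ p, S.indicator G p ∂(volume.prod volume)
      = ∫ t in Set.Ioi (0 : ℝ), Complex.exp (-zline w * t) • duhamel V (k + 1) t h := by
    rw [← hmp.map_eq, integral_map hmp.measurable.aemeasurable
      (by rw [hmp.map_eq]; exact hF.1), integral_prod _ hF', ← integral_indicator measurableSet_Ioi]
    refine integral_congr_ae (Eventually.of_forall fun t => ?_)
    by_cases ht : 0 < t
    · simp only [Set.indicator_of_mem (show t ∈ Set.Ioi (0 : ℝ) from ht), duhamel]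
      rw [intervalIntegral.integral_of_le ht.le, ← integral_smul,
        integral_Ioc_eq_integral_Ioo, ← integral_indicator measurableSet_Ioo]
      refine integral_congr_ae (Eventually.of_forall fun s => ?_)
      by_cases hs : s ∈ Set.Ioo 0 t
      · have h1 : (s, t - s) ∈ S := ⟨hs.1, sub_pos.2 hs.2⟩
        simp only [Set.indicator_of_mem h1, Set.indicator_of_mem hs, hG, smul_smul]
        rw [← Complex.exp_add]
        congr 2
        push_cast
        ring
      · have h1 : (s, t - s) ∉ S := fun h => hs ⟨h.1, sub_pos.1 h.2⟩
        simp only [Set.indicator_of_notMem h1, Set.indicator_of_notMem hs]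
    · simp only [Set.indicator_of_notMem (show t ∉ Set.Ioi (0 : ℝ) from ht)]
      refine integral_eq_zero_of_ae (Eventually.of_forall fun s => ?_)
      have h1 : (s, t - s) ∉ S := fun h => ht (by
        have h2 : 0 < s := h.1
        have h3 : 0 < t - s := h.2
        linarith)
      simp only [Set.indicator_of_notMem h1, Pi.zero_apply]
  rw [← e2, e1]

end WaveTrace

end

/-! ### Green functions as `L²` vectors and the rank one expansion of the Laplace transforms. -/

noncomputable section

namespace WaveTrace

open Filter Topology

variable {d : ℕ}

attribute [local instance] energyNormedSpace energyNormedSpaceReal energyInner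

/-! ### Point sources -/

theorem memLp_phase_mul {m : E d → ℂ} (hm : MemLp m 2 volume) (x : E d) :
    MemLp (fun ξ => ((Real.fourierChar (-inner ℝ ξ x) : Circle) : ℂ) * m ξ) 2 volume := by
  refine hm.of_le ?_ (Eventually.of_forall fun ξ => by rw [norm_mul, Circle.norm_coe, one_mul])
  refine AEStronglyMeasurable.mul (Continuous.aestronglyMeasurable ?_) hm.1
  have := Real.continuous_fourierChar
  fun_prop

/-- The square integrable function with Fourier transform `exp (-2πi⟨ξ, x⟩) m ξ`. -/
def pointSource {m : E d → ℂ} (hm : MemLp m 2 volume) (x : E d) : L2 d :=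
  𝓕⁻ ((memLp_phase_mul hm x).toLp _)

theorem inner_fourierInv_left (a f : L2 d) : inner ℂ (𝓕⁻ a : L2 d) f = inner ℂ a (𝓕 f : L2 d) := by
  rw [← Lp.inner_fourier_eq, fourier_fourierInv_eq]

theorem inner_pointSource {m : E d → ℂ} (hm : MemLp m 2 volume) (x : E d) (f : L2 d) :
    inner ℂ (pointSource hm x) f = ∫ ξ, ((Real.fourierChar (inner ℝ ξ x) : Circle) : ℂ)
      * ((starRingEnd ℂ) (m ξ) * (𝓕 f : L2 d) ξ) := by
  rw [pointSource, inner_fourierInv_left, L2.inner_def]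
  refine integral_congr_ae ?_
  filter_upwards [MemLp.coeFn_toLp (memLp_phase_mul hm x)] with ξ h
  rw [h, RCLike.inner_apply, map_mul, ← Circle.coe_inv_eq_conj, AddChar.map_neg_eq_inv, inv_inv]
  ring

theorem integrable_mul_fourier {m : E d → ℂ} (hm : MemLp m 2 volume) (f : L2 d) :
    Integrable (fun ξ => m ξ * (𝓕 f : L2 d) ξ) volume :=
  MemLp.integrable_mul hm (Lp.memLp (𝓕 f : L2 d))

/-- For a square integrable symbol the product `m 𝓕 f` is integrable, so the inverse transform is a
pointwise integral, that is, an inner product with a translate of one fixed vector. The conjugation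
is there because `inner` is conjugate linear in its first argument. -/
theorem multiplier_ae_eq_inner (m : BoundedContinuousFunction (E d) ℂ) {m' : E d → ℂ}
    (hm : MemLp m' 2 volume) (h : ∀ ξ, (starRingEnd ℂ) (m' ξ) = m ξ) (f : L2 d) :
    multiplier m f =ᵐ[volume] fun x => inner ℂ (pointSource hm x) f := by
  have hm2 : MemLp m 2 volume := by
    refine hm.of_le m.continuous.aestronglyMeasurable (Eventually.of_forall fun ξ => ?_)
    rw [← h, RCLike.norm_conj]
  rw [multiplier_eq]
  refine (fourierInv_ae_eq_of_integrable (integrable_mul_fourier hm2 f)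
    (MemLp.coeFn_toLp _)).trans (Eventually.of_forall fun x => ?_)
  simp only [inner_pointSource, h, Real.fourierInv_eq, Circle.smul_def, smul_eq_mul]

theorem inner_multiplier_star (m : BoundedContinuousFunction (E d) ℂ) (g f : L2 d) :
    inner ℂ g (multiplier m f) = inner ℂ (multiplier (star m) g) f := by
  rw [← inner_conj_symm (multiplier (star m) g), inner_multiplier, inner_multiplier,
    ← integral_conj]
  refine integral_congr_ae (Eventually.of_forall fun ξ => ?_)
  simp only [BoundedContinuousFunction.star_apply, map_mul, RCLike.star_def, Complex.conj_conj]
  ring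

/-- The dual of `multiplier_ae_eq_inner`: the multiplier synthesizes its output from point sources.
-/
theorem integral_smul_pointSource (m : BoundedContinuousFunction (E d) ℂ)
    (hm : MemLp m 2 volume) (u : L2 d) (hi : Integrable (fun x => u x • pointSource hm x)) :
    ∫ x, u x • pointSource hm x = multiplier m u := by
  refine ext_inner_left ℂ fun g => ?_
  rw [← integral_inner hi, inner_multiplier_star, L2.inner_def]
  refine integral_congr_ae ?_
  filter_upwards [multiplier_ae_eq_inner (star m) hm (fun ξ => by simp) g] with x hx
  rw [hx, inner_smul_right, RCLike.inner_apply, inner_conj_symm]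

theorem norm_pointSource {m : E d → ℂ} (hm : MemLp m 2 volume) (x : E d) :
    ‖pointSource hm x‖ = ‖hm.toLp m‖ := by
  rw [pointSource, ← Lp.norm_fourier_eq, fourier_fourierInv_eq, Lp.norm_toLp, Lp.norm_toLp]
  congr 1
  refine eLpNorm_congr_norm_ae (Eventually.of_forall fun ξ => by
    rw [norm_mul, Circle.norm_coe, one_mul])

/-! ### The Green function as an `L²` function -/

/-- The square decays like `|ξ|⁻⁴`, which is integrable exactly because `d < 4`. -/
theorem memLp_japanese (hd : d ≤ 3) :
    MemLp (fun ξ : E d => (1 + (2 * Real.pi * ‖ξ‖) ^ 2)⁻¹) 2 volume := by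
  have hc : Continuous fun ξ : E d => (1 + (2 * Real.pi * ‖ξ‖) ^ 2)⁻¹ :=
    Continuous.inv₀ (by fun_prop) fun ξ => by positivity
  rw [memLp_two_iff_integrable_sq hc.aestronglyMeasurable]
  have h1 := integrable_rpow_neg_one_add_norm_sq (E := E d) (μ := volume) (r := 4) (by
    rw [finrank_euclideanSpace_fin]
    have : (d : ℝ) ≤ 3 := by exact_mod_cast hd
    linarith)
  refine h1.mono' (hc.pow 2).aestronglyMeasurable (Eventually.of_forall fun ξ => ?_)
  rw [Real.norm_of_nonneg (by positivity), show (-4 / 2 : ℝ) = -(2 : ℕ) by norm_num,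
    Real.rpow_neg (by positivity), Real.rpow_natCast, inv_pow]
  gcongr
  nlinarith [Real.pi_gt_three, sq_nonneg ‖ξ‖, norm_nonneg ξ, mul_nonneg (sq_nonneg ‖ξ‖)
    (by nlinarith [Real.pi_gt_three] : 0 ≤ (2 * Real.pi) ^ 2 - 1)]

theorem memLp_greenSymbol (hd : d ≤ 3) (w : ℝ) : MemLp (greenSymbol d (zline w)) 2 volume := by
  refine ((memLp_japanese hd).const_mul ((1 + 2 * Real.pi * |w|) ^ 2)).mono'
    (resSym d w).continuous.aestronglyMeasurable
    (Eventually.of_forall fun ξ => norm_greenSymbol_zline_le w ξ)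

/-- The Green function of `z² - Δ` with pole at `x`, for `z` on the line `Re z = 1`. -/
def greenL2 (hd : d ≤ 3) (w : ℝ) (x : E d) : L2 d := pointSource (memLp_greenSymbol hd w) x

theorem exists_norm_greenL2_le (hd : d ≤ 3) :
    ∃ C, 0 ≤ C ∧ ∀ w x, ‖greenL2 hd w x‖ ≤ C * (1 + |w|) ^ 2 := by
  -- The `49` is `7²`, from `1 + 2π|w| ≤ 7 (1 + |w|)`.
  refine ⟨49 * ‖(memLp_japanese hd).toLp _‖, by positivity, fun w x => ?_⟩
  rw [greenL2, norm_pointSource]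
  have h1 : ‖(memLp_greenSymbol hd w).toLp _‖
      ≤ (1 + 2 * Real.pi * |w|) ^ 2 * ‖(memLp_japanese hd).toLp _‖ := by
    refine Lp.norm_le_mul_norm_of_ae_le_mul ?_
    filter_upwards [MemLp.coeFn_toLp (memLp_greenSymbol hd w),
      MemLp.coeFn_toLp (memLp_japanese hd)] with ξ h1 h2
    rw [h1, h2, Real.norm_of_nonneg (by positivity)]
    exact norm_greenSymbol_zline_le w ξ
  refine h1.trans ?_
  have h2 : 1 + 2 * Real.pi * |w| ≤ 7 * (1 + |w|) := by
    nlinarith [Real.pi_lt_d2, abs_nonneg w]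
  calc _ ≤ (7 * (1 + |w|)) ^ 2 * ‖(memLp_japanese hd).toLp _‖ := by gcongr
    _ = _ := by ring

theorem continuous_greenL2 (hd : d ≤ 3) :
    Continuous fun p : ℝ × E d => greenL2 hd p.1 p.2 := by
  refine (Lp.fourierTransformₗᵢ (E d) ℂ).symm.continuous.comp ?_
  rw [continuous_iff_continuousAt]
  rintro ⟨w, x⟩
  refine tendsto_toLp_two_of_dominated (l := 𝓝 (w, x)) (F := fun p : ℝ × E d => fun ξ =>
      ((Real.fourierChar (-inner ℝ ξ p.2) : Circle) : ℂ) * greenSymbol d (zline p.1) ξ)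
    (G := fun ξ => (2 * (1 + 2 * Real.pi * (|w| + 1)) ^ 2) * (1 + (2 * Real.pi * ‖ξ‖) ^ 2)⁻¹)
    (fun p => memLp_phase_mul (memLp_greenSymbol hd p.1) p.2)
    (memLp_phase_mul (memLp_greenSymbol hd w) x) ((memLp_japanese hd).const_mul _) ?_ ?_
  · have h1 : ∀ᶠ p : ℝ × E d in 𝓝 (w, x), |p.1| < |w| + 1 := by
      have : Continuous fun p : ℝ × E d => |p.1| := by fun_prop
      exact this.continuousAt.eventually_lt continuousAt_const (lt_add_one |w|)
    filter_upwards [h1] with p hp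
    refine Eventually.of_forall fun ξ => (norm_sub_le _ _).trans ?_
    rw [norm_mul, norm_mul, Circle.norm_coe, Circle.norm_coe, one_mul, one_mul, two_mul, add_mul]
    refine add_le_add ((norm_greenSymbol_zline_le _ ξ).trans ?_)
      ((norm_greenSymbol_zline_le _ ξ).trans ?_)
    · gcongr
    · gcongr
      linarith
  · refine Eventually.of_forall fun ξ => Continuous.tendsto' ?_ _ _ rfl
    have h1 : Continuous fun p : ℝ × E d => greenSymbol d (zline p.1) ξ :=
      continuous_greenSymbol (continuous_zline.comp continuous_fst)
        (fun _ => by simp [zline_re]) continuous_const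
    have := Real.continuous_fourierChar
    fun_prop

/-- Conjugation maps `zline w` to `zline (-w)`; hence the `-w` in the left-hand Green functions from
here on. -/
theorem conj_greenSymbol_zline (w : ℝ) (ξ : E d) :
    (starRingEnd ℂ) (greenSymbol d (zline (-w)) ξ) = greenSymbol d (zline w) ξ := by
  simp [greenSymbol, zline, map_ofNat]
  ring

theorem multiplier_resSym_ae_eq (hd : d ≤ 3) (w : ℝ) (f : L2 d) :
    multiplier (resSym d w) f =ᵐ[volume] fun x => inner ℂ (greenL2 hd (-w) x) f :=
  multiplier_ae_eq_inner _ _ (conj_greenSymbol_zline w) f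

/-! ### The Laplace transform of the Duhamel terms -/

theorem memLp_of_compact_support {V : Linfty d} {K : Set (E d)} (hK : IsCompact K)
    (hV : ∀ᵐ x, x ∉ K → V x = 0) (p : ℝ≥0∞) : MemLp V p volume := by
  have h1 : (V : E d → ℂ) =ᵐ[volume] K.indicator V := by
    filter_upwards [hV] with x hx
    by_cases h : x ∈ K
    · rw [Set.indicator_of_mem h]
    · rw [Set.indicator_of_notMem h, hx h]
  rw [memLp_congr_ae h1, memLp_indicator_iff_restrict hK.measurableSet]
  have : IsFiniteMeasure (volume.restrict K) := ⟨by simpa using hK.measure_lt_top⟩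
  exact ((Lp.memLp V).restrict K).mono_exponent le_top

theorem ae_norm_le (V : Linfty d) : ∀ᵐ x, ‖V x‖ ≤ ‖V‖ := by
  have h := ae_le_eLpNormEssSup (f := (V : E d → ℂ)) (μ := volume)
  filter_upwards [h] with x hx
  have h2 : eLpNormEssSup (V : E d → ℂ) volume = ENNReal.ofReal ‖V‖ := by
    rw [Lp.norm_def, ENNReal.ofReal_toReal (Lp.memLp V).2.ne, eLpNorm_exponent_top]
  rw [h2, ← ofReal_norm, ENNReal.ofReal_le_ofReal_iff (norm_nonneg _)] at hx
  exact hx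

/-- The operator `(z² - Δ)⁻¹ V`. -/
def bornStep (V : Linfty d) (w : ℝ) : L2 d →L[ℂ] L2 d := multiplier (resSym d w) ∘L mulL2 V

theorem norm_bornStep_pow_le (V : Linfty d) (w : ℝ) (n : ℕ) (f : L2 d) :
    ‖(bornStep V w ^ n) f‖ ≤ ‖mulL2 V‖ ^ n * ‖f‖ := by
  induction n with
  | zero => simp
  | succ n ih =>
    rw [pow_succ', mul_apply_eq_comp, bornStep, ContinuousLinearMap.comp_apply]
    refine (norm_multiplier_apply_le (norm_greenSymbol_zline_le_one w) _).trans ?_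
    rw [one_mul, pow_succ', mul_assoc]
    refine ((mulL2 V).le_opNorm _).trans ?_
    gcongr
    exact ih

theorem continuous_bornStep_pow (V : Linfty d) {T : Type} [TopologicalSpace T]
    {a : T → ℝ} {F : T → L2 d} (ha : Continuous a) (hF : Continuous F) (n : ℕ) :
    Continuous fun t => (bornStep V (a t) ^ n) (F t) := by
  have h0 : Continuous fun p : ℝ × L2 d => multiplier (resSym d p.1) p.2 := by
    refine continuous_multiplier (fun ξ => ?_) (C := fun _ => 1) continuous_const
      norm_greenSymbol_zline_le_one
    exact continuous_greenSymbol continuous_zline (fun _ => by simp [zline_re]) continuous_const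
  induction n with
  | zero => simpa using hF
  | succ n ih =>
    simp only [pow_succ', mul_apply_eq_comp]
    exact Continuous.comp (g := fun p : ℝ × L2 d => multiplier (resSym d p.1) p.2) h0
      (f := fun t => (a t, mulL2 V ((bornStep V (a t) ^ n) (F t))))
      (ha.prodMk ((mulL2 V).continuous.comp ih))

/-- The operator `R(z) (0, V ((z² - Δ)⁻¹ V)ⁿ u)`. -/
def bornOut (V : Linfty d) (n : ℕ) (w : ℝ) : L2 d →L[ℂ] Energy d :=
  laplaceWave w ∘L Energy.inr ∘L mulL2 V ∘L (bornStep V w ^ n)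

theorem continuous_bornOut (V : Linfty d) {T : Type} [TopologicalSpace T]
    {a : T → ℝ} {F : T → L2 d} (ha : Continuous a) (hF : Continuous F) (n : ℕ) :
    Continuous fun t => bornOut V n (a t) (F t) :=
  Continuous.comp (g := fun p : ℝ × Energy d => laplaceWave p.1 p.2) continuous_laplaceWave
    (f := fun t => (a t, Energy.inr (mulL2 V ((bornStep V (a t) ^ n) (F t)))))
    (ha.prodMk (Energy.inr.continuous.comp ((mulL2 V).continuous.comp
      (continuous_bornStep_pow V ha hF n))))

theorem exists_norm_bornOut_le (V : Linfty d) (n : ℕ) :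
    ∃ C, 0 ≤ C ∧ ∀ w f, ‖bornOut V n w f‖ ≤ C * ‖f‖ := by
  refine ⟨waveBound d * (‖(Energy.inr : L2 d →L[ℂ] Energy d)‖ * (‖mulL2 V‖ * ‖mulL2 V‖ ^ n)),
    mul_nonneg (waveBound_nonneg d) (by positivity), fun w f => ?_⟩
  refine (norm_laplaceWave_apply_le w _).trans ?_
  rw [mul_assoc]
  refine mul_le_mul_of_nonneg_left ?_ (waveBound_nonneg d)
  refine (Energy.inr.le_opNorm _).trans ?_
  rw [mul_assoc]
  refine mul_le_mul_of_nonneg_left ?_ (by positivity)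
  refine ((mulL2 V).le_opNorm _).trans ?_
  rw [mul_assoc]
  exact mul_le_mul_of_nonneg_left (norm_bornStep_pow_le V w n f) (norm_nonneg _)

theorem pos_integral_cexp_duhamel (V : Linfty d) (k : ℕ) (w : ℝ) (h : Energy d) :
    Energy.pos (∫ t in Set.Ioi (0 : ℝ), Complex.exp (-zline w * t) • duhamel V k t h)
      = (bornStep V w ^ k) (multiplier (resSym d w) (sourceMap w h)) := by
  induction k with
  | zero => exact pos_laplaceWave w h
  | succ k ih =>
    rw [integral_cexp_duhamel_succ, potential_apply, pos_laplaceWave_inr, ih, pow_succ',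
      mul_apply_eq_comp]
    rfl

/-- The factor `r V r` next to the data is split off. It exists because at least two potentials are
present, and it has a Green function on each side of `V`. -/
theorem integral_cexp_duhamel (V : Linfty d) (n : ℕ) (w : ℝ) (h : Energy d) :
    ∫ t in Set.Ioi (0 : ℝ), Complex.exp (-zline w * t) • duhamel V (n + 2) t h
      = bornOut V n w (multiplier (resSym d w)
        (mulL2 V (multiplier (resSym d w) (sourceMap w h)))) := by
  rw [integral_cexp_duhamel_succ, potential_apply, pos_integral_cexp_duhamel, pow_succ,
    mul_apply_eq_comp]
  rfl

theorem integrable_mul_smul_greenL2 (hd : d ≤ 3) {V : Linfty d} {K : Set (E d)} (hK : IsCompact K)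
    (hV : ∀ᵐ x, x ∉ K → V x = 0) (w : ℝ) (f : L2 d) :
    Integrable (fun x => (V x * f x) • greenL2 hd w x) volume := by
  obtain ⟨C, hC0, hC⟩ := exists_norm_greenL2_le hd
  have h1 : Integrable (fun x => V x * f x) volume :=
    MemLp.integrable_mul (memLp_of_compact_support hK hV 2) (Lp.memLp f)
  have hc : Continuous fun x : E d => greenL2 hd w x := by
    exact Continuous.comp (g := fun p : ℝ × E d => greenL2 hd p.1 p.2) (continuous_greenL2 hd)
      (f := fun x => (w, x)) (by fun_prop)
  refine (h1.norm.mul_const (C * (1 + |w|) ^ 2)).mono'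
    (h1.1.smul hc.aestronglyMeasurable) (Eventually.of_forall fun x => ?_)
  rw [norm_smul]
  gcongr
  exact hC w x

/-- In `r V r` the `r` on the right is analysed into inner products with point sources and the one
on the left is synthesized from them; the variable of the `V` in between indexes the rank one
operators. -/
theorem integral_cexp_duhamel_eq (hd : d ≤ 3) {V : Linfty d} {K : Set (E d)} (hK : IsCompact K)
    (hV : ∀ᵐ x, x ∉ K → V x = 0) (n : ℕ) (w : ℝ) (h : Energy d) :
    ∫ t in Set.Ioi (0 : ℝ), Complex.exp (-zline w * t) • duhamel V (n + 2) t h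
      = ∫ x, (V x * inner ℂ (greenL2 hd (-w) x) (sourceMap w h))
        • bornOut V n w (greenL2 hd w x) := by
  have hi := integrable_mul_smul_greenL2 hd hK hV w (multiplier (resSym d w) (sourceMap w h))
  have hu : (fun x => (mulL2 V (multiplier (resSym d w) (sourceMap w h))) x
      • greenL2 hd w x) =ᵐ[volume] fun x => (V x * (multiplier (resSym d w) (sourceMap w h)) x)
        • greenL2 hd w x := by
    filter_upwards [coeFn_mulL2 V (multiplier (resSym d w) (sourceMap w h))] with x hx
    rw [hx]
  rw [integral_cexp_duhamel, ← integral_smul_pointSource (resSym d w) (memLp_greenSymbol hd w) _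
    (hi.congr hu.symm)]
  change bornOut V n w (∫ x, (mulL2 V (multiplier (resSym d w) (sourceMap w h))) x
      • greenL2 hd w x) = _
  rw [integral_congr_ae hu]
  refine (ContinuousLinearMap.integral_comp_comm (𝕜 := ℂ) (E := L2 d) (Fₗ := Energy d)
    (bornOut V n w) hi).symm.trans (integral_congr_ae ?_)
  filter_upwards [multiplier_resSym_ae_eq hd w (sourceMap w h)] with x hx
  rw [map_smul, hx]

end WaveTrace

end

/-! ### Smearing in time: Fourier inversion and the trace formula for Laplace families. -/

noncomputable section

namespace WaveTrace

open Filter Topology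

variable {d : ℕ}

/-! ### Smeared Duhamel terms as integrals of rank one operators -/

/-- Fourier inversion for `e^t φ(t)`, which is still smooth with compact support. The compensating
`e^{-t}` moves the frequencies onto `Re z = 1`, where the Laplace transforms converge. -/
theorem exists_exponential_representation {φ : ℝ → ℂ} (hφ : ContDiff ℝ (⊤ : ℕ∞) φ)
    (hc : HasCompactSupport φ) :
    ∃ ψ : 𝓢(ℝ, ℂ), ∀ t : ℝ, φ t = ∫ w, ψ w * Complex.exp (-zline w * t) := by
  have hs : HasCompactSupport fun t : ℝ => φ t * Complex.exp t := hc.mul_right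
  have hd : ContDiff ℝ (⊤ : ℕ∞) fun t : ℝ => φ t * Complex.exp t := by
    refine hφ.mul (ContDiff.cexp ?_)
    exact Complex.ofRealCLM.contDiff
  let Φ : 𝓢(ℝ, ℂ) := hs.toSchwartzMap hd
  refine ⟨𝓕 Φ, fun t => ?_⟩
  have h1 : (𝓕⁻ (𝓕 Φ) : 𝓢(ℝ, ℂ)) t = φ t * Complex.exp t := by
    rw [FourierTransform.fourierInv_fourier_eq]
    rfl
  rw [SchwartzMap.fourierInv_coe, Real.fourierInv_eq] at h1
  have h2 : φ t = (φ t * Complex.exp t) * Complex.exp (-t) := by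
    rw [mul_assoc, ← Complex.exp_add]
    simp
  rw [h2, ← h1, ← integral_mul_const]
  refine integral_congr_ae (Eventually.of_forall fun w => ?_)
  simp only [Circle.smul_def, smul_eq_mul, Real.fourierChar_apply]
  rw [mul_comm (Complex.exp _), mul_assoc, ← Complex.exp_add]
  congr 2
  simp only [zline, RCLike.inner_apply, conj_trivial]
  push_cast
  ring

theorem exists_schwartz_bound (ψ : 𝓢(ℝ, ℂ)) (n : ℕ) :
    ∃ C, 0 ≤ C ∧ ∀ w, (1 + |w|) ^ n * ‖ψ w‖ ≤ C := by
  have h := SchwartzMap.one_add_le_sup_seminorm_apply (𝕜 := ℂ) (m := (n, 0)) (k := n) (n := 0)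
    le_rfl le_rfl ψ
  simp only [norm_iteratedFDeriv_zero, Real.norm_eq_abs] at h
  exact ⟨_, (by positivity : (0 : ℝ) ≤ (1 + |(0 : ℝ)|) ^ n * ‖ψ 0‖).trans (h 0), h⟩

/-- One inverse power of `1 + |w|` is square integrable on the line, and the set `K` has finite
measure. -/
theorem memLp_two_of_decay {Y : Type} [NormedAddCommGroup Y] {K : Set (E d)} (hK : IsCompact K)
    {F : ℝ × E d → Y} (hF : AEStronglyMeasurable F (volume.prod volume)) {C : ℝ}
    (hb : ∀ᵐ p : ℝ × E d ∂(volume.prod volume),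
      ‖F p‖ ≤ C * ((1 + |p.1|)⁻¹ * K.indicator 1 p.2)) : MemLp F 2 (volume.prod volume) := by
  have hm : AEStronglyMeasurable (fun p : ℝ × E d => (1 + |p.1|)⁻¹ * K.indicator (1 : E d → ℝ) p.2)
      (volume.prod volume) := by
    refine Measurable.aestronglyMeasurable ?_
    refine Measurable.mul (by fun_prop) ?_
    exact (measurable_one.indicator hK.measurableSet).comp measurable_snd
  have hG : MemLp (fun p : ℝ × E d => (1 + |p.1|)⁻¹ * K.indicator (1 : E d → ℝ) p.2) 2
      (volume.prod volume) := by
    rw [memLp_two_iff_integrable_sq hm]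
    have h1 : Integrable (fun w : ℝ => (1 + ‖w‖) ^ (-2 : ℝ)) volume :=
      integrable_one_add_norm (by simp)
    have h2 : Integrable (K.indicator (1 : E d → ℝ)) volume :=
      (integrable_indicator_iff hK.measurableSet).2 (integrableOn_const hK.measure_lt_top.ne)
    refine (h1.mul_prod h2).congr (Eventually.of_forall fun p => ?_)
    simp only
    rw [mul_pow, show (-2 : ℝ) = -(2 : ℕ) by norm_num, Real.rpow_neg (by positivity),
      Real.rpow_natCast, inv_pow, Real.norm_eq_abs]
    congr 1
    by_cases hx : p.2 ∈ K <;> simp [hx]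
  exact (hG.const_mul C).mono' hF hb

section Representation

variable {H : Type} [NormedAddCommGroup H] [InnerProductSpace ℂ H]

/-- The map `h ↦ z P h + Q h` for `z` on the line `Re z = 1`. -/
def lineMap (P Q : H →L[ℂ] L2 d) (w : ℝ) : H →L[ℂ] L2 d := zline w • P + Q

theorem norm_lineMap_apply_le {P Q : H →L[ℂ] L2 d} (hP : ∀ h, ‖P h‖ ≤ ‖h‖)
    (hQ : ∀ h, ‖Q h‖ ≤ ‖h‖) (w : ℝ) (h : H) : ‖lineMap P Q w h‖ ≤ 7 * (1 + |w|) * ‖h‖ := by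
  rw [lineMap, add_apply, smul_apply]
  have h1 := hP h
  have h2 := hQ h
  have h3 := norm_zline_le w
  have h4 : 2 * Real.pi * |w| ≤ 6.3 * |w| := by
    have := Real.pi_lt_d2
    gcongr
    linarith
  have h0 := norm_nonneg h
  have h5 : ‖zline w • P h‖ ≤ (1 + 6.3 * |w|) * ‖h‖ := by
    rw [norm_smul]
    have := abs_nonneg w
    gcongr
    linarith
  have h6 : 0 ≤ |w| * ‖h‖ := by positivity
  refine (norm_add_le _ _).trans ?_
  nlinarith

/-- Seven powers of decay of `ψ` are spent: four on the weight borrowed from `leftVec`, two on the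
growth of `o`, one for square integrability. -/
theorem memLp_rightVec {V : Linfty d} {K : Set (E d)} (hK : IsCompact K)
    (hV : ∀ᵐ x, x ∉ K → V x = 0) (ψ : 𝓢(ℝ, ℂ)) {o : ℝ × E d → H} (ho : Continuous o) {B : ℝ}
    (hB : ∀ p, ‖o p‖ ≤ B * (1 + |p.1|) ^ 2) :
    MemLp (fun p : ℝ × E d => (ψ p.1 * ((1 + |p.1|) ^ 4 : ℝ) * V p.2) • o p) 2
      (volume.prod volume) := by
  obtain ⟨S, hS0, hS⟩ := exists_schwartz_bound ψ 7
  have hB0 : 0 ≤ B := by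
    have h1 := (norm_nonneg _).trans (hB 0)
    simpa using h1
  have hVm : AEStronglyMeasurable (fun p : ℝ × E d => V p.2) (volume.prod volume) :=
    (Lp.aestronglyMeasurable V).comp_snd
  refine memLp_two_of_decay hK (C := S * ‖V‖ * B) ?_ ?_
  · have h0 : Continuous fun p : ℝ × E d => ψ p.1 * (((1 + |p.1|) ^ 4 : ℝ) : ℂ) := by
      have := ψ.continuous
      fun_prop
    exact (h0.aestronglyMeasurable.mul hVm).smul ho.aestronglyMeasurable
  · have h1 : ∀ᵐ p : ℝ × E d ∂(volume.prod volume), p.2 ∉ K → V p.2 = 0 :=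
      Measure.quasiMeasurePreserving_snd.ae hV
    have h2 : ∀ᵐ p : ℝ × E d ∂(volume.prod volume), ‖V p.2‖ ≤ ‖V‖ :=
      Measure.quasiMeasurePreserving_snd.ae (ae_norm_le V)
    filter_upwards [h1, h2] with p h1 h2
    by_cases hx : p.2 ∈ K
    · rw [norm_smul, norm_mul, norm_mul, Complex.norm_real,
        Real.norm_of_nonneg (by positivity), Set.indicator_of_mem hx, Pi.one_apply, mul_one]
      have hpos : 0 < 1 + |p.1| := by positivity
      have h3 := hB p
      have h4 := hS p.1
      calc _ ≤ ‖ψ p.1‖ * (1 + |p.1|) ^ 4 * ‖V‖ * (B * (1 + |p.1|) ^ 2) := by gcongr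
        _ = ((1 + |p.1|) ^ 7 * ‖ψ p.1‖) * (‖V‖ * B) * (1 + |p.1|)⁻¹ := by field_simp
        _ ≤ S * (‖V‖ * B) * (1 + |p.1|)⁻¹ := by gcongr
        _ = _ := by ring
    · rw [h1 hx]
      simp [hx]

variable [CompleteSpace H]

/-- The left vectors of the rank one operators. -/
def leftVec (hd : d ≤ 3) (K : Set (E d)) (P Q : H →L[ℂ] L2 d) (p : ℝ × E d) : H :=
  (((1 + |p.1|) ^ 4)⁻¹ * K.indicator (1 : E d → ℝ) p.2 : ℝ) •
    (lineMap P Q p.1).adjoint (greenL2 hd (-p.1) p.2)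

theorem lineMap_adjoint_apply (P Q : H →L[ℂ] L2 d) (w : ℝ) (u : L2 d) :
    (lineMap P Q w).adjoint u = (starRingEnd ℂ) (zline w) • P.adjoint u + Q.adjoint u := by
  refine ext_inner_right ℂ fun h => ?_
  rw [ContinuousLinearMap.adjoint_inner_left, inner_add_left, inner_smul_left,
    ContinuousLinearMap.adjoint_inner_left, ContinuousLinearMap.adjoint_inner_left,
    Complex.conj_conj, lineMap, add_apply, smul_apply, inner_add_right, inner_smul_right]

/-- The line map grows like `1 + |w|` and the Green function like `(1 + |w|)²`; the weight `(1 +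
|w|)⁻⁴` leaves one inverse power. -/
theorem memLp_leftVec (hd : d ≤ 3) {K : Set (E d)} (hK : IsCompact K) {P Q : H →L[ℂ] L2 d}
    (hP : ∀ h, ‖P h‖ ≤ ‖h‖) (hQ : ∀ h, ‖Q h‖ ≤ ‖h‖) :
    MemLp (leftVec hd K P Q) 2 (volume.prod volume) := by
  obtain ⟨C, hC0, hC⟩ := exists_norm_greenL2_le hd
  have hg : Continuous fun p : ℝ × E d => greenL2 hd (-p.1) p.2 :=
    Continuous.comp (g := fun p : ℝ × E d => greenL2 hd p.1 p.2) (continuous_greenL2 hd)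
      (f := fun p : ℝ × E d => (-p.1, p.2)) (by fun_prop)
  refine memLp_two_of_decay hK (C := 7 * C) ?_ (Eventually.of_forall fun p => ?_)
  · have hK1 : Measurable (K.indicator (1 : E d → ℝ)) :=
      measurable_one.indicator hK.measurableSet
    have h0 : Measurable fun p : ℝ × E d =>
        ((1 + |p.1|) ^ 4)⁻¹ * K.indicator (1 : E d → ℝ) p.2 :=
      Measurable.mul (by fun_prop) (hK1.comp measurable_snd)
    have hc : Continuous fun p : ℝ × E d =>
        (lineMap P Q p.1).adjoint (greenL2 hd (-p.1) p.2) := by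
      simp only [lineMap_adjoint_apply]
      have h3 : Continuous fun p : ℝ × E d => (starRingEnd ℂ) (zline p.1) :=
        Complex.continuous_conj.comp (continuous_zline.comp continuous_fst)
      exact (h3.smul (P.adjoint.continuous.comp hg)).add (Q.adjoint.continuous.comp hg)
    have h1 : AEStronglyMeasurable (fun p : ℝ × E d =>
        ((1 + |p.1|) ^ 4)⁻¹ * K.indicator (1 : E d → ℝ) p.2) (volume.prod volume) :=
      h0.aestronglyMeasurable
    exact h1.smul hc.aestronglyMeasurable
  · have hpos : 0 < 1 + |p.1| := by positivity
    have hi : 0 ≤ K.indicator (1 : E d → ℝ) p.2 := by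
      by_cases hx : p.2 ∈ K <;> simp [hx]
    rw [leftVec, norm_smul, Real.norm_of_nonneg (by positivity)]
    have h1 : ‖(lineMap P Q p.1).adjoint (greenL2 hd (-p.1) p.2)‖
        ≤ 7 * (1 + |p.1|) * (C * (1 + |p.1|) ^ 2) := by
      refine ((lineMap P Q p.1).adjoint.le_opNorm _).trans ?_
      gcongr
      · rw [LinearIsometryEquiv.norm_map]
        exact ContinuousLinearMap.opNorm_le_bound _ (by positivity)
          (norm_lineMap_apply_le hP hQ p.1)
      · have := hC (-p.1) p.2
        rwa [abs_neg] at this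
    calc _ ≤ ((1 + |p.1|) ^ 4)⁻¹ * K.indicator (1 : E d → ℝ) p.2
          * (7 * (1 + |p.1|) * (C * (1 + |p.1|) ^ 2)) := by gcongr
      _ = _ := by field_simp

theorem inner_leftVec (hd : d ≤ 3) (K : Set (E d)) (P Q : H →L[ℂ] L2 d) (p : ℝ × E d) (h : H) :
    inner ℂ (leftVec hd K P Q p) h
      = ((((1 + |p.1|) ^ 4)⁻¹ * K.indicator (1 : E d → ℝ) p.2 : ℝ) : ℂ)
        * inner ℂ (greenL2 hd (-p.1) p.2) (lineMap P Q p.1 h) := by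
  rw [leftVec, RCLike.real_smul_eq_coe_smul (K := ℂ), inner_smul_left,
    ContinuousLinearMap.adjoint_inner_left]
  simp

/-- The weights of the left and right vectors cancel, and truncation to `K` changes nothing because
`V` vanishes off `K`. -/
theorem weight_mul_cancel {V : Linfty d} {K : Set (E d)} {p : ℝ × E d}
    (h : p.2 ∉ K → V p.2 = 0) (a b : ℂ) :
    ((((1 + |p.1|) ^ 4)⁻¹ * K.indicator (1 : E d → ℝ) p.2 : ℝ) : ℂ) * a
      * (b * ((1 + |p.1|) ^ 4 : ℝ) * V p.2) = b * (V p.2 * a) := by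
  by_cases hx : p.2 ∈ K
  · have h0 : ((1 + |p.1| : ℝ) : ℂ) ≠ 0 := by
      exact_mod_cast (by positivity : (1 + |p.1| : ℝ) ≠ 0)
    rw [Set.indicator_of_mem hx]
    push_cast at h0 ⊢
    simp only [Pi.one_apply, Complex.ofReal_one]
    field_simp
  · rw [h hx]
    simp

/-- A family `D h t` of vectors, equivariant under the reversal `J` of time, whose Laplace
transforms on the line `Re z = 1` are integrals of rank one operators made of Green functions. -/
structure IsLaplaceFamily (hd : d ≤ 3) (V : Linfty d) (P Q : H →L[ℂ] L2 d) (o : ℝ × E d → H)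
    (J : H →L[ℂ] H) (D : H → ℝ → H) : Prop where
  norm_fst_le : ∀ h, ‖P h‖ ≤ ‖h‖
  norm_snd_le : ∀ h, ‖Q h‖ ≤ ‖h‖
  continuous_out : Continuous o
  norm_out_le : ∃ B : ℝ, ∀ p, ‖o p‖ ≤ B * (1 + |p.1|) ^ 2
  inner_reverse : ∀ a b, inner ℂ (J a) b = inner ℂ a (J b)
  reverse_reverse : ∀ a, J (J a) = a
  continuous_family : ∀ h, Continuous (D h)
  norm_family_le : ∀ h, ∃ C m, ∀ t, 0 ≤ t → ‖D h t‖ ≤ C * (1 + t) ^ (m : ℕ)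
  family_neg : ∀ h t, D h (-t) = J (D (J h) t)
  laplace : ∀ w h, ∫ t in Set.Ioi (0 : ℝ), Complex.exp (-zline w * t) • D h t
    = ∫ x, (V x * inner ℂ (greenL2 hd (-w) x) (lineMap P Q w h)) • o (w, x)

/-- The smeared operators `h ↦ ∫ φ(t) D h t dt` of such a family are of trace class. -/
theorem IsLaplaceFamily.exists_hasTrace [SecondCountableTopology H] {hd : d ≤ 3} {V : Linfty d}
    {K : Set (E d)} (hK : IsCompact K) (hV : ∀ᵐ x, x ∉ K → V x = 0) {P Q : H →L[ℂ] L2 d}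
    {o : ℝ × E d → H} {J : H →L[ℂ] H} {D : H → ℝ → H} (hF : IsLaplaceFamily hd V P Q o J D)
    {φ : ℝ → ℂ} {ψ : 𝓢(ℝ, ℂ)} (hc : Continuous φ) (hs : HasCompactSupport φ)
    (he : ∀ t, φ (-t) = φ t) (hφ : ∀ t : ℝ, φ t = ∫ w, ψ w * Complex.exp (-zline w * t)) :
    ∃ T : H →L[ℂ] H, (∀ h, T h = ∫ t, φ t • D h t) ∧
      HasTrace T (2 * ∫ w, ψ w * ∫ x, V x *
        inner ℂ (greenL2 hd (-w) x) (lineMap P Q w (o (w, x)))) := by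
  obtain ⟨hP, hQ, ho, ⟨B, hB⟩, hJ, hJJ, hDc, hDb, hDneg, hDL⟩ := hF
  have hl := memLp_leftVec hd hK hP hQ
  have hr := memLp_rightVec hK hV ψ ho hB
  set l : ℝ × E d → H := leftVec hd K P Q with hl_def
  set r : ℝ × E d → H := fun p => (ψ p.1 * ((1 + |p.1|) ^ 4 : ℝ) * V p.2) • o p with hr_def
  have htr : ∫ p, inner ℂ (l p) (r p) ∂(volume.prod volume) = ∫ w, ψ w * ∫ x, V x *
        inner ℂ (greenL2 hd (-w) x) (lineMap P Q w (o (w, x))) := by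
    rw [integral_prod _ (integrable_inner_of_memLp hl hr)]
    refine integral_congr_ae (Eventually.of_forall fun w => ?_)
    simp only
    rw [← integral_const_mul]
    refine integral_congr_ae ?_
    filter_upwards [hV] with x hx
    rw [← weight_mul_cancel (p := (w, x)) hx, hl_def, hr_def]
    simp only [inner_leftVec, inner_smul_right]
    ring
  -- The half line `t > 0` only: integrate the Laplace transforms against `ψ` and exchange the
  -- integrals over `w` and `t`.
  have hT : ∀ h, ∫ t in Set.Ioi (0 : ℝ), φ t • D h t
      = ∫ p, inner ℂ (l p) h • r p ∂(volume.prod volume) := by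
    intro h
    have e1 : ∫ p, inner ℂ (l p) h • r p ∂(volume.prod volume)
        = ∫ w, ∫ t in Set.Ioi (0 : ℝ), (ψ w * Complex.exp (-zline w * t)) • D h t := by
      rw [integral_prod _ (integrable_inner_smul hl hr h)]
      refine integral_congr_ae (Eventually.of_forall fun w => ?_)
      simp only [mul_smul]
      rw [integral_smul, hDL, ← integral_smul]
      refine integral_congr_ae ?_
      filter_upwards [hV] with x hx
      simp only [hl_def, hr_def]
      rw [inner_leftVec, smul_smul, weight_mul_cancel (p := (w, x)) hx, smul_smul]
    rw [e1, integral_integral_swap]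
    · refine integral_congr_ae (Eventually.of_forall fun t => ?_)
      simp only
      rw [hφ, ← integral_smul_const]
    · obtain ⟨C, m, hC⟩ := hDb h
      have hD := integrableOn_cexp_smul (hDc h) hC 0
      refine Integrable.mono' (ψ.integrable.norm.mul_prod hD.norm) ?_
        (Eventually.of_forall fun p => ?_)
      · refine Continuous.aestronglyMeasurable ?_
        have h1 := ψ.continuous
        have h2 := hDc h
        have h3 := continuous_zline
        simp only [Function.uncurry_def]
        fun_prop
      · simp only [Function.uncurry]
        rw [norm_smul, norm_smul, norm_mul, norm_cexp_zline, norm_cexp_zline, mul_assoc]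
  -- The conjugate by `J` has vectors `J l` and `J r`. Since `J` is symmetric with square one, the
  -- inner products and hence the trace are unchanged, which produces the factor `2`.
  have hl' : MemLp (fun p => J (l p)) 2 (volume.prod volume) := J.comp_memLp' hl
  have hr' : MemLp (fun p => J (r p)) 2 (volume.prod volume) := J.comp_memLp' hr
  have h1 := hasTrace_innerL2 hl hr
  have h2 := hasTrace_innerL2 hl' hr'
  simp only [hJ, hJJ] at h2
  rw [htr] at h1 h2
  refine ⟨_, fun h => ?_, by rw [two_mul]; exact h1.add h2⟩
  have hi : ∀ h, Integrable (fun t => φ t • D h t) := fun h => by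
    have h3 : Continuous fun t => φ t • D h t := hc.smul (hDc h)
    exact h3.integrable_of_hasCompactSupport hs.smul_right
  -- This is where evenness of `φ` enters.
  have hneg : ∫ t in Set.Iic (0 : ℝ), φ t • D h t
      = J (∫ t in Set.Ioi (0 : ℝ), φ t • D (J h) t) := by
    rw [← J.integral_comp_comm (hi _).integrableOn]
    have h4 := integral_comp_neg_Ioi 0 (fun t => φ t • D h t)
    rw [neg_zero] at h4
    rw [← h4]
    simp only [he, hDneg, map_smul]
  rw [add_apply, innerL2_adjoint_comp_apply, innerL2_adjoint_comp_apply,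
    ← intervalIntegral.integral_Iic_add_Ioi (hi h).integrableOn (hi h).integrableOn (b := 0),
    hneg, hT, hT, ← J.integral_comp_comm (integrable_inner_smul hl hr (J h)), add_comm]
  simp only [map_smul, hJ]

end Representation

end WaveTrace

end

/-! ### The Duhamel terms as a Laplace family. -/

noncomputable section

namespace WaveTrace

open Filter Topology

variable {d : ℕ}

attribute [local instance] energyNormedSpace energyNormedSpaceReal energyInner

/-- The diagonal of the `n + 2`-nd Born term, integrated over space. -/
def bornTrace (hd : d ≤ 3) (V : Linfty d) (n : ℕ) (w : ℝ) : ℂ :=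
  ∫ x, V x * inner ℂ (greenL2 hd (-w) x) ((2 * zline w) •
    multiplier (resSym d w) (mulL2 V ((bornStep V w ^ n) (greenL2 hd w x))))

theorem isLaplaceFamily_duhamel (hd : d ≤ 3) {V : Linfty d} {K : Set (E d)}
    (hK : IsCompact K) (hV : ∀ᵐ x, x ∉ K → V x = 0) (n : ℕ) :
    IsLaplaceFamily (H := Energy d) hd V Energy.pos Energy.vel
      (fun p => bornOut V n p.1 (greenL2 hd p.1 p.2)) timeReversal
      (fun h t => duhamel V (n + 2) t h) where
  norm_fst_le := norm_pos_le
  norm_snd_le := norm_vel_le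
  continuous_out := continuous_bornOut V continuous_fst (continuous_greenL2 hd) n
  norm_out_le := by
    obtain ⟨C, hC0, hC⟩ := exists_norm_greenL2_le hd
    obtain ⟨B, hB0, hB⟩ := exists_norm_bornOut_le V n
    refine ⟨B * C, fun p => (hB _ _).trans ?_⟩
    rw [mul_assoc]
    exact mul_le_mul_of_nonneg_left (hC _ _) hB0
  inner_reverse := inner_timeReversal
  reverse_reverse := timeReversal_timeReversal
  continuous_family := continuous_duhamel V (n + 2)
  norm_family_le h := by
    obtain ⟨C, -, hC⟩ := exists_norm_duhamel_le V (n + 2) h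
    exact ⟨C, _, hC⟩
  family_neg h t := duhamel_neg V (n + 2) t h
  laplace w h := integral_cexp_duhamel_eq hd hK hV n w h

theorem exists_smeared_hasTrace (hd : d ≤ 3) {V : Linfty d} {K : Set (E d)}
    (hK : IsCompact K) (hV : ∀ᵐ x, x ∉ K → V x = 0) (n : ℕ) {φ : ℝ → ℂ} {ψ : 𝓢(ℝ, ℂ)}
    (hc : Continuous φ) (hs : HasCompactSupport φ) (he : ∀ t, φ (-t) = φ t)
    (hφ : ∀ t : ℝ, φ t = ∫ w, ψ w * Complex.exp (-zline w * t)) :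
    ∃ T : Energy d →L[ℂ] Energy d, IsSmearedDuhamel V (n + 2) φ T ∧
      HasTrace (H := Energy d) T (2 * ∫ w, ψ w * bornTrace hd V n w) := by
  obtain ⟨T, hT1, hT2⟩ := (isLaplaceFamily_duhamel hd hK hV n).exists_hasTrace hK hV hc hs he hφ
  refine ⟨T, hT1, ?_⟩
  have h1 : ∀ w, (∫ x, V x * inner ℂ (greenL2 hd (-w) x)
      (sourceMap w (bornOut V n w (greenL2 hd w x)))) = bornTrace hd V n w := fun w => by
    simp only [bornTrace, bornOut, ContinuousLinearMap.comp_apply, sourceMap_laplaceWave_inr]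
  simp only [← h1]
  exact hT2

end WaveTrace

end

/-! ### The wave kernel and its Laplace transform compared with the heat kernel. -/

noncomputable section

namespace WaveTrace

open Filter Topology

variable {d : ℕ}

/-! ### Bessel integrals -/

theorem lintegral_exp_neg_mul_sq {b : ℝ} (hb : 0 < b) :
    ∫⁻ y : ℝ, ENNReal.ofReal (Real.exp (-b * y ^ 2)) = ENNReal.ofReal (√(Real.pi / b)) := by
  rw [← integral_gaussian, ofReal_integral_eq_lintegral_ofReal (integrable_exp_neg_mul_sq hb)
    (Eventually.of_forall fun _ => (Real.exp_pos _).le)]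

theorem lintegral_exp_half_sub_cosh_neg (a : ℝ) :
    ∫⁻ v : ℝ, ENNReal.ofReal (Real.exp (-(v / 2) - a * Real.cosh v))
      = ∫⁻ v : ℝ, ENNReal.ofReal (Real.exp (v / 2 - a * Real.cosh v)) := by
  have h := (Measure.measurePreserving_neg (volume : Measure ℝ)).lintegral_comp
    (f := fun v : ℝ => ENNReal.ofReal (Real.exp (v / 2 - a * Real.cosh v)))
    (by have := Real.continuous_cosh; fun_prop)
  rw [← h]
  simp [Real.cosh_neg, neg_div]

/-- This is the elementary Bessel function `K_{1/2}`. By `v ↦ -v` the integral equals its mate with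
`e^{-v/2}`; their sum contains `cosh(v/2)`, proportional to the derivative of `sinh(v/2)`, and `cosh
v = 1 + 2 sinh²(v/2)` makes it Gaussian. -/
theorem lintegral_exp_half_sub_cosh {a : ℝ} (ha : 0 < a) :
    ∫⁻ v : ℝ, ENNReal.ofReal (Real.exp (v / 2 - a * Real.cosh v))
      = ENNReal.ofReal (Real.exp (-a) * √(2 * Real.pi / a)) := by
  have h1 : ∫⁻ y : ℝ, ENNReal.ofReal (Real.exp (-(2 * a) * y ^ 2))
      = ENNReal.ofReal (√(Real.pi / (2 * a))) := lintegral_exp_neg_mul_sq (by positivity)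
  have himg : (fun v : ℝ => Real.sinh (v / 2)) '' Set.univ = Set.univ := by
    rw [Set.image_univ, Set.range_eq_univ]
    intro y
    obtain ⟨v, hv⟩ := Real.sinh_surjective y
    exact ⟨2 * v, by simp [hv]⟩
  have h2 := lintegral_image_eq_lintegral_abs_deriv_mul (s := Set.univ)
    (f := fun v : ℝ => Real.sinh (v / 2)) (f' := fun v => Real.cosh (v / 2) * (1 / 2))
    MeasurableSet.univ
    (fun v _ => ((hasDerivAt_id' v).div_const 2).sinh.hasDerivWithinAt)
    (fun x _ y _ h => by
      have := Real.sinh_injective h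
      linarith)
    (fun y : ℝ => ENNReal.ofReal (Real.exp (-(2 * a) * y ^ 2)))
  rw [himg, setLIntegral_univ, setLIntegral_univ, h1] at h2
  have hm : Measurable fun v : ℝ => ENNReal.ofReal (Real.exp (v / 2 - a * Real.cosh v)) := by
    have := Real.continuous_cosh
    fun_prop
  have h3 : ∫⁻ v : ℝ, ENNReal.ofReal (Real.exp (v / 2 - a * Real.cosh v))
      + ENNReal.ofReal (Real.exp (-(v / 2) - a * Real.cosh v))
      = ∫⁻ v : ℝ, ENNReal.ofReal (4 * Real.exp (-a)) *
        (ENNReal.ofReal |Real.cosh (v / 2) * (1 / 2)|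
          * ENNReal.ofReal (Real.exp (-(2 * a) * Real.sinh (v / 2) ^ 2))) := by
    refine lintegral_congr fun v => ?_
    rw [← ENNReal.ofReal_add (Real.exp_pos _).le (Real.exp_pos _).le,
      ← ENNReal.ofReal_mul (abs_nonneg _), ← ENNReal.ofReal_mul (by positivity),
      abs_of_pos (by have := Real.cosh_pos (v / 2); positivity)]
    congr 1
    have hc : Real.cosh v = 1 + 2 * Real.sinh (v / 2) ^ 2 := by
      have h4 := Real.cosh_two_mul (v / 2)
      rw [mul_div_cancel₀ _ two_ne_zero, Real.cosh_sq] at h4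
      linarith
    have e1 : Real.exp (-a) * Real.exp (-(2 * a) * Real.sinh (v / 2) ^ 2)
        = Real.exp (-(a * Real.cosh v)) := by
      rw [← Real.exp_add, hc]
      ring_nf
    rw [sub_eq_add_neg, sub_eq_add_neg, Real.exp_add, Real.exp_add, ← add_mul, ← e1,
      Real.cosh_eq]
    ring
  rw [lintegral_add_left hm, lintegral_exp_half_sub_cosh_neg, lintegral_const_mul' _ _ ENNReal.ofReal_ne_top,
    ← h2, ← ENNReal.ofReal_mul (by positivity), ← two_mul] at h3
  have h5 : 4 * Real.exp (-a) * √(Real.pi / (2 * a))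
      = 2 * (Real.exp (-a) * √(2 * Real.pi / a)) := by
    rw [show 2 * Real.pi / a = 2 ^ 2 * (Real.pi / (2 * a)) by field_simp,
      Real.sqrt_mul (by positivity), Real.sqrt_sq (by norm_num)]
    ring
  rw [h5, ENNReal.ofReal_mul (by norm_num), ENNReal.ofReal_ofNat] at h3
  exact (ENNReal.mul_right_inj (by norm_num) (by norm_num)).1 h3

theorem lintegral_exp_neg_cosh (a : ℝ) :
    ∫⁻ v : ℝ, ENNReal.ofReal (Real.exp (-(a * Real.cosh v)))
      = 2 * ∫⁻ v in Set.Ioi (0 : ℝ), ENNReal.ofReal (Real.exp (-(a * Real.cosh v))) := by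
  have h := (Measure.measurePreserving_neg (volume : Measure ℝ)).setLIntegral_comp_preimage
    (s := Set.Iio (0 : ℝ)) measurableSet_Iio
    (f := fun v : ℝ => ENNReal.ofReal (Real.exp (-(a * Real.cosh v))))
    (by have := Real.continuous_cosh; fun_prop)
  simp only [Real.cosh_neg] at h
  rw [show Neg.neg ⁻¹' Set.Iio (0 : ℝ) = Set.Ioi 0 by ext; simp] at h
  rw [two_mul]
  nth_rw 1 [h]
  rw [setLIntegral_congr Iio_ae_eq_Iic, ← Set.compl_Ioi, add_comm,
    lintegral_add_compl _ measurableSet_Ioi]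

/-- Substitute `s = r cosh v`. Times `s ≤ r` contribute nothing, since there the square root is `0`
and so is its inverse. -/
theorem lintegral_exp_neg_mul_inv_sqrt {r l : ℝ} (hr : 0 < r) :
    ∫⁻ s in Set.Ioi (0 : ℝ), ENNReal.ofReal ((√(s ^ 2 - r ^ 2))⁻¹ * Real.exp (-l * s))
      = ∫⁻ v in Set.Ioi (0 : ℝ), ENNReal.ofReal (Real.exp (-(l * r * Real.cosh v))) := by
  have himg : (fun v => r * Real.cosh v) '' Set.Ioi 0 = Set.Ioi r := by
    ext s
    constructor
    · rintro ⟨v, hv, rfl⟩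
      have := Real.one_lt_cosh.2 (ne_of_gt hv)
      simp only [Set.mem_Ioi]
      nlinarith
    · intro hs
      have h1 : 1 < s / r := by rwa [one_lt_div hr]
      refine ⟨Real.arcosh (s / r), Real.arcosh_pos h1, ?_⟩
      simp only
      rw [Real.cosh_arcosh h1.le]
      field_simp
  have h := lintegral_image_eq_lintegral_abs_deriv_mul (s := Set.Ioi 0)
    (f := fun v : ℝ => r * Real.cosh v) (f' := fun v => r * Real.sinh v) measurableSet_Ioi
    (fun v _ => ((Real.hasDerivAt_cosh v).const_mul r).hasDerivWithinAt)
    (fun x hx y hy h => by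
      have h1 := mul_left_cancel₀ hr.ne' h
      rw [← Real.arcosh_cosh (le_of_lt hx), h1, Real.arcosh_cosh (le_of_lt hy)])
    (fun s : ℝ => ENNReal.ofReal ((√(s ^ 2 - r ^ 2))⁻¹ * Real.exp (-l * s)))
  rw [himg] at h
  have h0 : ∫⁻ s in Set.Ioi (0 : ℝ), ENNReal.ofReal ((√(s ^ 2 - r ^ 2))⁻¹ * Real.exp (-l * s))
      = ∫⁻ s in Set.Ioi r, ENNReal.ofReal ((√(s ^ 2 - r ^ 2))⁻¹ * Real.exp (-l * s)) := by
    rw [← lintegral_indicator measurableSet_Ioi, ← lintegral_indicator measurableSet_Ioi]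
    refine lintegral_congr fun s => ?_
    by_cases h1 : r < s
    · rw [Set.indicator_of_mem (Set.mem_Ioi.2 h1), Set.indicator_of_mem (Set.mem_Ioi.2
        (hr.trans h1))]
    · rw [Set.indicator_of_notMem (s := Set.Ioi r) (by simpa using h1)]
      by_cases h2 : 0 < s
      · rw [Set.indicator_of_mem (Set.mem_Ioi.2 h2), Real.sqrt_eq_zero_of_nonpos (by nlinarith)]
        simp
      · rw [Set.indicator_of_notMem (by simpa using h2)]
  rw [h0, h]
  refine setLIntegral_congr_fun measurableSet_Ioi fun v (hv : 0 < v) => ?_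
  have hs : 0 < Real.sinh v := Real.sinh_pos_iff.2 hv
  rw [← ENNReal.ofReal_mul (abs_nonneg _), abs_of_pos (by positivity)]
  have h2 : √((r * Real.cosh v) ^ 2 - r ^ 2) = r * Real.sinh v := by
    rw [← Real.sqrt_sq (by positivity : 0 ≤ r * Real.sinh v)]
    congr 1
    have := Real.cosh_sq v
    rw [mul_pow, mul_pow, this]
    ring
  rw [h2]
  congr 1
  rw [← mul_assoc, mul_inv_cancel₀ (by positivity), one_mul]
  ring_nf

/-! ### The wave kernel -/

/-- The fundamental solution of the wave equation at distance `r` is the image of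
`waveWeight d r v dv` under `v ↦ waveDelay d r v`, where `dv` is `waveBase d`. -/
def waveBase (d : ℕ) : Measure ℝ := if d = 3 then Measure.dirac 0 else volume.restrict (Set.Ioi 0)

/-- The delays of the fundamental solution of the wave equation. -/
def waveDelay (d : ℕ) (r v : ℝ) : ℝ := if d = 3 then r else v

/-- The density of the fundamental solution of the wave equation. -/
def waveWeight (d : ℕ) (r v : ℝ) : ℝ :=
  if d = 3 then (4 * Real.pi * r)⁻¹
  else if d = 2 then (2 * Real.pi)⁻¹ * (√(v ^ 2 - r ^ 2))⁻¹
  else (Set.Ici r).indicator (fun _ => 1 / 2) v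

instance (d : ℕ) : SFinite (waveBase d) := by
  unfold waveBase
  split_ifs <;> infer_instance

theorem waveWeight_nonneg (d : ℕ) {r : ℝ} (hr : 0 ≤ r) (v : ℝ) : 0 ≤ waveWeight d r v := by
  unfold waveWeight
  split_ifs
  · positivity
  · positivity
  · exact Set.indicator_nonneg (fun _ _ => by norm_num) v

theorem measurable_waveWeight (d : ℕ) : Measurable fun p : ℝ × ℝ => waveWeight d p.1 p.2 := by
  unfold waveWeight
  split_ifs
  · fun_prop
  · fun_prop
  · have h : (fun p : ℝ × ℝ => (Set.Ici p.1).indicator (fun _ => (1 / 2 : ℝ)) p.2)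
        = {p : ℝ × ℝ | p.1 ≤ p.2}.indicator fun _ => 1 / 2 := by
      ext p
      simp [Set.indicator_apply]
    rw [h]
    exact measurable_const.indicator (measurableSet_le measurable_fst measurable_snd)

theorem continuous_waveDelay (d : ℕ) : Continuous fun p : ℝ × ℝ => waveDelay d p.1 p.2 := by
  unfold waveDelay
  split_ifs <;> fun_prop

theorem ae_waveDelay_nonneg (d : ℕ) {r : ℝ} (hr : 0 ≤ r) :
    ∀ᵐ v ∂waveBase d, 0 ≤ waveDelay d r v := by
  unfold waveBase waveDelay
  split_ifs
  · exact Eventually.of_forall fun _ => hr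
  · exact (ae_restrict_iff' measurableSet_Ioi).2 (Eventually.of_forall fun v hv => le_of_lt hv)

/-- The heat kernel at time `τ` and distance `r`. -/
def heatKernel (d : ℕ) (τ r : ℝ) : ℝ := ((√(4 * Real.pi * τ)) ^ d)⁻¹ * Real.exp (-(r ^ 2 / (4 * τ)))

/-- The substitution `τ = r e^v / (2l)` balances the two exponents `l² τ` and `r² / (4τ)` into `l r
cosh v`. -/
theorem lintegral_heatKernel_time {r l : ℝ} (hr : 0 < r) (hl : 0 < l) :
    ∫⁻ τ in Set.Ioi (0 : ℝ), ENNReal.ofReal (Real.exp (-(l ^ 2 * τ)) * heatKernel d τ r)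
      = ∫⁻ v : ℝ, ENNReal.ofReal (r / (2 * l) * ((√(2 * Real.pi * r / l)) ^ d)⁻¹
        * (Real.exp v * ((Real.exp (v / 2)) ^ d)⁻¹ * Real.exp (-(l * r * Real.cosh v)))) := by
  have himg : (fun v => r / (2 * l) * Real.exp v) '' Set.univ = Set.Ioi 0 := by
    ext s
    constructor
    · rintro ⟨v, -, rfl⟩
      have := Real.exp_pos v
      simp only [Set.mem_Ioi]
      positivity
    · intro hs
      have hs' : 0 < s := hs
      refine ⟨Real.log (s / (r / (2 * l))), trivial, ?_⟩
      simp only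
      rw [Real.exp_log (by positivity)]
      field_simp
  have h := lintegral_image_eq_lintegral_abs_deriv_mul (s := Set.univ)
    (f := fun v : ℝ => r / (2 * l) * Real.exp v) (f' := fun v => r / (2 * l) * Real.exp v)
    MeasurableSet.univ
    (fun v _ => ((Real.hasDerivAt_exp v).const_mul _).hasDerivWithinAt)
    (fun x hx y hy h => Real.exp_injective (mul_left_cancel₀ (by positivity) h))
    (fun τ : ℝ => ENNReal.ofReal (Real.exp (-(l ^ 2 * τ)) * heatKernel d τ r))
  rw [himg, setLIntegral_univ] at h
  rw [h]
  refine lintegral_congr fun v => ?_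
  have hv := Real.exp_pos v
  rw [← ENNReal.ofReal_mul (abs_nonneg _), abs_of_pos (by positivity), heatKernel]
  congr 1
  have e1 : √(4 * Real.pi * (r / (2 * l) * Real.exp v))
      = √(2 * Real.pi * r / l) * Real.exp (v / 2) := by
    rw [show 4 * Real.pi * (r / (2 * l) * Real.exp v)
      = (2 * Real.pi * r / l) * (Real.exp (v / 2)) ^ 2 by
        rw [← Real.exp_nat_mul]
        push_cast
        rw [mul_div_cancel₀ _ (two_ne_zero' ℝ)]
        field_simp
        ring,
      Real.sqrt_mul (by positivity), Real.sqrt_sq (Real.exp_pos _).le]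
  have e2 : Real.exp (-(l ^ 2 * (r / (2 * l) * Real.exp v)))
      * Real.exp (-(r ^ 2 / (4 * (r / (2 * l) * Real.exp v))))
      = Real.exp (-(l * r * Real.cosh v)) := by
    rw [← Real.exp_add, Real.cosh_eq, Real.exp_neg v]
    congr 1
    field_simp
    ring
  rw [e1, mul_pow, mul_inv, ← e2]
  ring

/-- The Laplace transform in time of the fundamental solution of the wave equation is that of the
heat kernel at the squared frequency. -/
theorem lintegral_waveWeight (hd : 1 ≤ d) (hd' : d ≤ 3) {r l : ℝ} (hr : 0 < r) (hl : 0 < l) :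
    ∫⁻ v, ENNReal.ofReal (waveWeight d r v * Real.exp (-l * waveDelay d r v)) ∂waveBase d
      = ∫⁻ τ in Set.Ioi (0 : ℝ), ENNReal.ofReal (Real.exp (-(l ^ 2 * τ)) * heatKernel d τ r) := by
  rw [lintegral_heatKernel_time hr hl]
  have hs : √(2 * Real.pi * r / l) * √(2 * Real.pi / (l * r)) = 2 * Real.pi / l := by
    rw [← Real.sqrt_mul (by positivity), ← Real.sqrt_sq (by positivity : 0 ≤ 2 * Real.pi / l)]
    congr 1
    field_simp
  have hs0 : 0 < √(2 * Real.pi * r / l) := Real.sqrt_pos.2 (by positivity)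
  have hs1 : √(2 * Real.pi * r / l) ^ 2 = 2 * Real.pi * r / l := Real.sq_sqrt (by positivity)
  have hexp : ∀ v : ℝ, Real.exp v = Real.exp (v / 2) ^ 2 := fun v => by
    rw [← Real.exp_nat_mul]
    push_cast
    rw [mul_div_cancel₀ _ (two_ne_zero' ℝ)]
  have hsplit : ∀ v : ℝ, Real.exp (v / 2) ≠ 0 := fun v => (Real.exp_pos _).ne'
  interval_cases d
  -- Dimension one: `K_{1/2}` against the integral of `e^{-l v} / 2` over `v ≥ r`.
  · have e : ∀ v : ℝ, Real.exp v * (Real.exp (v / 2) ^ 1)⁻¹ * Real.exp (-(l * r * Real.cosh v))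
        = Real.exp (v / 2 - l * r * Real.cosh v) := fun v => by
      rw [hexp v, sub_eq_add_neg, Real.exp_add]
      have := hsplit v
      field_simp
    simp only [e]
    simp_rw [ENNReal.ofReal_mul (by positivity : 0 ≤ r / (2 * l) * (√(2 * Real.pi * r / l) ^ 1)⁻¹)]
    rw [lintegral_const_mul' _ _ ENNReal.ofReal_ne_top,
      lintegral_exp_half_sub_cosh (by positivity), ← ENNReal.ofReal_mul (by positivity)]
    have hlhs : ∫⁻ v, ENNReal.ofReal (waveWeight 1 r v * Real.exp (-l * waveDelay 1 r v))
        ∂waveBase 1 = ∫⁻ v in Set.Ioi r, ENNReal.ofReal (1 / 2 * Real.exp (-l * v)) := by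
      simp only [waveBase, waveDelay, waveWeight, OfNat.one_ne_ofNat, if_false]
      rw [setLIntegral_congr (Ioi_ae_eq_Ici (a := r)), ← lintegral_indicator measurableSet_Ioi,
        ← lintegral_indicator measurableSet_Ici]
      refine lintegral_congr fun v => ?_
      by_cases h1 : r ≤ v
      · rw [Set.indicator_of_mem (Set.mem_Ioi.2 (hr.trans_le h1)),
          Set.indicator_of_mem (Set.mem_Ici.2 h1), Set.indicator_of_mem (Set.mem_Ici.2 h1)]
      · rw [Set.indicator_of_notMem (s := Set.Ici r) (by simpa using h1)]
        simp [Set.indicator_of_notMem (s := Set.Ici r) (by simpa using h1)]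
    rw [hlhs, ← ofReal_integral_eq_lintegral_ofReal
      ((integrableOn_exp_mul_Ioi (neg_lt_zero.2 hl) r).const_mul _)
      (Eventually.of_forall fun _ => by positivity), integral_const_mul,
      integral_exp_mul_Ioi (neg_lt_zero.2 hl)]
    congr 1
    set A := √(2 * Real.pi * r / l)
    set B := √(2 * Real.pi / (l * r))
    have hB : B = A / r := by
      rw [eq_div_iff hr.ne']
      refine mul_left_cancel₀ hs0.ne' ?_
      rw [← mul_assoc, hs, ← sq, hs1]
      field_simp
    rw [hB, neg_mul]
    field_simp
  -- Dimension two: the powers of `e^v` cancel and both sides are the same unevaluated Bessel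
  -- integral.
  · have e : ∀ v : ℝ, Real.exp v * (Real.exp (v / 2) ^ 2)⁻¹ * Real.exp (-(l * r * Real.cosh v))
        = Real.exp (-(l * r * Real.cosh v)) := fun v => by
      rw [hexp v, mul_inv_cancel₀ (pow_ne_zero _ (hsplit v)), one_mul]
    simp only [e]
    simp_rw [ENNReal.ofReal_mul (by positivity : 0 ≤ r / (2 * l) * (√(2 * Real.pi * r / l) ^ 2)⁻¹)]
    rw [lintegral_const_mul' _ _ ENNReal.ofReal_ne_top, lintegral_exp_neg_cosh,
      ← lintegral_exp_neg_mul_inv_sqrt hr]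
    simp only [waveBase, waveDelay, waveWeight, Nat.reduceEqDiff, if_true, if_false, mul_assoc]
    simp_rw [ENNReal.ofReal_mul (by positivity : 0 ≤ (2 * Real.pi)⁻¹)]
    rw [lintegral_const_mul' _ _ ENNReal.ofReal_ne_top, ← mul_assoc]
    congr 1
    rw [← mul_assoc 2 Real.pi r, hs1, ← ENNReal.ofReal_ofNat 2, ← ENNReal.ofReal_mul (by positivity)]
    congr 1
    field_simp
  -- Dimension three: `K_{1/2}` again, against the single delay `r` of Huygens' principle.
  · have e : ∀ v : ℝ, Real.exp v * (Real.exp (v / 2) ^ 3)⁻¹ * Real.exp (-(l * r * Real.cosh v))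
        = Real.exp (-(v / 2) - l * r * Real.cosh v) := fun v => by
      rw [hexp v, sub_eq_add_neg, Real.exp_add, Real.exp_neg (v / 2)]
      have := hsplit v
      field_simp
    simp only [e]
    simp_rw [ENNReal.ofReal_mul (by positivity : 0 ≤ r / (2 * l) * (√(2 * Real.pi * r / l) ^ 3)⁻¹)]
    rw [lintegral_const_mul' _ _ ENNReal.ofReal_ne_top, lintegral_exp_half_sub_cosh_neg,
      lintegral_exp_half_sub_cosh (by positivity), ← ENNReal.ofReal_mul (by positivity)]
    simp only [waveBase, waveDelay, waveWeight, if_true, lintegral_dirac]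
    congr 1
    set A := √(2 * Real.pi * r / l)
    set B := √(2 * Real.pi / (l * r))
    have hB : B = A / r := by
      rw [eq_div_iff hr.ne']
      refine mul_left_cancel₀ hs0.ne' ?_
      rw [← mul_assoc, hs, ← sq, hs1]
      field_simp
    rw [hB, pow_succ, hs1, neg_mul]
    field_simp
    norm_num

end WaveTrace

end

/-! ### The space-time Fourier-Laplace transform of the wave kernel. -/

noncomputable section

namespace WaveTrace

open Filter Topology

variable {d : ℕ}

/-! ### The Fourier transform of the heat kernel -/

theorem heatKernel_nonneg (d : ℕ) (τ r : ℝ) : 0 ≤ heatKernel d τ r := by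
  unfold heatKernel
  positivity

theorem measurable_heatKernel (d : ℕ) : Measurable fun p : ℝ × ℝ => heatKernel d p.1 p.2 := by
  unfold heatKernel
  fun_prop

theorem ofReal_heatKernel {τ : ℝ} (x : E d) :
    (heatKernel d τ ‖x‖ : ℂ) = (((√(4 * Real.pi * τ)) ^ d : ℝ)⁻¹ : ℂ) *
      Complex.exp (-((4 * τ : ℝ)⁻¹ : ℂ) * ‖x‖ ^ 2) := by
  rw [heatKernel]
  push_cast
  congr 2
  rw [div_eq_inv_mul]
  ring

theorem fourier_heatKernel {τ : ℝ} (hτ : 0 < τ) (ξ : E d) :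
    𝓕 (fun x : E d => (heatKernel d τ ‖x‖ : ℂ)) ξ
      = Complex.exp (-((2 * Real.pi * ‖ξ‖) ^ 2 : ℝ) * τ) := by
  have hb : 0 < (((4 * τ : ℝ)⁻¹ : ℂ)).re := by
    rw [← Complex.ofReal_inv, Complex.ofReal_re]
    positivity
  have h := fourier_gaussian_innerProductSpace hb ξ
  have e : (fun x : E d => (heatKernel d τ ‖x‖ : ℂ)) = (((√(4 * Real.pi * τ)) ^ d : ℝ)⁻¹ : ℂ) •
      fun x : E d => Complex.exp (-((4 * τ : ℝ)⁻¹ : ℂ) * ‖x‖ ^ 2) := by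
    ext x
    rw [ofReal_heatKernel]
    rfl
  have h2 : ∀ f : E d → ℂ, 𝓕 ((((√(4 * Real.pi * τ)) ^ d : ℝ)⁻¹ : ℂ) • f) ξ
      = (((√(4 * Real.pi * τ)) ^ d : ℝ)⁻¹ : ℂ) * 𝓕 f ξ := fun f => by
    rw [Real.fourier_eq', Real.fourier_eq', ← integral_const_mul]
    refine integral_congr_ae (Eventually.of_forall fun v => ?_)
    simp only [Pi.smul_apply, smul_eq_mul]
    ring
  have hp : ((Real.pi : ℂ) / ((4 * τ : ℝ)⁻¹ : ℂ)) ^ (Module.finrank ℝ (E d) / 2 : ℂ)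
      = ((√(4 * Real.pi * τ)) ^ d : ℝ) := by
    have h3 : (√(4 * Real.pi * τ)) ^ d = (4 * Real.pi * τ) ^ ((d : ℝ) / 2) := by
      rw [Real.sqrt_eq_rpow, ← Real.rpow_natCast, ← Real.rpow_mul (by positivity)]
      ring_nf
    rw [h3, Complex.ofReal_cpow (by positivity)]
    congr 1
    · push_cast
      rw [div_inv_eq_mul]
      ring
    · simp
  rw [e, h2, h, hp, ← mul_assoc, inv_mul_cancel₀, one_mul]
  · congr 1
    push_cast
    have : (τ : ℂ) ≠ 0 := by exact_mod_cast hτ.ne'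
    field_simp
    ring
  · have : 0 < √(4 * Real.pi * τ) := Real.sqrt_pos.2 (by positivity)
    exact_mod_cast (pow_pos this d).ne'

theorem integrable_heatKernel {τ : ℝ} (hτ : 0 < τ) :
    Integrable fun x : E d => heatKernel d τ ‖x‖ := by
  have hb : 0 < (((4 * τ : ℝ)⁻¹ : ℂ)).re := by
    rw [← Complex.ofReal_inv, Complex.ofReal_re]
    positivity
  have h := GaussianFourier.integrable_cexp_neg_mul_sq_norm_add hb 0 (0 : E d)
  simp only [zero_mul, add_zero] at h
  have h2 := (h.const_mul (((√(4 * Real.pi * τ)) ^ d : ℝ)⁻¹ : ℂ)).re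
  refine h2.congr (Eventually.of_forall fun x => ?_)
  simp only
  rw [← ofReal_heatKernel]
  exact Complex.ofReal_re _

theorem integral_heatKernel {τ : ℝ} (hτ : 0 < τ) : ∫ x : E d, heatKernel d τ ‖x‖ = 1 := by
  have h := fourier_heatKernel hτ (0 : E d)
  rw [Real.fourier_eq'] at h
  simp only [inner_zero_right, mul_zero, Complex.ofReal_zero, zero_mul, Complex.exp_zero,
    one_smul, norm_zero] at h
  rw [integral_complex_ofReal] at h
  norm_num at h
  exact h

theorem lintegral_heatKernel {τ : ℝ} (hτ : 0 < τ) :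
    ∫⁻ x : E d, ENNReal.ofReal (heatKernel d τ ‖x‖) = 1 := by
  rw [← ofReal_integral_eq_lintegral_ofReal (integrable_heatKernel hτ)
    (Eventually.of_forall fun _ => heatKernel_nonneg _ _ _), integral_heatKernel hτ,
    ENNReal.ofReal_one]

/-! ### Integrability of the wave kernel -/

theorem ae_norm_pos (hd : 1 ≤ d) : ∀ᵐ x : E d, 0 < ‖x‖ := by
  have : Nonempty (Fin d) := ⟨⟨0, hd⟩⟩
  have h : ∀ᵐ x : E d, x ≠ 0 := by
    simp [ae_iff]
  filter_upwards [h] with x hx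
  exact norm_pos_iff.2 hx

theorem measurable_heat_time (l : ℝ) : Measurable fun p : E d × ℝ =>
    Real.exp (-(l ^ 2 * p.2)) * heatKernel d p.2 ‖p.1‖ :=
  Measurable.mul (by fun_prop) ((measurable_heatKernel d).comp
    (measurable_snd.prodMk measurable_fst.norm))

/-- The heat kernel has mass one at every time, so only the integral of `e^{-l² τ}` remains. -/
theorem lintegral_heat_time {l : ℝ} (hl : 0 < l) :
    ∫⁻ x : E d, ∫⁻ τ in Set.Ioi (0 : ℝ),
      ENNReal.ofReal (Real.exp (-(l ^ 2 * τ)) * heatKernel d τ ‖x‖) < ∞ := by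
  rw [lintegral_lintegral_swap (measurable_heat_time l).ennreal_ofReal.aemeasurable]
  have h1 : ∀ τ ∈ Set.Ioi (0 : ℝ), ∫⁻ x : E d,
      ENNReal.ofReal (Real.exp (-(l ^ 2 * τ)) * heatKernel d τ ‖x‖)
      = ENNReal.ofReal (Real.exp (-l ^ 2 * τ)) := fun τ hτ => by
    simp_rw [ENNReal.ofReal_mul (Real.exp_pos _).le]
    rw [lintegral_const_mul' _ _ ENNReal.ofReal_ne_top, lintegral_heatKernel hτ, mul_one, neg_mul]
  rw [setLIntegral_congr_fun measurableSet_Ioi h1]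
  exact (integrableOn_exp_mul_Ioi (neg_lt_zero.2 (by positivity : 0 < l ^ 2)) 0).lintegral_lt_top

theorem integrable_heat_time {l : ℝ} (hl : 0 < l) :
    Integrable (fun p : E d × ℝ => Real.exp (-(l ^ 2 * p.2)) * heatKernel d p.2 ‖p.1‖)
      (volume.prod (volume.restrict (Set.Ioi 0))) := by
  refine ⟨(measurable_heat_time l).aestronglyMeasurable, ?_⟩
  rw [hasFiniteIntegral_iff_ofReal (Eventually.of_forall fun p =>
    mul_nonneg (Real.exp_pos _).le (heatKernel_nonneg _ _ _)),
    lintegral_prod _ (measurable_heat_time l).ennreal_ofReal.aemeasurable]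
  exact lintegral_heat_time hl

theorem measurable_waveWeight_exp (l : ℝ) : Measurable fun p : E d × ℝ =>
    waveWeight d ‖p.1‖ p.2 * Real.exp (-l * waveDelay d ‖p.1‖ p.2) := by
  have h : Measurable fun p : E d × ℝ => (‖p.1‖, p.2) := by fun_prop
  have h1 := (measurable_waveWeight d).comp h
  have h2 := (continuous_waveDelay d).measurable.comp h
  exact h1.mul ((h2.const_mul (-l)).exp)

theorem integrable_waveWeight_exp (hd : 1 ≤ d) (hd' : d ≤ 3) {l : ℝ} (hl : 0 < l) :
    Integrable (fun p : E d × ℝ => waveWeight d ‖p.1‖ p.2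
      * Real.exp (-l * waveDelay d ‖p.1‖ p.2)) (volume.prod (waveBase d)) := by
  refine ⟨(measurable_waveWeight_exp l).aestronglyMeasurable, ?_⟩
  rw [hasFiniteIntegral_iff_ofReal (Eventually.of_forall fun p =>
    mul_nonneg (waveWeight_nonneg _ (norm_nonneg _) _) (Real.exp_pos _).le),
    lintegral_prod _ (measurable_waveWeight_exp l).ennreal_ofReal.aemeasurable]
  refine lt_of_eq_of_lt (lintegral_congr_ae ?_) (lintegral_heat_time (d := d) hl)
  filter_upwards [ae_norm_pos hd] with x hx
  exact lintegral_waveWeight hd hd' hx hl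

theorem integral_waveWeight (hd : 1 ≤ d) (hd' : d ≤ 3) {r l : ℝ} (hr : 0 < r) (hl : 0 < l) :
    ∫ v, waveWeight d r v * Real.exp (-l * waveDelay d r v) ∂waveBase d
      = ∫ τ in Set.Ioi (0 : ℝ), Real.exp (-(l ^ 2 * τ)) * heatKernel d τ r := by
  have hm : Measurable fun v : ℝ => (r, v) := by fun_prop
  rw [integral_eq_lintegral_of_nonneg_ae, integral_eq_lintegral_of_nonneg_ae,
    lintegral_waveWeight hd hd' hr hl]
  · exact Eventually.of_forall fun p => mul_nonneg (Real.exp_pos _).le (heatKernel_nonneg _ _ _)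
  · refine Measurable.aestronglyMeasurable ?_
    have := (measurable_heatKernel d).comp (measurable_id.prodMk (measurable_const (a := r)))
    exact Measurable.mul (by fun_prop) this
  · exact Eventually.of_forall fun p =>
      mul_nonneg (waveWeight_nonneg _ hr.le _) (Real.exp_pos _).le
  · exact (((measurable_waveWeight d).comp hm).mul ((((continuous_waveDelay d).measurable.comp
      hm).const_mul (-l)).exp)).aestronglyMeasurable

/-! ### The Fourier transform of the wave kernel -/

/-- The integrand of the Fourier-Laplace transform of the fundamental solution. -/
def waveIntegrand (ξ : E d) (z : ℂ) (p : E d × ℝ) : ℂ :=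
  ((Real.fourierChar (-inner ℝ p.1 ξ) : Circle) : ℂ) *
    (waveWeight d ‖p.1‖ p.2 * Complex.exp (-z * waveDelay d ‖p.1‖ p.2))

theorem measurable_waveIntegrand (ξ : E d) (z : ℂ) : Measurable (waveIntegrand ξ z) := by
  have h : Measurable fun p : E d × ℝ => (‖p.1‖, p.2) := by fun_prop
  have h1 := ((measurable_waveWeight d).comp h).complex_ofReal
  have h2 := (((continuous_waveDelay d).measurable.comp h).complex_ofReal.const_mul (-z)).cexp
  have h3 : Measurable fun p : E d × ℝ => ((Real.fourierChar (-inner ℝ p.1 ξ) : Circle) : ℂ) := by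
    refine Continuous.measurable ?_
    have := Real.continuous_fourierChar
    fun_prop
  exact h3.mul (h1.mul h2)

theorem norm_waveIntegrand (ξ : E d) (z : ℂ) (p : E d × ℝ) : ‖waveIntegrand ξ z p‖
    = waveWeight d ‖p.1‖ p.2 * Real.exp (-z.re * waveDelay d ‖p.1‖ p.2) := by
  rw [waveIntegrand, norm_mul, Circle.norm_coe, one_mul, norm_mul, Complex.norm_real,
    Real.norm_of_nonneg (waveWeight_nonneg _ (norm_nonneg _) _), Complex.norm_exp]
  simp

theorem integrable_waveIntegrand (hd : 1 ≤ d) (hd' : d ≤ 3) (ξ : E d) {z : ℂ} (hz : 0 < z.re) :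
    Integrable (waveIntegrand ξ z) (volume.prod (waveBase d)) :=
  (integrable_waveWeight_exp hd hd' hz).mono' (measurable_waveIntegrand ξ z).aestronglyMeasurable
    (Eventually.of_forall fun p => (norm_waveIntegrand ξ z p).le)

theorem ae_waveDelay_prod_nonneg (d : ℕ) :
    ∀ᵐ p : E d × ℝ ∂(volume.prod (waveBase d)), 0 ≤ waveDelay d ‖p.1‖ p.2 := by
  unfold waveBase waveDelay
  split_ifs
  · exact Eventually.of_forall fun _ => norm_nonneg _
  · have h : ∀ᵐ v ∂(volume.restrict (Set.Ioi (0 : ℝ))), 0 ≤ v :=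
      (ae_restrict_iff' measurableSet_Ioi).2 (Eventually.of_forall fun v hv => le_of_lt hv)
    exact Measure.quasiMeasurePreserving_snd.ae h

/-- A factor `s` is paid for with half of the exponential decay rate. -/
theorem mul_exp_neg_le {δ s : ℝ} (hδ : 0 < δ) :
    s * Real.exp (-δ * s) ≤ 2 / δ * Real.exp (-(δ / 2) * s) := by
  have h1 : s ≤ 2 / δ * Real.exp (δ / 2 * s) := by
    have h2 := Real.add_one_le_exp (δ / 2 * s)
    rw [div_mul_eq_mul_div, le_div_iff₀ hδ]
    linarith
  calc _ ≤ 2 / δ * Real.exp (δ / 2 * s) * Real.exp (-δ * s) := by gcongr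
    _ = _ := by
      rw [mul_assoc, ← Real.exp_add]
      ring_nf

theorem hasDerivAt_integral_waveIntegrand (hd : 1 ≤ d) (hd' : d ≤ 3) (ξ : E d) {z : ℂ}
    (hz : 0 < z.re) :
    Integrable (fun p => -(waveDelay d ‖p.1‖ p.2 : ℂ) * waveIntegrand ξ z p)
      (volume.prod (waveBase d)) ∧
    HasDerivAt (fun z => ∫ p, waveIntegrand ξ z p ∂(volume.prod (waveBase d)))
      (∫ p, -(waveDelay d ‖p.1‖ p.2 : ℂ) * waveIntegrand ξ z p ∂(volume.prod (waveBase d))) z := by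
  have hδ : 0 < z.re / 2 := by positivity
  have hm : ∀ z, Measurable fun p : E d × ℝ => -(waveDelay d ‖p.1‖ p.2 : ℂ) * waveIntegrand ξ z p :=
    fun z => by
      have h : Measurable fun p : E d × ℝ => (‖p.1‖, p.2) := by fun_prop
      exact ((continuous_waveDelay d).measurable.comp h).complex_ofReal.neg.mul
        (measurable_waveIntegrand ξ z)
  -- On this ball the decay rate is at least `z.re / 2`, and half of it absorbs the delay brought
  -- down by differentiation.
  refine hasDerivAt_integral_of_dominated_loc_of_deriv_le (s := Metric.ball z (z.re / 2))
    (Metric.ball_mem_nhds z hδ) (F' := fun z p => -(waveDelay d ‖p.1‖ p.2 : ℂ) * waveIntegrand ξ z p)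
    (bound := fun p => 2 / (z.re / 2) * (waveWeight d ‖p.1‖ p.2
      * Real.exp (-(z.re / 2 / 2) * waveDelay d ‖p.1‖ p.2)))
    (Eventually.of_forall fun z => (measurable_waveIntegrand ξ z).aestronglyMeasurable)
    (integrable_waveIntegrand hd hd' ξ hz) (hm z).aestronglyMeasurable ?_
    ((integrable_waveWeight_exp hd hd' (by positivity)).const_mul _) ?_
  · filter_upwards [ae_waveDelay_prod_nonneg d] with p hp y hy
    have h1 : z.re / 2 ≤ y.re := by
      have h2 := (Complex.abs_re_le_norm (y - z)).trans (le_of_lt (by simpa [dist_eq_norm] using hy))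
      rw [Complex.sub_re, abs_le] at h2
      linarith [h2.1]
    have hw := waveWeight_nonneg d (norm_nonneg p.1) p.2
    rw [norm_mul, norm_waveIntegrand, norm_neg, Complex.norm_real, Real.norm_of_nonneg hp]
    calc _ ≤ waveDelay d ‖p.1‖ p.2 * (waveWeight d ‖p.1‖ p.2
          * Real.exp (-(z.re / 2) * waveDelay d ‖p.1‖ p.2)) := by gcongr
      _ = waveWeight d ‖p.1‖ p.2 * (waveDelay d ‖p.1‖ p.2
          * Real.exp (-(z.re / 2) * waveDelay d ‖p.1‖ p.2)) := by ring
      _ ≤ waveWeight d ‖p.1‖ p.2 * (2 / (z.re / 2)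
          * Real.exp (-(z.re / 2 / 2) * waveDelay d ‖p.1‖ p.2)) := by
        exact mul_le_mul_of_nonneg_left (mul_exp_neg_le hδ) hw
      _ = _ := by ring
  · refine Eventually.of_forall fun p y _ => ?_
    have h1 : HasDerivAt (fun y : ℂ => Complex.exp (-y * waveDelay d ‖p.1‖ p.2))
        (Complex.exp (-y * waveDelay d ‖p.1‖ p.2) * (-1 * waveDelay d ‖p.1‖ p.2)) y :=
      (((hasDerivAt_id' y).neg).mul_const _).cexp
    have h2 := (h1.const_mul (waveWeight d ‖p.1‖ p.2 : ℂ)).const_mul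
      ((Real.fourierChar (-inner ℝ p.1 ξ) : Circle) : ℂ)
    refine h2.congr_deriv ?_
    rw [waveIntegrand]
    ring

/-- For real `l` the delay integral may be replaced by the heat kernel integral. The transform in
`x` is then Gaussian, and the remaining integral over `τ` is `1 / (l² + |2πξ|²)`. -/
theorem integral_waveIntegrand_ofReal (hd : 1 ≤ d) (hd' : d ≤ 3) (ξ : E d) {l : ℝ} (hl : 0 < l) :
    ∫ p, waveIntegrand ξ l p ∂(volume.prod (waveBase d)) = greenSymbol d l ξ := by
  rw [integral_prod _ (integrable_waveIntegrand hd hd' ξ (by simpa using hl))]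
  have h1 : ∀ᵐ x : E d, ∫ v, waveIntegrand ξ l (x, v) ∂waveBase d
      = ∫ τ in Set.Ioi (0 : ℝ), ((Real.fourierChar (-inner ℝ x ξ) : Circle) : ℂ)
        * ((Real.exp (-(l ^ 2 * τ)) * heatKernel d τ ‖x‖ : ℝ) : ℂ) := by
    filter_upwards [ae_norm_pos hd] with x hx
    have e : ∀ v, waveIntegrand ξ l (x, v) = ((Real.fourierChar (-inner ℝ x ξ) : Circle) : ℂ)
        * ((waveWeight d ‖x‖ v * Real.exp (-l * waveDelay d ‖x‖ v) : ℝ) : ℂ) := fun v => by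
      rw [waveIntegrand]
      push_cast
      rfl
    simp only [e]
    rw [integral_const_mul, integral_const_mul, integral_complex_ofReal, integral_complex_ofReal,
      integral_waveWeight hd hd' hx hl]
  rw [integral_congr_ae h1, integral_integral_swap]
  · have h2 : ∀ τ ∈ Set.Ioi (0 : ℝ), ∫ x : E d, ((Real.fourierChar (-inner ℝ x ξ) : Circle) : ℂ)
        * ((Real.exp (-(l ^ 2 * τ)) * heatKernel d τ ‖x‖ : ℝ) : ℂ)
        = ((Real.exp (-(l ^ 2 + (2 * Real.pi * ‖ξ‖) ^ 2) * τ) : ℝ) : ℂ) := fun τ hτ => by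
      have h3 := fourier_heatKernel hτ ξ
      rw [Real.fourier_eq] at h3
      simp only [Circle.smul_def, smul_eq_mul] at h3
      have h4 : ∀ x : E d, ((Real.fourierChar (-inner ℝ x ξ) : Circle) : ℂ)
          * ((Real.exp (-(l ^ 2 * τ)) * heatKernel d τ ‖x‖ : ℝ) : ℂ)
          = (Real.exp (-(l ^ 2 * τ)) : ℂ) * (((Real.fourierChar (-inner ℝ x ξ) : Circle) : ℂ)
          * (heatKernel d τ ‖x‖ : ℂ)) := fun x => by
        push_cast
        ring
      simp only [h4]
      rw [integral_const_mul, h3]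
      push_cast
      rw [← Complex.exp_add]
      ring_nf
    rw [setIntegral_congr_fun measurableSet_Ioi h2, integral_complex_ofReal,
      integral_exp_mul_Ioi (neg_lt_zero.2 (by positivity)), greenSymbol]
    simp only [mul_zero, Real.exp_zero, neg_div_neg_eq, one_div]
    push_cast
    rfl
  · refine (integrable_heat_time (d := d) hl).mono ?_ (Eventually.of_forall fun p => ?_)
    · refine Measurable.aestronglyMeasurable ?_
      have h3 : Measurable fun p : E d × ℝ =>
          ((Real.fourierChar (-inner ℝ p.1 ξ) : Circle) : ℂ) := by
        refine Continuous.measurable ?_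
        have := Real.continuous_fourierChar
        fun_prop
      exact h3.mul (measurable_heat_time l).complex_ofReal
    · simp only [Function.uncurry]
      rw [norm_mul, Circle.norm_coe, one_mul, Complex.norm_real]

theorem hasDerivAt_greenSymbol {z : ℂ} (hz : 0 < z.re) (ξ : E d) :
    HasDerivAt (fun z => greenSymbol d z ξ) (-(2 * z * greenSymbol d z ξ ^ 2)) z := by
  have h := ((hasDerivAt_pow 2 z).add_const (((2 * Real.pi * ‖ξ‖ : ℝ) : ℂ) ^ 2)).inv
    (sq_add_sq_ne_zero hz _)
  refine h.congr_deriv ?_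
  rw [greenSymbol]
  have := sq_add_sq_ne_zero hz (2 * Real.pi * ‖ξ‖)
  field_simp
  simp [mul_comm]

/-- Both sides are holomorphic on the right half plane and agree on the real `l > 1`, which
accumulate at `1`. -/
theorem integral_waveIntegrand (hd : 1 ≤ d) (hd' : d ≤ 3) (ξ : E d) {z : ℂ} (hz : 0 < z.re) :
    ∫ p, waveIntegrand ξ z p ∂(volume.prod (waveBase d)) = greenSymbol d z ξ := by
  have hU : IsOpen {z : ℂ | 0 < z.re} := isOpen_lt continuous_const Complex.continuous_re
  have h1 : AnalyticOnNhd ℂ (fun z => ∫ p, waveIntegrand ξ z p ∂(volume.prod (waveBase d)))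
      {z : ℂ | 0 < z.re} := DifferentiableOn.analyticOnNhd (fun z hz =>
    (hasDerivAt_integral_waveIntegrand hd hd' ξ hz).2.differentiableAt.differentiableWithinAt) hU
  have h2 : AnalyticOnNhd ℂ (fun z => greenSymbol d z ξ) {z : ℂ | 0 < z.re} :=
    DifferentiableOn.analyticOnNhd (fun z hz =>
      (hasDerivAt_greenSymbol hz ξ).differentiableAt.differentiableWithinAt) hU
  refine h1.eqOn_of_preconnected_of_frequently_eq h2 (z₀ := 1)
    (convex_halfSpace_re_gt 0).isPreconnected (by simp) ?_ hz
  have h3 : Tendsto (fun l : ℝ => (l : ℂ)) (𝓝[>] 1) (𝓝[≠] 1) := by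
    refine tendsto_nhdsWithin_of_tendsto_nhds_of_eventually_within _ ?_ ?_
    · exact (Complex.continuous_ofReal.tendsto' 1 1 (by simp)).mono_left nhdsWithin_le_nhds
    · filter_upwards [self_mem_nhdsWithin] with l hl
      have : (1 : ℝ) < l := hl
      simp only [Set.mem_compl_iff, Set.mem_singleton_iff]
      exact_mod_cast this.ne'
  refine h3.frequently (Eventually.frequently ?_)
  filter_upwards [self_mem_nhdsWithin] with l hl
  exact integral_waveIntegrand_ofReal hd hd' ξ (zero_lt_one.trans hl)

/-- Two computations of the same derivative in `z`: under the integral a delay comes down, and on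
the symbol one gets `-2 z r²`. -/
theorem integral_delay_waveIntegrand (hd : 1 ≤ d) (hd' : d ≤ 3) (ξ : E d) {z : ℂ}
    (hz : 0 < z.re) :
    ∫ p, -(waveDelay d ‖p.1‖ p.2 : ℂ) * waveIntegrand ξ z p ∂(volume.prod (waveBase d))
      = -(2 * z * greenSymbol d z ξ ^ 2) := by
  have h1 := (hasDerivAt_integral_waveIntegrand hd hd' ξ hz).2
  have hU : IsOpen {z : ℂ | 0 < z.re} := isOpen_lt continuous_const Complex.continuous_re
  refine h1.unique ((hasDerivAt_greenSymbol hz ξ).congr_of_eventuallyEq ?_)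
  filter_upwards [hU.mem_nhds hz] with y hy
  exact integral_waveIntegrand hd hd' ξ hy

/-- The Laplace transform of the fundamental solution of the wave equation. -/
def waveGreen (d : ℕ) (z : ℂ) (r : ℝ) : ℂ :=
  ∫ v, waveWeight d r v * Complex.exp (-z * waveDelay d r v) ∂waveBase d

/-- Minus the derivative of `waveGreen` with respect to `z`. -/
def waveGreenDelay (d : ℕ) (z : ℂ) (r : ℝ) : ℂ :=
  ∫ v, waveDelay d r v * (waveWeight d r v * Complex.exp (-z * waveDelay d r v)) ∂waveBase d

theorem integrable_waveGreen (hd : 1 ≤ d) (hd' : d ≤ 3) {z : ℂ} (hz : 0 < z.re) :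
    Integrable fun x : E d => waveGreen d z ‖x‖ := by
  have h := (integrable_waveIntegrand hd hd' 0 hz).integral_prod_left
  simpa [waveIntegrand, waveGreen] using h

theorem fourier_waveGreen (hd : 1 ≤ d) (hd' : d ≤ 3) {z : ℂ} (hz : 0 < z.re) :
    𝓕 (fun x : E d => waveGreen d z ‖x‖) = greenSymbol d z := by
  ext ξ
  rw [← integral_waveIntegrand hd hd' ξ hz, integral_prod _ (integrable_waveIntegrand hd hd' ξ hz),
    Real.fourier_eq]
  simp only [waveIntegrand, Circle.smul_def, smul_eq_mul, integral_const_mul, waveGreen]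

theorem integrable_waveGreenDelay (hd : 1 ≤ d) (hd' : d ≤ 3) {z : ℂ} (hz : 0 < z.re) :
    Integrable fun x : E d => waveGreenDelay d z ‖x‖ := by
  have h := (hasDerivAt_integral_waveIntegrand hd hd' 0 hz).1.integral_prod_left.neg
  refine h.congr (Eventually.of_forall fun x => ?_)
  simp [waveIntegrand, waveGreenDelay, integral_neg]

theorem fourier_waveGreenDelay (hd : 1 ≤ d) (hd' : d ≤ 3) {z : ℂ} (hz : 0 < z.re) :
    𝓕 (fun x : E d => waveGreenDelay d z ‖x‖) = fun ξ => 2 * z * greenSymbol d z ξ ^ 2 := by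
  ext ξ
  have h := integral_delay_waveIntegrand hd hd' ξ hz
  rw [integral_prod _ (hasDerivAt_integral_waveIntegrand hd hd' ξ hz).1] at h
  rw [← neg_neg (2 * z * _), ← h, Real.fourier_eq, ← integral_neg]
  refine integral_congr_ae (Eventually.of_forall fun x => ?_)
  simp only [Circle.smul_def, smul_eq_mul, waveGreenDelay]
  rw [← integral_neg, ← integral_const_mul]
  refine integral_congr_ae (Eventually.of_forall fun v => ?_)
  simp only [waveIntegrand]
  ring

end WaveTrace

end

/-! ### Green functions in real space and a majorant uniform in `w`. -/

noncomputable section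

namespace WaveTrace

open Filter Topology

variable {d : ℕ}

/-! ### Green functions in real space -/

theorem zline_neg (w : ℝ) : zline (-w) = (starRingEnd ℂ) (zline w) := by
  simp [zline, Complex.ext_iff]

theorem zline_re_pos (w : ℝ) : 0 < (zline w).re := by
  simp [zline_re]

theorem conj_waveGreen (z : ℂ) (r : ℝ) :
    (starRingEnd ℂ) (waveGreen d z r) = waveGreen d ((starRingEnd ℂ) z) r := by
  simp only [waveGreen]
  rw [← integral_conj]
  simp only [map_mul, Complex.conj_ofReal, ← Complex.exp_conj, map_neg]

theorem conj_waveGreenDelay (z : ℂ) (r : ℝ) :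
    (starRingEnd ℂ) (waveGreenDelay d z r) = waveGreenDelay d ((starRingEnd ℂ) z) r := by
  simp only [waveGreenDelay]
  rw [← integral_conj]
  simp only [map_mul, Complex.conj_ofReal, ← Complex.exp_conj, map_neg]

theorem fourier_comp_sub (h : E d → ℂ) (x : E d) :
    𝓕 (fun y => h (y - x)) = fun ξ => ((Real.fourierChar (-inner ℝ ξ x) : Circle) : ℂ) * 𝓕 h ξ := by
  ext ξ
  rw [Real.fourier_eq, Real.fourier_eq, ← integral_const_mul,
    ← integral_add_right_eq_self _ x]
  refine integral_congr_ae (Eventually.of_forall fun y => ?_)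
  simp only [add_sub_cancel_right, Circle.smul_def, smul_eq_mul]
  rw [inner_add_left, neg_add, AddChar.map_add_eq_mul, Circle.coe_mul, real_inner_comm ξ x]
  ring

/-- Translation by `x` is multiplication by the phase of `pointSource` on the Fourier side. -/
theorem pointSource_ae_eq {h m : E d → ℂ} (hh : Integrable h) (hf : 𝓕 h = m)
    (hm : MemLp m 2 volume) (x : E d) : pointSource hm x =ᵐ[volume] fun y => h (y - x) := by
  refine fourierInv_ae_eq_of_fourier_eq (hh.comp_sub_right x) ?_
  rw [fourier_comp_sub, hf]
  exact MemLp.coeFn_toLp _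

theorem greenL2_ae_eq (hd : 1 ≤ d) (hd' : d ≤ 3) (w : ℝ) (x : E d) :
    greenL2 hd' w x =ᵐ[volume] fun y => waveGreen d (zline w) ‖y - x‖ :=
  pointSource_ae_eq (integrable_waveGreen hd hd' (zline_re_pos w))
    (fourier_waveGreen hd hd' (zline_re_pos w)) _ x

theorem inner_eq_integral_of_ae_eq {a f : L2 d} {h : E d → ℂ} (ha : a =ᵐ[volume] h) :
    inner ℂ a f = ∫ y, (starRingEnd ℂ) (h y) * f y := by
  rw [L2.inner_def]
  refine integral_congr_ae ?_
  filter_upwards [ha] with y hy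
  rw [hy, RCLike.inner_apply, mul_comm]

theorem inner_greenL2 (hd : 1 ≤ d) (hd' : d ≤ 3) (w : ℝ) (x : E d) (f : L2 d) :
    inner ℂ (greenL2 hd' (-w) x) f = ∫ y, waveGreen d (zline w) ‖y - x‖ * f y := by
  rw [inner_eq_integral_of_ae_eq (greenL2_ae_eq hd hd' (-w) x)]
  simp only [conj_waveGreen, zline_neg, Complex.conj_conj]

theorem multiplier_resSym_ae_eq_integral (hd : 1 ≤ d) (hd' : d ≤ 3) (w : ℝ) (f : L2 d) :
    multiplier (resSym d w) f =ᵐ[volume] fun x => ∫ y, waveGreen d (zline w) ‖y - x‖ * f y := by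
  filter_upwards [multiplier_resSym_ae_eq hd' w f] with x hx
  rw [hx, inner_greenL2 hd hd']

theorem memLp_greenSymbol_sq (hd : d ≤ 3) (w : ℝ) :
    MemLp (fun ξ : E d => 2 * zline w * greenSymbol d (zline w) ξ ^ 2) 2 volume := by
  have h := (memLp_greenSymbol hd w).const_mul (2 * zline w)
  have hc : Continuous fun ξ : E d => greenSymbol d (zline w) ξ :=
    continuous_greenSymbol continuous_const (fun _ => by simp [zline_re]) continuous_id
  refine h.of_le (by fun_prop) (Eventually.of_forall fun ξ => ?_)
  rw [sq, ← mul_assoc, norm_mul]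
  exact mul_le_of_le_one_right (norm_nonneg _) (norm_greenSymbol_zline_le_one w ξ)

/-- The two resolvents and the factor `2 z` merge into the symbol `2 z r²`, whose kernel is the wave
kernel weighted by the delay. This puts the factor `t` of the final formula on one side of the
polygon. -/
theorem inner_greenL2_resSym (hd : 1 ≤ d) (hd' : d ≤ 3) (w : ℝ) (x : E d) (f : L2 d) :
    inner ℂ (greenL2 hd' (-w) x) ((2 * zline w) • multiplier (resSym d w) f)
      = ∫ y, waveGreenDelay d (zline w) ‖y - x‖ * f y := by
  have h1 := inner_eq_integral_of_ae_eq (f := f) (pointSource_ae_eq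
    (integrable_waveGreenDelay hd hd' (zline_re_pos (-w)))
    (fourier_waveGreenDelay hd hd' (zline_re_pos (-w))) (memLp_greenSymbol_sq hd' (-w)) x)
  simp only [conj_waveGreenDelay, zline_neg, Complex.conj_conj] at h1
  rw [← h1, inner_smul_right, greenL2, inner_pointSource, inner_pointSource, ← integral_const_mul]
  refine integral_congr_ae ?_
  filter_upwards [fourier_multiplier (resSym d w) f] with ξ hξ
  rw [hξ, resSym_apply]
  simp only [map_mul, map_pow, Complex.conj_conj, map_ofNat, conj_greenSymbol_zline]
  rw [← zline_neg, conj_greenSymbol_zline]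
  ring

/-! ### The majorant of the Green functions -/

/-- A common majorant of the Green functions on the line `Re z = 1`. -/
def greenBound (d : ℕ) (r : ℝ) : ℝ≥0∞ :=
  ∫⁻ v, ENNReal.ofReal (waveWeight d r v * Real.exp (-(1 / 2) * waveDelay d r v)) ∂waveBase d

theorem measurable_weight_exp (d : ℕ) (l : ℝ) : Measurable fun p : ℝ × ℝ =>
    waveWeight d p.1 p.2 * Real.exp (-l * waveDelay d p.1 p.2) :=
  (measurable_waveWeight d).mul (((continuous_waveDelay d).measurable.const_mul (-l)).exp)

theorem measurable_greenBound (d : ℕ) : Measurable (greenBound d) :=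
  (measurable_weight_exp d (1 / 2)).ennreal_ofReal.lintegral_prod_right'

theorem measurable_waveGreen (d : ℕ) (z : ℂ) : Measurable (waveGreen d z) := by
  have h : Measurable fun p : ℝ × ℝ => (waveWeight d p.1 p.2 : ℂ)
      * Complex.exp (-z * waveDelay d p.1 p.2) :=
    (measurable_waveWeight d).complex_ofReal.mul
      ((continuous_waveDelay d).measurable.complex_ofReal.const_mul (-z)).cexp
  exact (h.stronglyMeasurable.integral_prod_right' (ν := waveBase d)).measurable

theorem measurable_waveGreenDelay (d : ℕ) (z : ℂ) : Measurable (waveGreenDelay d z) := by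
  have h : Measurable fun p : ℝ × ℝ => (waveDelay d p.1 p.2 : ℂ) * ((waveWeight d p.1 p.2 : ℂ)
      * Complex.exp (-z * waveDelay d p.1 p.2)) :=
    (continuous_waveDelay d).measurable.complex_ofReal.mul
      ((measurable_waveWeight d).complex_ofReal.mul
        ((continuous_waveDelay d).measurable.complex_ofReal.const_mul (-z)).cexp)
  exact (h.stronglyMeasurable.integral_prod_right' (ν := waveBase d)).measurable

theorem enorm_waveGreen_le (w : ℝ) {r : ℝ} (hr : 0 ≤ r) :
    ‖waveGreen d (zline w) r‖ₑ ≤ greenBound d r := by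
  refine (enorm_integral_le_lintegral_enorm _).trans (lintegral_mono_ae ?_)
  filter_upwards [ae_waveDelay_nonneg d hr] with v hv
  have hw := waveWeight_nonneg d hr v
  rw [← ofReal_norm, norm_mul, Complex.norm_real, Real.norm_of_nonneg hw,
    norm_cexp_zline]
  refine ENNReal.ofReal_le_ofReal (mul_le_mul_of_nonneg_left (Real.exp_le_exp.2 ?_) hw)
  linarith

/-- The majorant has decay rate `1/2` instead of `1` precisely so that it can absorb the delay. -/
theorem enorm_waveGreenDelay_le (w : ℝ) {r : ℝ} (hr : 0 ≤ r) :
    ‖waveGreenDelay d (zline w) r‖ₑ ≤ 2 * greenBound d r := by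
  rw [greenBound, ← lintegral_const_mul' _ _ (by norm_num)]
  refine (enorm_integral_le_lintegral_enorm _).trans (lintegral_mono_ae ?_)
  filter_upwards [ae_waveDelay_nonneg d hr] with v hv
  have hw := waveWeight_nonneg d hr v
  rw [← ofReal_norm, norm_mul, norm_mul, Complex.norm_real, Complex.norm_real,
    Real.norm_of_nonneg hw, Real.norm_of_nonneg hv, norm_cexp_zline, ← ENNReal.ofReal_ofNat 2,
    ← ENNReal.ofReal_mul (by norm_num)]
  refine ENNReal.ofReal_le_ofReal ?_
  have h := mul_exp_neg_le (δ := 1) (s := waveDelay d r v) one_pos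
  rw [neg_one_mul, div_one] at h
  calc _ = waveWeight d r v * (waveDelay d r v * Real.exp (-waveDelay d r v)) := by ring
    _ ≤ waveWeight d r v * (2 * Real.exp (-(1 / 2) * waveDelay d r v)) :=
      mul_le_mul_of_nonneg_left h hw
    _ = _ := by ring

theorem lintegral_greenBound_lt_top (hd : 1 ≤ d) (hd' : d ≤ 3) :
    ∫⁻ x : E d, greenBound d ‖x‖ < ∞ := by
  have h := (integrable_waveWeight_exp hd hd' (l := 1 / 2) (by norm_num)).lintegral_lt_top
  rwa [lintegral_prod _ (measurable_waveWeight_exp _).ennreal_ofReal.aemeasurable] at h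

/-- The majorant is itself the Green function at `z = 1/2`, so its `L²` norm is accessible through
Plancherel. -/
theorem greenBound_ae_eq (hd : 1 ≤ d) (hd' : d ≤ 3) :
    ∀ᵐ x : E d, greenBound d ‖x‖ = ‖waveGreen d ((1 / 2 : ℝ) : ℂ) ‖x‖‖ₑ := by
  filter_upwards [(integrable_waveWeight_exp hd hd' (l := 1 / 2) (by norm_num)).prod_right_ae]
    with x hx
  have e : waveGreen d ((1 / 2 : ℝ) : ℂ) ‖x‖ = ((∫ v, waveWeight d ‖x‖ v
      * Real.exp (-(1 / 2) * waveDelay d ‖x‖ v) ∂waveBase d : ℝ) : ℂ) := by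
    rw [waveGreen, ← integral_complex_ofReal]
    push_cast
    rfl
  have h0 : ∀ v, 0 ≤ waveWeight d ‖x‖ v * Real.exp (-(1 / 2) * waveDelay d ‖x‖ v) := fun v =>
    mul_nonneg (waveWeight_nonneg _ (norm_nonneg _) _) (Real.exp_pos _).le
  rw [e, ← ofReal_norm, Complex.norm_real, Real.norm_of_nonneg (integral_nonneg h0),
    ofReal_integral_eq_lintegral_ofReal hx (Eventually.of_forall h0), greenBound]

theorem lintegral_greenBound_sq_lt_top (hd : 1 ≤ d) (hd' : d ≤ 3) :
    ∫⁻ x : E d, greenBound d ‖x‖ ^ 2 < ∞ := by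
  have hz : 0 < (((1 / 2 : ℝ) : ℂ)).re := by
    rw [Complex.ofReal_re]
    norm_num
  have hm : MemLp (greenSymbol d ((1 / 2 : ℝ) : ℂ)) 2 volume := by
    -- The symbol at `z = 1/2` is compared with the one at `z = 1`: `1/4 + b² ≥ (1 + b²) / 4`.
    refine ((memLp_greenSymbol (d := d) hd' 0).const_mul 4).of_le
      (continuous_greenSymbol continuous_const (fun _ => hz) continuous_id).aestronglyMeasurable
      (Eventually.of_forall fun ξ => ?_)
    have h1 : ∀ l : ℝ, 0 < l → ‖greenSymbol d (l : ℂ) ξ‖ = (l ^ 2 + (2 * Real.pi * ‖ξ‖) ^ 2)⁻¹ :=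
      fun l hl => by
        rw [greenSymbol, ← Complex.ofReal_pow, ← Complex.ofReal_pow, ← Complex.ofReal_add,
          ← Complex.ofReal_inv, Complex.norm_real, Real.norm_of_nonneg (by positivity)]
    have h2 : zline 0 = ((1 : ℝ) : ℂ) := by simp [zline]
    rw [norm_mul, h2, h1 _ (by norm_num), h1 _ one_pos, ← div_eq_mul_inv, inv_eq_one_div,
      div_le_div_iff₀ (by positivity) (by positivity)]
    norm_num
    nlinarith [sq_nonneg (2 * Real.pi * ‖ξ‖)]
  have h1 : MemLp (fun x : E d => waveGreen d ((1 / 2 : ℝ) : ℂ) ‖x‖) 2 volume := by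
    have h2 := pointSource_ae_eq (integrable_waveGreen hd hd' hz) (fourier_waveGreen hd hd' hz)
      hm 0
    simp only [sub_zero] at h2
    exact (memLp_congr_ae h2).1 (Lp.memLp _)
  have h3 := h1.eLpNorm_lt_top
  rw [eLpNorm_lt_top_iff_lintegral_rpow_enorm_lt_top (by norm_num) (by norm_num)] at h3
  refine lt_of_eq_of_lt (lintegral_congr_ae ?_) h3
  filter_upwards [greenBound_ae_eq hd hd'] with x hx
  rw [hx]
  simp

end WaveTrace

end

/-! ### The Born trace as an integral over closed polygons. -/

noncomputable section

namespace WaveTrace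

open Filter Topology

variable {d : ℕ}

/-! ### Integrals over finite families of points -/

section FinCons

variable {X : Type} [MeasureSpace X] {n : ℕ}

/-- `Fin.cons` as an equivalence of measurable spaces. -/
def finCons (X : Type) [MeasureSpace X] (n : ℕ) : X × (Fin n → X) ≃ᵐ (Fin (n + 1) → X) :=
  (MeasurableEquiv.piFinSuccAbove (fun _ : Fin (n + 1) => X) 0).symm

theorem finCons_apply (p : X × (Fin n → X)) : finCons X n p = Fin.cons p.1 p.2 := by
  simp [finCons, MeasurableEquiv.piFinSuccAbove, Fin.consEquiv]

variable [SigmaFinite (volume : Measure X)]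

theorem measurePreserving_finCons : MeasurePreserving (finCons X n) (volume.prod volume) volume :=
  (volume_preserving_piFinSuccAbove (fun _ : Fin (n + 1) => X) 0).symm

theorem lintegral_finCons {f : (Fin (n + 1) → X) → ℝ≥0∞} (hf : Measurable f) :
    ∫⁻ v, f v = ∫⁻ a, ∫⁻ v, f (Fin.cons a v) := by
  rw [← measurePreserving_finCons.lintegral_comp hf,
    lintegral_prod (fun p => f (finCons X n p)) (hf.comp (finCons X n).measurable).aemeasurable]
  simp only [finCons_apply]

theorem integrable_finCons {Y : Type} [NormedAddCommGroup Y] {f : (Fin (n + 1) → X) → Y} :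
    Integrable (fun p : X × (Fin n → X) => f (Fin.cons p.1 p.2)) (volume.prod volume)
      ↔ Integrable f := by
  rw [← (measurePreserving_finCons (X := X) (n := n)).integrable_comp_emb
    (finCons X n).measurableEmbedding]
  simp only [Function.comp_def, finCons_apply]

theorem integral_finCons {Y : Type} [NormedAddCommGroup Y] [NormedSpace ℝ Y]
    {f : (Fin (n + 1) → X) → Y} (hf : Integrable f) :
    ∫ v, f v = ∫ a, ∫ v, f (Fin.cons a v) := by
  rw [← measurePreserving_finCons.integral_comp', integral_prod _ _]
  · simp only [finCons_apply]
  · simp only [finCons_apply]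
    exact integrable_finCons.2 hf

end FinCons

/-! ### Iterated Green functions -/

/-- The iterated kernel of the majorant of the Green functions. -/
def boundChain (d : ℕ) : ℕ → E d → E d → ℝ≥0∞
  | 0, y, x => greenBound d ‖x - y‖
  | n + 1, y, x => ∫⁻ y', greenBound d ‖y' - y‖ * boundChain d n y' x

theorem measurable_boundChain (d n : ℕ) :
    Measurable fun p : E d × E d => boundChain d n p.1 p.2 := by
  induction n with
  | zero => exact (measurable_greenBound d).comp (by fun_prop)
  | succ n ih =>
    simp only [boundChain]
    refine Measurable.lintegral_prod_right' (f := fun p : (E d × E d) × E d =>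
      greenBound d ‖p.2 - p.1.1‖ * boundChain d n p.2 p.1.2) ?_
    exact ((measurable_greenBound d).comp (by fun_prop)).mul
      (ih.comp (measurable_snd.prodMk measurable_fst.snd))

theorem lintegral_greenBound_sub (y : E d) {f : ℝ≥0∞ → ℝ≥0∞} :
    ∫⁻ x : E d, f (greenBound d ‖x - y‖) = ∫⁻ x : E d, f (greenBound d ‖x‖) :=
  lintegral_sub_right_eq_self (fun x => f (greenBound d ‖x‖)) y

/-- The convolution of two functions in `L²` is bounded, and each further convolution is with a
function in `L¹`. A single Green function may be singular at its pole, hence the index `n + 1`. -/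
theorem exists_boundChain_le (hd : 1 ≤ d) (hd' : d ≤ 3) (n : ℕ) :
    ∃ M : ℝ≥0∞, M < ∞ ∧ ∀ y x, boundChain d (n + 1) y x ≤ M := by
  induction n with
  | zero =>
    refine ⟨(∫⁻ x : E d, greenBound d ‖x‖ ^ 2) + ∫⁻ x : E d, greenBound d ‖x‖ ^ 2,
      ENNReal.add_lt_top.2 ⟨lintegral_greenBound_sq_lt_top hd hd',
        lintegral_greenBound_sq_lt_top hd hd'⟩, fun y x => ?_⟩
    simp only [boundChain]
    have h : ∀ a b : ℝ≥0∞, a * b ≤ a ^ 2 + b ^ 2 := fun a b => by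
      rcases le_total a b with h | h
      · exact (mul_le_mul_left h b).trans (by rw [← sq]; exact le_add_self)
      · exact (mul_le_mul_right h a).trans (by rw [← sq]; exact le_self_add)
    refine (lintegral_mono fun y' => h _ _).trans ?_
    have hm : Measurable fun y' : E d => greenBound d ‖y' - y‖ ^ 2 :=
      ((measurable_greenBound d).comp (by fun_prop)).pow_const 2
    rw [lintegral_add_left hm]
    refine add_le_add (lintegral_greenBound_sub y (f := fun a => a ^ 2)).le ?_
    simp_rw [norm_sub_rev x]
    exact (lintegral_greenBound_sub x (f := fun a => a ^ 2)).le
  | succ n ih =>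
    obtain ⟨M, hM, h⟩ := ih
    refine ⟨(∫⁻ x : E d, greenBound d ‖x‖) * M,
      ENNReal.mul_lt_top (lintegral_greenBound_lt_top hd hd') hM, fun y x => ?_⟩
    rw [boundChain]
    calc _ ≤ ∫⁻ y' : E d, greenBound d ‖y' - y‖ * M :=
          lintegral_mono fun y' => mul_le_mul_right (h y' x) _
      _ = _ := by
        rw [lintegral_mul_const' _ _ hM.ne]
        congr 1
        exact lintegral_greenBound_sub y (f := fun a => a)

/-- The integrand of the kernel of the iterated operator `(r V)ⁿ r`. -/
def greenChain (q : E d → ℂ) (w : ℝ) : (n : ℕ) → E d → (Fin n → E d) → E d → ℂ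
  | 0, y, _, x => waveGreen d (zline w) ‖x - y‖
  | n + 1, y, v, x =>
    waveGreen d (zline w) ‖v 0 - y‖ * (q (v 0) * greenChain q w n (v 0) (Fin.tail v) x)

theorem measurable_greenChain {q : E d → ℂ} (hq : Measurable q) (w : ℝ) (n : ℕ) :
    Measurable fun p : E d × (Fin n → E d) × E d => greenChain q w n p.1 p.2.1 p.2.2 := by
  induction n with
  | zero => exact (measurable_waveGreen d _).comp (by fun_prop)
  | succ n ih =>
    have h0 : Measurable fun p : E d × (Fin (n + 1) → E d) × E d => p.2.1 0 := by fun_prop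
    have h1 : Measurable fun p : E d × (Fin (n + 1) → E d) × E d =>
        (p.2.1 0, Fin.tail p.2.1, p.2.2) := by
      refine h0.prodMk (Measurable.prodMk ?_ (by fun_prop))
      exact measurable_pi_lambda _ fun i => by
        simp only [Fin.tail]
        fun_prop
    exact ((measurable_waveGreen d _).comp (by fun_prop)).mul ((hq.comp h0).mul (ih.comp h1))

theorem lintegral_greenChain_le {q : E d → ℂ} (hq : Measurable q) {C : ℝ≥0∞} (hC : ∀ x, ‖q x‖ₑ ≤ C)
    (w : ℝ) (n : ℕ) (y x : E d) :
    ∫⁻ v, ‖greenChain q w n y v x‖ₑ ≤ C ^ n * boundChain d n y x := by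
  induction n generalizing y with
  | zero =>
    simp only [greenChain, boundChain, pow_zero, one_mul]
    rw [lintegral_const, volume_pi, Measure.pi_univ]
    simpa using enorm_waveGreen_le w (norm_nonneg _)
  | succ n ih =>
    have hm : Measurable fun v : Fin (n + 1) → E d => ‖greenChain q w (n + 1) y v x‖ₑ :=
      ((measurable_greenChain hq w (n + 1)).comp
        (measurable_const.prodMk (measurable_id.prodMk measurable_const))).enorm
    have hm' : ∀ a : E d, Measurable fun v : Fin n → E d => ‖greenChain q w n a v x‖ₑ := fun a =>
      ((measurable_greenChain hq w n).comp
        (measurable_const.prodMk (measurable_id.prodMk measurable_const))).enorm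
    rw [lintegral_finCons hm, boundChain, ← lintegral_const_mul]
    · refine lintegral_mono fun a => ?_
      simp only [greenChain, Fin.cons_zero, Fin.tail_cons, enorm_mul]
      rw [lintegral_const_mul _ ((hm' a).const_mul _), lintegral_const_mul _ (hm' a)]
      calc _ ≤ greenBound d ‖a - y‖ * (C * (C ^ n * boundChain d n a x)) := by
            gcongr
            · exact enorm_waveGreen_le w (norm_nonneg _)
            · exact hC a
            · exact ih a
        _ = _ := by ring
    · exact ((measurable_greenBound d).comp (by fun_prop)).mul
        ((measurable_boundChain d n).comp (measurable_id.prodMk measurable_const))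

theorem integrable_greenChain (hd : 1 ≤ d) (hd' : d ≤ 3) {q : E d → ℂ} (hq : Measurable q) {C : ℝ}
    (hC : ∀ x, ‖q x‖ ≤ C) (w : ℝ) (n : ℕ) (y x : E d) :
    Integrable fun v => greenChain q w (n + 1) y v x := by
  refine ⟨((measurable_greenChain hq w (n + 1)).comp
    (measurable_const.prodMk (measurable_id.prodMk measurable_const))).aestronglyMeasurable, ?_⟩
  obtain ⟨M, hM, h⟩ := exists_boundChain_le hd hd' n
  have hC' : ∀ x, ‖q x‖ₑ ≤ ENNReal.ofReal C := fun x => by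
    rw [← ofReal_norm]
    exact ENNReal.ofReal_le_ofReal (hC x)
  refine (lintegral_greenChain_le hq hC' w (n + 1) y x).trans_lt ?_
  exact ENNReal.mul_lt_top (ENNReal.pow_lt_top ENNReal.ofReal_lt_top) ((h y x).trans_lt hM)

theorem bornStep_ae_eq (hd : 1 ≤ d) (hd' : d ≤ 3) {V : Linfty d} {q : E d → ℂ}
    (hqV : V =ᵐ[volume] q) (w : ℝ) {f : L2 d} {F : E d → ℂ} (hf : f =ᵐ[volume] F) :
    bornStep V w f =ᵐ[volume] fun y => ∫ y', waveGreen d (zline w) ‖y' - y‖ * (q y' * F y') := by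
  filter_upwards [multiplier_resSym_ae_eq_integral hd hd' w (mulL2 V f)] with y hy
  rw [bornStep, ContinuousLinearMap.comp_apply, hy]
  refine integral_congr_ae ?_
  filter_upwards [coeFn_mulL2 V f, hqV, hf] with y' h1 h2 h3
  rw [h1, h2, h3]

/-- For `n = 0` the integral runs over the one-point space of empty families and is just the value.
-/
theorem bornStep_pow_greenL2 (hd : 1 ≤ d) (hd' : d ≤ 3) {V : Linfty d} {q : E d → ℂ}
    (hqV : V =ᵐ[volume] q) (hq : Measurable q) {C : ℝ} (hC : ∀ x, ‖q x‖ ≤ C) (w : ℝ) (n : ℕ)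
    (x : E d) :
    (bornStep V w ^ n) (greenL2 hd' w x) =ᵐ[volume] fun y => ∫ v, greenChain q w n y v x := by
  induction n with
  | zero =>
    filter_upwards [greenL2_ae_eq hd hd' w x] with y hy
    simp only [pow_zero, one_apply_eq_self, greenChain]
    rw [hy, integral_const, norm_sub_rev, measureReal_def, volume_pi, Measure.pi_univ]
    simp
  | succ n ih =>
    rw [pow_succ', mul_apply_eq_comp]
    filter_upwards [bornStep_ae_eq hd hd' hqV w ih] with y hy
    rw [hy, integral_finCons (integrable_greenChain hd hd' hq hC w n y x)]
    simp only [greenChain, Fin.cons_zero, Fin.tail_cons, integral_const_mul]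

/-- The integrand of `bornTrace`. -/
def closedChain (q : E d → ℂ) (w : ℝ) (n : ℕ) (p : Fin (n + 2) → E d) : ℂ :=
  q (p 0) * (waveGreenDelay d (zline w) ‖p 1 - p 0‖ *
    (q (p 1) * greenChain q w n (p 1) (Fin.tail (Fin.tail p)) (p 0)))

theorem measurable_closedChain {q : E d → ℂ} (hq : Measurable q) (w : ℝ) (n : ℕ) :
    Measurable (closedChain q w n) := by
  have h0 : ∀ i : Fin (n + 2), Measurable fun p : Fin (n + 2) → E d => p i := fun i => by fun_prop
  refine (hq.comp (h0 0)).mul (((measurable_waveGreenDelay d _).comp (by fun_prop)).mul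
    ((hq.comp (h0 1)).mul ((measurable_greenChain hq w n).comp
      (f := fun p : Fin (n + 2) → E d => (p 1, Fin.tail (Fin.tail p), p 0))
      ((h0 1).prodMk (Measurable.prodMk ?_ (h0 0))))))
  exact measurable_pi_lambda _ fun i => h0 _

/-- Integrability of `q` controls the position of the first vertex. The shape of the polygon is
controlled by `boundChain d (n + 1) x x`, which is bounded uniformly in `x`. -/
theorem integrable_closedChain (hd : 1 ≤ d) (hd' : d ≤ 3) {q : E d → ℂ} (hq : Measurable q)
    {C : ℝ} (hC : ∀ x, ‖q x‖ ≤ C) (hi : Integrable q) (w : ℝ) (n : ℕ) :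
    Integrable (closedChain q w n) := by
  have hm := measurable_closedChain hq w n
  refine ⟨hm.aestronglyMeasurable, ?_⟩
  obtain ⟨M, hM, h⟩ := exists_boundChain_le hd hd' n
  have hC' : ∀ x, ‖q x‖ₑ ≤ ENNReal.ofReal C := fun x => by
    rw [← ofReal_norm]
    exact ENNReal.ofReal_le_ofReal (hC x)
  have hm1 : ∀ x : E d, Measurable fun v : Fin (n + 1) → E d =>
      ‖closedChain q w n (Fin.cons x v)‖ₑ := fun x => by
    have := hm.comp ((finCons (E d) (n + 1)).measurable.comp
      ((measurable_const (a := x)).prodMk measurable_id))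
    simp only [Function.comp_def, finCons_apply] at this
    exact this.enorm
  have hm2 : ∀ a x : E d, Measurable fun v : Fin n → E d => ‖greenChain q w n a v x‖ₑ :=
    fun a x => ((measurable_greenChain hq w n).comp
        (measurable_const.prodMk (measurable_id.prodMk measurable_const))).enorm
  set D : ℝ≥0∞ := 2 * ENNReal.ofReal C ^ (n + 1) with hD
  have key : ∀ x : E d, ∫⁻ v : Fin (n + 1) → E d, ‖closedChain q w n (Fin.cons x v)‖ₑ
      ≤ ‖q x‖ₑ * (D * M) := by
    intro x
    rw [lintegral_finCons (hm1 x)]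
    calc _ ≤ ∫⁻ a : E d, ‖q x‖ₑ * (D * (greenBound d ‖a - x‖ * boundChain d n a x)) := by
          refine lintegral_mono fun a => ?_
          have h1 : (1 : Fin (n + 2)) = Fin.succ 0 := rfl
          simp only [closedChain, Fin.cons_zero, Fin.tail_cons, h1, Fin.cons_succ, enorm_mul]
          rw [lintegral_const_mul _ (((hm2 a x).const_mul _).const_mul _),
            lintegral_const_mul _ ((hm2 a x).const_mul _), lintegral_const_mul _ (hm2 a x)]
          calc _ ≤ ‖q x‖ₑ * (2 * greenBound d ‖a - x‖ * (ENNReal.ofReal C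
                * (ENNReal.ofReal C ^ n * boundChain d n a x))) := by
                gcongr
                · exact enorm_waveGreenDelay_le w (norm_nonneg _)
                · exact hC' a
                · exact lintegral_greenChain_le hq hC' w n a x
            _ = _ := by
              rw [hD, pow_succ]
              ring
      _ ≤ _ := by
        have hDt : D ≠ ∞ :=
          (ENNReal.mul_lt_top (by norm_num) (ENNReal.pow_lt_top ENNReal.ofReal_lt_top)).ne
        rw [lintegral_const_mul' _ _ enorm_ne_top, lintegral_const_mul' _ _ hDt]
        gcongr
        exact h x x
  rw [hasFiniteIntegral_iff_enorm, lintegral_finCons hm.enorm]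
  refine (lintegral_mono key).trans_lt ?_
  have hDM : D * M < ∞ := ENNReal.mul_lt_top
    (ENNReal.mul_lt_top (by norm_num) (ENNReal.pow_lt_top ENNReal.ofReal_lt_top)) hM
  rw [lintegral_mul_const' _ _ hDM.ne]
  exact ENNReal.mul_lt_top hi.2 hDM

theorem bornTrace_eq_integral (hd : 1 ≤ d) (hd' : d ≤ 3) {V : Linfty d} {q : E d → ℂ}
    (hqV : V =ᵐ[volume] q) (hq : Measurable q) {C : ℝ} (hC : ∀ x, ‖q x‖ ≤ C) (hi : Integrable q)
    (w : ℝ) (n : ℕ) : bornTrace hd' V n w = ∫ p, closedChain q w n p := by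
  have hI := integrable_closedChain hd hd' hq hC hi w n
  rw [integral_finCons hI, bornTrace]
  refine integral_congr_ae ?_
  filter_upwards [hqV, (integrable_finCons.2 hI).prod_right_ae] with x hx hI'
  rw [integral_finCons hI', inner_greenL2_resSym hd hd', hx, ← integral_const_mul]
  refine integral_congr_ae ?_
  filter_upwards [coeFn_mulL2 V ((bornStep V w ^ n) (greenL2 hd' w x)), hqV,
    bornStep_pow_greenL2 hd hd' hqV hq hC w n x] with a h1 h2 h3
  have h4 : (1 : Fin (n + 2)) = Fin.succ 0 := rfl
  simp only [closedChain, Fin.cons_zero, Fin.tail_cons, h4, Fin.cons_succ, integral_const_mul]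
  rw [h1, h2, h3]

end WaveTrace

end

/-! ### Cyclic symmetry, and separation of the position of a polygon from its shape. -/

noncomputable section

namespace WaveTrace

open Filter Topology

variable {d : ℕ}

/-! ### Cyclic symmetry -/

/-- The product of Green functions around a cycle, the `i`-th one differentiated. -/
def cycleTerm (d : ℕ) {k : ℕ} (w : ℝ) (i : Fin k) (r : Fin k → ℝ) : ℂ :=
  ∏ j, if j = i then waveGreenDelay d (zline w) (r j) else waveGreen d (zline w) (r j)

/-- The lengths of the sides of a closed polygon. -/
def cycleSide {n : ℕ} (p : Fin (n + 2) → E d) (j : Fin (n + 2)) : ℝ := ‖p (j + 1) - p j‖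

theorem greenChain_eq_prod (q : E d → ℂ) (w : ℝ) (n : ℕ) (y : E d) (v : Fin n → E d) (x : E d) :
    greenChain q w n y v x = (∏ i, q (v i)) * ∏ i, waveGreen d (zline w)
      ‖(Fin.snoc v x : Fin (n + 1) → E d) i - (Fin.cons y v : Fin (n + 1) → E d) i‖ := by
  induction n generalizing y with
  | zero => simp [greenChain, Fin.snoc]
  | succ n ih =>
    obtain ⟨a, v, rfl⟩ : ∃ a v', v = (Fin.cons a v' : Fin (n + 1) → E d) :=
      ⟨v 0, Fin.tail v, (Fin.cons_self_tail v).symm⟩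
    rw [Fin.prod_univ_succ, Fin.prod_univ_succ (n := n + 1), greenChain, Fin.cons_zero,
      Fin.tail_cons, ih]
    have h0 : (Fin.snoc (Fin.cons a v : Fin (n + 1) → E d) x : Fin (n + 2) → E d) 0 = a := by
      rw [← Fin.cons_snoc_eq_snoc_cons, Fin.cons_zero]
    have h1 : ∀ i : Fin (n + 1), (Fin.snoc (Fin.cons a v : Fin (n + 1) → E d) x :
        Fin (n + 2) → E d) i.succ = (Fin.snoc v x : Fin (n + 1) → E d) i := fun i => by
      rw [← Fin.cons_snoc_eq_snoc_cons, Fin.cons_succ]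
    simp only [h0, h1, Fin.cons_zero, Fin.cons_succ]
    ring

/-- Addition in `Fin (n + 2)` wraps around, so the last side returns to the first vertex. -/
theorem closedChain_eq_cycleTerm (q : E d → ℂ) (w : ℝ) (n : ℕ) (p : Fin (n + 2) → E d) :
    closedChain q w n p = (∏ i, q (p i)) * cycleTerm d w 0 (cycleSide p) := by
  have h0 : ∏ i, q (p i) = q (p 0) * (q (p 1) * ∏ i : Fin n, q (p i.succ.succ)) := by
    rw [Fin.prod_univ_succ, Fin.prod_univ_succ, Fin.succ_zero_eq_one]
  rw [closedChain, greenChain_eq_prod, h0, cycleTerm, Fin.prod_univ_succ (n := n + 1)]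
  have h1 : ∀ j : Fin (n + 1), (Fin.snoc (Fin.tail (Fin.tail p)) (p 0) : Fin (n + 1) → E d) j
      = p (j.succ + 1) := fun j => by
    refine Fin.lastCases ?_ (fun j => ?_) j
    · rw [Fin.snoc_last, Fin.succ_last, Fin.last_add_one]
    · rw [Fin.snoc_castSucc, Fin.succ_castSucc, Fin.coeSucc_eq_succ]
      rfl
  have h2 : ∀ j : Fin (n + 1), (Fin.cons (p 1) (Fin.tail (Fin.tail p)) : Fin (n + 1) → E d) j
      = p j.succ := fun j => by
    refine Fin.cases rfl (fun j => ?_) j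
    rw [Fin.cons_succ]
    rfl
  simp only [h1, h2, Fin.succ_ne_zero, if_true, if_false, cycleSide, zero_add]
  have h3 : ∀ i : Fin n, Fin.tail (Fin.tail p) i = p i.succ.succ := fun i => rfl
  simp only [h3]
  ring

/-- Rotation of a cyclic family. -/
def rotate (d : ℕ) {n : ℕ} (i : Fin (n + 2)) : (Fin (n + 2) → E d) ≃ᵐ (Fin (n + 2) → E d) :=
  (MeasurableEquiv.piCongrLeft (fun _ => E d) (Equiv.addRight i)).symm

theorem rotate_apply {n : ℕ} (i : Fin (n + 2)) (p : Fin (n + 2) → E d) (j : Fin (n + 2)) :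
    rotate d i p j = p (j + i) := rfl

theorem measurePreserving_rotate {n : ℕ} (i : Fin (n + 2)) :
    MeasurePreserving (rotate d i) volume volume :=
  (volume_measurePreserving_piCongrLeft (fun _ => E d) (Equiv.addRight i)).symm

theorem closedChain_rotate (q : E d → ℂ) (w : ℝ) {n : ℕ} (i : Fin (n + 2)) (p : Fin (n + 2) → E d) :
    closedChain q w n (rotate d i p) = (∏ j, q (p j)) * cycleTerm d w i (cycleSide p) := by
  rw [closedChain_eq_cycleTerm]
  congr 1
  · exact Fintype.prod_equiv (Equiv.addRight i) _ _ fun j => rfl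
  · refine Fintype.prod_equiv (Equiv.addRight i) _ _ fun j => ?_
    have h : cycleSide (rotate d i p) j = cycleSide p (j + i) := by
      rw [cycleSide, cycleSide, rotate_apply, rotate_apply, add_right_comm]
    simp only [Equiv.coe_addRight, h, add_eq_right]

theorem integrable_prod_mul_cycleTerm {q : E d → ℂ} {w : ℝ} {n : ℕ}
    (h : Integrable (closedChain q w n)) (i : Fin (n + 2)) :
    Integrable fun p : Fin (n + 2) → E d => (∏ j, q (p j)) * cycleTerm d w i (cycleSide p) := by
  have h1 := ((measurePreserving_rotate (d := d) i).integrable_comp_emb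
    (rotate d i).measurableEmbedding).2 h
  simpa only [Function.comp_def, closedChain_rotate] using h1

/-- Relabelling the vertices cyclically preserves the measure and the product of the potentials, but
moves the differentiated factor. Averaging over all rotations completes the product rule. -/
theorem integral_closedChain_eq_sum {q : E d → ℂ} {w : ℝ} {n : ℕ}
    (h : Integrable (closedChain q w n)) :
    ((n + 2 : ℕ) : ℂ) * ∫ p, closedChain q w n p = ∫ p : Fin (n + 2) → E d,
      (∏ j, q (p j)) * ∑ i, cycleTerm d w i (cycleSide p) := by
  simp only [Finset.mul_sum]
  rw [integral_finsetSum _ fun i _ => integrable_prod_mul_cycleTerm h i]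
  have h1 : ∀ i : Fin (n + 2), ∫ p : Fin (n + 2) → E d,
      (∏ j, q (p j)) * cycleTerm d w i (cycleSide p) = ∫ p, closedChain q w n p := fun i => by
    rw [← (measurePreserving_rotate (d := d) i).integral_comp' (g := closedChain q w n)]
    simp only [closedChain_rotate]
  simp [h1]

/-! ### Polygons with a base point -/

theorem vertex_eq_cons {n : ℕ} (u : Fin (n + 1) → E d) (j : Fin (n + 2)) :
    vertex (k := n + 2) u j = (Fin.cons 0 u : Fin (n + 2) → E d) j := by
  refine Fin.cases ?_ (fun j => ?_) j
  · simp [vertex]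
  · rw [Fin.cons_succ, vertex, dif_pos]
    · simp
    · constructor
      · simp
      · exact j.succ.2

theorem vertex_add_one_eq_cons {n : ℕ} (u : Fin (n + 1) → E d) (j : Fin (n + 2)) :
    vertex (k := n + 2) u (j + 1) = (Fin.cons 0 u : Fin (n + 2) → E d) (j + 1) := by
  refine Fin.lastCases ?_ (fun j => ?_) j
  · rw [Fin.last_add_one, Fin.cons_zero, vertex, dif_neg]
    simp
  · rw [Fin.coeSucc_eq_succ, ← vertex_eq_cons]
    simp

theorem cycleSide_cons {n : ℕ} (x : E d) (u : Fin (n + 1) → E d) (j : Fin (n + 2)) :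
    cycleSide (Fin.cons x fun i => x + u i) j = side (k := n + 2) u j := by
  have h : ∀ j : Fin (n + 2), (Fin.cons x (fun i => x + u i) : Fin (n + 2) → E d) j
      = x + (Fin.cons 0 u : Fin (n + 2) → E d) j := fun j => by
    refine Fin.cases ?_ (fun j => ?_) j <;> simp
  rw [cycleSide, side, vertex_eq_cons, vertex_add_one_eq_cons, h, h, add_sub_add_left_eq_sub]

/-- The sum of the products of Green functions around a closed polygon, with one of them
differentiated. -/
def polygonGreen {n : ℕ} (w : ℝ) (u : Fin (n + 1) → E d) : ℂ :=
  ∑ i, cycleTerm d w i fun j : Fin (n + 2) => side (k := n + 2) u j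

/-- The correlation function `∫ q(x) ∏ q(x + uⱼ) dx`. -/
def correlation {m : ℕ} (q : E d → ℂ) (u : Fin m → E d) : ℂ := ∫ x, q x * ∏ j, q (x + u j)

/-- The Green functions see only relative positions. The shear to a base point and displacements
preserves volume, and integrating out the base point gives the correlation function. -/
theorem natCast_mul_integral_closedChain {q : E d → ℂ} {w : ℝ} {n : ℕ}
    (h : Integrable (closedChain q w n)) :
    ((n + 2 : ℕ) : ℂ) * ∫ p, closedChain q w n p
      = ∫ u : Fin (n + 1) → E d, correlation q u * polygonGreen w u := by
  have hI : Integrable fun p : Fin (n + 2) → E d =>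
      (∏ j, q (p j)) * ∑ i, cycleTerm d w i (cycleSide p) := by
    simp only [Finset.mul_sum]
    exact integrable_finsetSum _ fun i _ => integrable_prod_mul_cycleTerm h i
  have hI2 := integrable_finCons.2 hI
  let e : E d × (Fin (n + 1) → E d) ≃ᵐ E d × (Fin (n + 1) → E d) :=
    { toFun := fun p => (p.1, fun i => p.1 + p.2 i)
      invFun := fun p => (p.1, fun i => -p.1 + p.2 i)
      left_inv := fun p => by simp
      right_inv := fun p => by simp
      measurable_toFun := (by fun_prop :
        Measurable fun p : E d × (Fin (n + 1) → E d) => (p.1, fun i => p.1 + p.2 i))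
      measurable_invFun := (by fun_prop :
        Measurable fun p : E d × (Fin (n + 1) → E d) => (p.1, fun i => -p.1 + p.2 i)) }
  have he : MeasurePreserving e (volume.prod volume) (volume.prod volume) := by
    refine MeasurePreserving.skew_product (g := fun (x : E d) (u : Fin (n + 1) → E d) i => x + u i)
      (MeasurePreserving.id _) (by fun_prop) (Eventually.of_forall fun x => ?_)
    exact (measurePreserving_add_left (volume : Measure (Fin (n + 1) → E d)) (fun _ => x)).map_eq
  have hI3 := (he.integrable_comp_emb e.measurableEmbedding).2 hI2
  have hval : ∀ p : E d × (Fin (n + 1) → E d), (∏ j, q ((Fin.cons (e p).1 (e p).2 :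
      Fin (n + 2) → E d) j)) * ∑ i, cycleTerm d w i (cycleSide (Fin.cons (e p).1 (e p).2))
      = (q p.1 * ∏ j, q (p.1 + p.2 j)) * polygonGreen w p.2 := by
    intro p
    have h1 : cycleSide (Fin.cons (e p).1 (e p).2)
        = fun j : Fin (n + 2) => side (k := n + 2) p.2 j := funext fun j => cycleSide_cons p.1 p.2 j
    rw [h1, Fin.prod_univ_succ]
    rfl
  simp only [Function.comp_def, hval] at hI3
  rw [integral_closedChain_eq_sum h, ← measurePreserving_finCons.integral_comp']
  simp only [finCons_apply]
  rw [← he.integral_comp']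
  simp only [hval]
  rw [integral_prod_symm _ hI3]
  simp only [integral_mul_const, correlation]

end WaveTrace

end

/-! ### Scaling, polar coordinates over the simplex, and volumes. -/

noncomputable section

namespace WaveTrace

open Filter Topology
open scoped Pointwise

variable {d : ℕ}

/-! ### Products over finite families of measures -/

theorem lintegral_pi_prod {m : ℕ} (μ : Measure ℝ) [SigmaFinite μ] {f : Fin m → ℝ → ℝ≥0∞}
    (hf : ∀ i, Measurable (f i)) :
    ∫⁻ v, ∏ i, f i (v i) ∂(Measure.pi fun _ : Fin m => μ) = ∏ i, ∫⁻ x, f i x ∂μ := by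
  induction m with
  | zero => simp
  | succ m ih =>
    have h := (measurePreserving_piFinSuccAbove (fun _ : Fin (m + 1) => μ) 0).symm
    have hm : Measurable fun v : Fin (m + 1) → ℝ => ∏ i, f i (v i) :=
      Finset.measurable_prod _ fun i _ => (hf i).comp (measurable_pi_apply i)
    rw [← h.lintegral_comp hm, Fin.prod_univ_succ, ← ih fun i => hf i.succ,
      ← lintegral_prod_mul (hf 0).aemeasurable]
    · refine lintegral_congr fun p => ?_
      rw [Fin.prod_univ_succ]
      rfl
    · exact (Finset.measurable_prod _ fun i _ =>
        (hf i.succ).comp (measurable_pi_apply i)).aemeasurable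

/-! ### Scaling and polar coordinates -/

theorem lintegral_eq_mul_lintegral_smul {X : Type} [NormedAddCommGroup X] [NormedSpace ℝ X]
    [MeasurableSpace X] [BorelSpace X] [FiniteDimensional ℝ X] (μ : Measure X) [μ.IsAddHaarMeasure]
    {g : X → ℝ≥0∞} (hg : Measurable g) {t : ℝ} (ht : 0 < t) :
    ∫⁻ x, g x ∂μ = ENNReal.ofReal (t ^ Module.finrank ℝ X) * ∫⁻ x, g (t • x) ∂μ := by
  have h : ∫⁻ x, g (t • x) ∂μ = ∫⁻ x, g x ∂(Measure.map (fun x => t • x) μ) :=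
    (lintegral_map hg (measurable_const_smul t)).symm
  have hp : 0 < t ^ Module.finrank ℝ X := by positivity
  rw [h, Measure.map_addHaar_smul μ ht.ne', lintegral_smul_measure, smul_eq_mul, ← mul_assoc,
    ← ENNReal.ofReal_mul hp.le, abs_of_pos (by positivity), mul_inv_cancel₀ hp.ne',
    ENNReal.ofReal_one, one_mul]

theorem lintegral_Ioi_eq_mul_lintegral {g : ℝ → ℝ≥0∞} (hg : Measurable g) {c : ℝ} (hc : 0 < c) :
    ∫⁻ t in Set.Ioi (0 : ℝ), g t = ENNReal.ofReal c * ∫⁻ s in Set.Ioi (0 : ℝ), g (c * s) := by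
  rw [← lintegral_indicator measurableSet_Ioi, ← lintegral_indicator measurableSet_Ioi,
    lintegral_eq_mul_lintegral_smul volume (hg.indicator measurableSet_Ioi) hc]
  simp only [Module.finrank_self, pow_one]
  congr 1
  refine lintegral_congr fun s => ?_
  simp only [Set.indicator_apply, Set.mem_Ioi, smul_eq_mul, mul_pos_iff_of_pos_left hc]

theorem finrank_polygon (d n : ℕ) : Module.finrank ℝ (Fin n → E d) = n * d := by
  rw [Module.finrank_pi_fintype]
  simp

theorem lintegral_pow_mul_exp_neg (n : ℕ) :
    ∫⁻ t in Set.Ioi (0 : ℝ), ENNReal.ofReal (t ^ n * Real.exp (-t))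
      = ENNReal.ofReal n.factorial := by
  have h1 := Real.GammaIntegral_convergent (s := n + 1) (by positivity)
  have h2 := Real.Gamma_eq_integral (s := n + 1) (by positivity)
  have e : ∀ t ∈ Set.Ioi (0 : ℝ), Real.exp (-t) * t ^ ((n : ℝ) + 1 - 1) = t ^ n * Real.exp (-t) :=
    fun t _ => by
      rw [add_sub_cancel_right, Real.rpow_natCast, mul_comm]
  rw [setIntegral_congr_fun measurableSet_Ioi e, Real.Gamma_nat_eq_factorial] at h2
  have h3 := h1.congr_fun e measurableSet_Ioi
  rw [h2, ofReal_integral_eq_lintegral_ofReal h3]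
  exact (ae_restrict_iff' measurableSet_Ioi).2 (Eventually.of_forall fun t ht => by
    have : (0 : ℝ) < t := ht
    positivity)

theorem bary_eq_snoc {n : ℕ} (s : Fin (n + 1) → ℝ) (j : Fin (n + 2)) :
    bary (k := n + 2) s j = (Fin.snoc s (1 - ∑ i, s i) : Fin (n + 2) → ℝ) j := by
  refine Fin.lastCases ?_ (fun j => ?_) j
  · rw [Fin.snoc_last, bary, dif_neg (by simp)]
    rfl
  · rw [Fin.snoc_castSucc, bary, dif_pos (by simpa using j.2)]
    rfl

theorem mem_simplex {n : ℕ} (s : Fin (n + 1) → ℝ) :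
    s ∈ simplex (n + 2) ↔ ∀ j : Fin (n + 2), 0 ≤ bary (k := n + 2) s j :=
  ⟨fun h j => h j j.2, fun h i hi => h ⟨i, hi⟩⟩

theorem sum_bary {n : ℕ} (s : Fin (n + 1) → ℝ) : ∑ j : Fin (n + 2), bary (k := n + 2) s j = 1 := by
  simp only [bary_eq_snoc]
  rw [Fin.sum_univ_castSucc]
  simp

theorem measurable_bary {n : ℕ} (i : ℕ) :
    Measurable fun s : Fin (n + 1) → ℝ => bary (k := n + 2) s i := by
  unfold bary
  split_ifs
  · exact measurable_pi_apply _
  · fun_prop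

theorem measurableSet_simplex (n : ℕ) : MeasurableSet (simplex (n + 2)) := by
  have h : simplex (n + 2) = ⋂ j : Fin (n + 2), {s | 0 ≤ bary (k := n + 2) s j} := by
    ext s
    simpa using mem_simplex s
  rw [h]
  exact MeasurableSet.iInter fun j => measurableSet_le measurable_const (measurable_bary j)

/-- `Fin.snoc` as an equivalence of measurable spaces. -/
def finSnoc (n : ℕ) : ℝ × (Fin n → ℝ) ≃ᵐ (Fin (n + 1) → ℝ) :=
  (MeasurableEquiv.piFinSuccAbove (fun _ : Fin (n + 1) => ℝ) (Fin.last n)).symm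

theorem finSnoc_apply (n : ℕ) (p : ℝ × (Fin n → ℝ)) : finSnoc n p = Fin.snoc p.2 p.1 := by
  rw [← Fin.insertNth_last']
  rfl

theorem lintegral_finSnoc {n : ℕ} {f : (Fin (n + 1) → ℝ) → ℝ≥0∞} (hf : Measurable f) :
    ∫⁻ v, f v = ∫⁻ s, ∫⁻ a, f (Fin.snoc s a) := by
  have h := (volume_preserving_piFinSuccAbove (fun _ : Fin (n + 1) => ℝ) (Fin.last n)).symm
  rw [← h.lintegral_comp hf]
  change ∫⁻ p, f (finSnoc n p) ∂(volume.prod volume) = _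
  rw [lintegral_prod_symm (fun p => f (finSnoc n p))
    (hf.comp (finSnoc n).measurable).aemeasurable]
  simp only [finSnoc_apply]

/-- The last coordinate is traded for the total `t`, and the others are rescaled by `t`, which gives
the Jacobian `t^{n+1}`. -/
theorem lintegral_orthant {n : ℕ} {G : (Fin (n + 2) → ℝ) → ℝ≥0∞} (hG : Measurable G) :
    ∫⁻ v in Set.univ.pi fun _ => Set.Ici (0 : ℝ), G v
      = ∫⁻ t in Set.Ioi (0 : ℝ), ENNReal.ofReal (t ^ (n + 1)) *
        ∫⁻ s in simplex (n + 2), G fun j => t * bary (k := n + 2) s j := by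
  have hO : MeasurableSet (Set.univ.pi fun _ : Fin (n + 2) => Set.Ici (0 : ℝ)) :=
    MeasurableSet.univ_pi fun _ => measurableSet_Ici
  set O : Set (Fin (n + 2) → ℝ) := Set.univ.pi fun _ => Set.Ici (0 : ℝ) with hO_def
  have hOG : Measurable (O.indicator G) := hG.indicator hO
  have hsn : Measurable fun p : (Fin (n + 1) → ℝ) × ℝ =>
      (Fin.snoc p.1 (p.2 - ∑ i, p.1 i) : Fin (n + 2) → ℝ) := by
    have h := (finSnoc (n + 1)).measurable.comp (f := fun p : (Fin (n + 1) → ℝ) × ℝ =>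
      (p.2 - ∑ i, p.1 i, p.1)) (by fun_prop)
    simpa only [Function.comp_def, finSnoc_apply] using h
  have hm := hOG.comp hsn
  have h1 : ∫⁻ v in O, G v = ∫⁻ t : ℝ, ∫⁻ s : Fin (n + 1) → ℝ,
      O.indicator G (Fin.snoc s (t - ∑ i, s i)) := by
    rw [← lintegral_indicator hO, lintegral_finSnoc hOG, lintegral_lintegral_swap
      (f := fun (t : ℝ) (s : Fin (n + 1) → ℝ) => O.indicator G (Fin.snoc s (t - ∑ i, s i)))]
    · refine lintegral_congr fun s => ?_
      exact (lintegral_sub_right_eq_self (fun a => O.indicator G (Fin.snoc s a)) _).symm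
    · exact (hm.comp measurable_swap).aemeasurable
  have hsum : ∀ (t : ℝ) (s : Fin (n + 1) → ℝ),
      ∑ j, (Fin.snoc s (t - ∑ i, s i) : Fin (n + 2) → ℝ) j = t := fun t s => by
    rw [Fin.sum_univ_castSucc]
    simp
  have h2 : ∀ t : ℝ, t < 0 → ∫⁻ s : Fin (n + 1) → ℝ,
      O.indicator G (Fin.snoc s (t - ∑ i, s i)) = 0 := fun t ht => by
    rw [← lintegral_zero (μ := (volume : Measure (Fin (n + 1) → ℝ)))]
    refine lintegral_congr fun s => Set.indicator_of_notMem (fun hs => ?_) _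
    have := Finset.sum_nonneg fun j (_ : j ∈ Finset.univ) => Set.mem_Ici.1 (hs j trivial)
    rw [hsum] at this
    linarith
  rw [h1, ← lintegral_indicator measurableSet_Ioi]
  refine lintegral_congr_ae ?_
  have h0 : ∀ᵐ t : ℝ, t ≠ 0 := by simp [ae_iff]
  filter_upwards [h0] with t ht0
  rcases lt_or_gt_of_ne ht0 with ht | ht
  · rw [h2 t ht, Set.indicator_of_notMem (by simpa using ht.le)]
  · rw [Set.indicator_of_mem (Set.mem_Ioi.2 ht)]
    have hmt : Measurable fun s : Fin (n + 1) → ℝ => O.indicator G (Fin.snoc s (t - ∑ i, s i)) :=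
      hm.comp (measurable_id.prodMk measurable_const)
    rw [lintegral_eq_mul_lintegral_smul volume hmt ht, Module.finrank_fin_fun,
      ← lintegral_indicator (measurableSet_simplex n)]
    congr 1
    refine lintegral_congr fun s => ?_
    have e : (Fin.snoc (t • s) (t - ∑ i, (t • s) i) : Fin (n + 2) → ℝ)
        = fun j : Fin (n + 2) => t * bary (k := n + 2) s j := by
      ext j
      rw [bary_eq_snoc]
      refine Fin.lastCases ?_ (fun j => ?_) j
      · simp [mul_sub, Finset.mul_sum]
      · simp
    have hiff : (fun j : Fin (n + 2) => t * bary (k := n + 2) s j) ∈ O ↔ s ∈ simplex (n + 2) := by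
      rw [mem_simplex, hO_def, Set.mem_univ_pi]
      exact forall_congr' fun j => mul_nonneg_iff_of_pos_left ht
    rw [e]
    by_cases hs : s ∈ simplex (n + 2)
    · rw [Set.indicator_of_mem (hiff.2 hs)]
      exact (Set.indicator_of_mem hs
        fun s => G fun j : Fin (n + 2) => t * bary (k := n + 2) s j).symm
    · rw [Set.indicator_of_notMem (mt hiff.1 hs)]
      exact (Set.indicator_of_notMem hs
        fun s => G fun j : Fin (n + 2) => t * bary (k := n + 2) s j).symm

/-- Test `lintegral_orthant` on `e^{-∑ v j}`: the orthant side is `1`, the simplex side is `(n +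
1)!` times the volume. -/
theorem volume_simplex (n : ℕ) :
    volume (simplex (n + 2)) = ENNReal.ofReal ((n + 1).factorial : ℝ)⁻¹ := by
  have hm : ∀ _ : Fin (n + 2), Measurable fun x : ℝ => ENNReal.ofReal (Real.exp (-x)) := fun _ => by
    fun_prop
  have h := lintegral_orthant (n := n) (G := fun v => ∏ j, ENNReal.ofReal (Real.exp (-v j)))
    (Finset.measurable_prod _ fun j _ => (hm j).comp (measurable_pi_apply j))
  have h1 : ∫⁻ x in Set.Ici (0 : ℝ), ENNReal.ofReal (Real.exp (-x)) = 1 := by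
    have h2 := lintegral_pow_mul_exp_neg 0
    rw [setLIntegral_congr Ioi_ae_eq_Ici] at h2
    simpa using h2
  have h3 : ∀ t : ℝ, ∫⁻ s in simplex (n + 2), ∏ j : Fin (n + 2),
      ENNReal.ofReal (Real.exp (-(t * bary (k := n + 2) s j)))
      = ENNReal.ofReal (Real.exp (-t)) * volume (simplex (n + 2)) := fun t => by
    rw [← setLIntegral_const]
    refine lintegral_congr fun s => ?_
    rw [← ENNReal.ofReal_prod_of_nonneg fun _ _ => (Real.exp_pos _).le, ← Real.exp_sum,
      Finset.sum_neg_distrib, ← Finset.mul_sum, sum_bary, mul_one]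
  rw [volume_pi, Measure.restrict_pi_pi, lintegral_pi_prod _ hm] at h
  simp only [h1, h3, Finset.prod_const_one, ← mul_assoc] at h
  have h4 : ∀ t ∈ Set.Ioi (0 : ℝ), ENNReal.ofReal (t ^ (n + 1)) * ENNReal.ofReal (Real.exp (-t))
      = ENNReal.ofReal (t ^ (n + 1) * Real.exp (-t)) := fun t ht =>
    (ENNReal.ofReal_mul (pow_nonneg (le_of_lt ht) _)).symm
  rw [lintegral_mul_const _ (by fun_prop), setLIntegral_congr_fun measurableSet_Ioi h4,
    lintegral_pow_mul_exp_neg] at h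
  rw [ENNReal.ofReal_inv_of_pos (by positivity)]
  exact ENNReal.eq_inv_of_mul_eq_one_left (by rw [mul_comm, ← h])

/-- Lower bounds on the barycentric coordinates cut out a translate of the simplex shrunk by `1 - ∑
r j`. -/
theorem volume_bary_ge {n : ℕ} (r : Fin (n + 2) → ℝ) :
    volume {s : Fin (n + 1) → ℝ | ∀ j : Fin (n + 2), r j ≤ bary (k := n + 2) s j}
      = ENNReal.ofReal ((max (1 - ∑ j, r j) 0) ^ (n + 1) * ((n + 1).factorial : ℝ)⁻¹) := by
  rcases lt_trichotomy (∑ j, r j) 1 with h | h | h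
  · have hc : 0 < 1 - ∑ j, r j := sub_pos.2 h
    obtain ⟨S, hS⟩ : ∃ S : Set (Fin (n + 1) → ℝ), S = simplex (n + 2) := ⟨_, rfl⟩
    have hset : {s : Fin (n + 1) → ℝ | ∀ j : Fin (n + 2), r j ≤ bary (k := n + 2) s j}
        = (fun s => (fun i : Fin (n + 1) => r i.castSucc) + s) ''
          ((1 - ∑ j, r j) • S) := by
      have hb : ∀ (s : Fin (n + 1) → ℝ) (j : Fin (n + 2)), bary (k := n + 2)
          ((fun i : Fin (n + 1) => r i.castSucc) + (1 - ∑ j, r j) • s) j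
          = r j + (1 - ∑ j, r j) * bary (k := n + 2) s j := fun s j => by
        rw [bary_eq_snoc, bary_eq_snoc]
        refine Fin.lastCases ?_ (fun j => ?_) j
        · have hsum := Fin.sum_univ_castSucc r
          rw [Fin.snoc_last, Fin.snoc_last]
          simp only [Pi.add_apply, Pi.smul_apply, smul_eq_mul, Finset.sum_add_distrib,
            ← Finset.mul_sum]
          linear_combination hsum
        · simp
      ext s
      constructor
      · intro hs
        refine ⟨(1 - ∑ j, r j) • ((1 - ∑ j, r j)⁻¹ • (s - fun i => r i.castSucc)),
          Set.smul_mem_smul_set ?_, ?_⟩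
        · rw [hS, mem_simplex]
          intro j
          have h1 := hb ((1 - ∑ j, r j)⁻¹ • (s - fun i => r i.castSucc)) j
          rw [smul_inv_smul₀ hc.ne', add_sub_cancel] at h1
          have h2 := hs j
          rw [h1] at h2
          exact nonneg_of_mul_nonneg_right (by linarith) hc
        · simp only
          rw [smul_inv_smul₀ hc.ne', add_sub_cancel]
      · rintro ⟨_, ⟨s, hs, rfl⟩, rfl⟩ j
        rw [hS, mem_simplex] at hs
        simp only [hb]
        exact le_add_of_nonneg_right (mul_nonneg hc.le (hs j))
    rw [hset, Set.image_add_left, measure_preimage_add, Measure.addHaar_smul,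
      Module.finrank_fin_fun, hS, volume_simplex, max_eq_left hc.le, abs_of_pos (by positivity),
      ENNReal.ofReal_mul (by positivity)]
  -- When the bounds add up to one every inequality is an equality, leaving at most one point.
  · have hsub : {s : Fin (n + 1) → ℝ | ∀ j : Fin (n + 2), r j ≤ bary (k := n + 2) s j}
        ⊆ {fun i : Fin (n + 1) => r i.castSucc} := by
      intro s hs
      have h0 : ∀ j : Fin (n + 2), bary (k := n + 2) s j = r j := by
        have h1 : ∑ j : Fin (n + 2), (bary (k := n + 2) s j - r j) = 0 := by
          rw [Finset.sum_sub_distrib, sum_bary, h, sub_self]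
        have h2 := (Finset.sum_eq_zero_iff_of_nonneg fun j _ => sub_nonneg.2 (hs j)).1 h1
        exact fun j => sub_eq_zero.1 (h2 j (Finset.mem_univ j))
      ext i
      rw [← h0, bary_eq_snoc, Fin.snoc_castSucc]
    rw [measure_mono_null hsub (measure_singleton _), h]
    simp
  · have hempty : {s : Fin (n + 1) → ℝ | ∀ j : Fin (n + 2), r j ≤ bary (k := n + 2) s j} = ∅ := by
      rw [Set.eq_empty_iff_forall_notMem]
      intro s hs
      have := Finset.sum_le_sum fun j (_ : j ∈ Finset.univ) => hs j
      rw [sum_bary] at this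
      linarith
    rw [hempty, measure_empty, max_eq_right (by linarith)]
    simp

end WaveTrace

end

/-! ### The polar identity for `σ_k` in dimensions one and two. -/

noncomputable section

namespace WaveTrace

open Filter Topology

variable {d : ℕ}

/-! ### The measures `σ_k` in polar coordinates -/

/-- The measure `σ_{n+2}`. -/
def polygonMeasure (d n : ℕ) : Measure (Fin (n + 1) → E d) := sigma d (n + 2)

/-- The lengths of the sides of the polygon with vertices `0, u`. -/
def polygonSide {n : ℕ} (u : Fin (n + 1) → E d) (j : Fin (n + 2)) : ℝ := side (k := n + 2) u j

theorem polygonSide_nonneg {n : ℕ} (u : Fin (n + 1) → E d) (j : Fin (n + 2)) :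
    0 ≤ polygonSide u j := norm_nonneg _

theorem continuous_vertex {n : ℕ} (i : ℕ) :
    Continuous fun u : Fin (n + 1) → E d => vertex (k := n + 2) u i := by
  unfold vertex
  split_ifs
  · exact continuous_apply _
  · exact continuous_const

theorem continuous_polygonSide {n : ℕ} (j : Fin (n + 2)) :
    Continuous fun u : Fin (n + 1) → E d => polygonSide u j :=
  ((continuous_vertex _).sub (continuous_vertex _)).norm

theorem vertex_smul {n : ℕ} (t : ℝ) (u : Fin (n + 1) → E d) (i : ℕ) :
    vertex (k := n + 2) (t • u) i = t • vertex (k := n + 2) u i := by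
  unfold vertex
  split_ifs
  · rfl
  · simp

theorem polygonSide_smul {n : ℕ} {t : ℝ} (ht : 0 ≤ t) (u : Fin (n + 1) → E d) (j : Fin (n + 2)) :
    polygonSide (t • u) j = t * polygonSide u j := by
  rw [polygonSide, polygonSide, side, side, vertex_smul, vertex_smul, ← smul_sub, norm_smul,
    Real.norm_of_nonneg ht]

theorem perimeter_eq_sum {n : ℕ} (u : Fin (n + 1) → E d) :
    perimeter (k := n + 2) u = ∑ j, polygonSide u j :=
  Finset.sum_range _

instance (d : ℕ) : SigmaFinite (waveBase d) := by
  unfold waveBase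
  split_ifs <;> infer_instance

/-- The product of the wave kernels of the sides of a polygon. -/
def polygonWeight {n : ℕ} (u : Fin (n + 1) → E d) (v : Fin (n + 2) → ℝ) : ℝ :=
  ∏ j, waveWeight d (polygonSide u j) (v j)

/-- The total delay of a polygon. -/
def polygonDelay {n : ℕ} (u : Fin (n + 1) → E d) (v : Fin (n + 2) → ℝ) : ℝ :=
  ∑ j, waveDelay d (polygonSide u j) (v j)

theorem polygonWeight_nonneg {n : ℕ} (u : Fin (n + 1) → E d) (v : Fin (n + 2) → ℝ) :
    0 ≤ polygonWeight u v :=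
  Finset.prod_nonneg fun j _ => waveWeight_nonneg d (polygonSide_nonneg u j) (v j)

theorem measurable_polygonWeight (d n : ℕ) :
    Measurable fun p : (Fin (n + 1) → E d) × (Fin (n + 2) → ℝ) => polygonWeight p.1 p.2 := by
  refine Finset.measurable_prod _ fun j _ => (measurable_waveWeight d).comp
    (f := fun p : (Fin (n + 1) → E d) × (Fin (n + 2) → ℝ) => (polygonSide p.1 j, p.2 j)) ?_
  exact ((continuous_polygonSide j).measurable.comp measurable_fst).prodMk (by fun_prop)

theorem measurable_polygonDelay (d n : ℕ) :
    Measurable fun p : (Fin (n + 1) → E d) × (Fin (n + 2) → ℝ) => polygonDelay p.1 p.2 := by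
  refine Finset.measurable_sum _ fun j _ => (continuous_waveDelay d).measurable.comp
    (f := fun p : (Fin (n + 1) → E d) × (Fin (n + 2) → ℝ) => (polygonSide p.1 j, p.2 j)) ?_
  exact ((continuous_polygonSide j).measurable.comp measurable_fst).prodMk (by fun_prop)

theorem ofReal_prod_indicator {m : ℕ} (r b : Fin m → ℝ) :
    ENNReal.ofReal (∏ j, (Set.Ici (r j)).indicator (fun _ => (1 / 2 : ℝ)) (b j))
      = Set.indicator {b : Fin m → ℝ | ∀ j, r j ≤ b j} (fun _ => ENNReal.ofReal ((1 / 2) ^ m)) b := by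
  by_cases h : ∀ j, r j ≤ b j
  · rw [Set.indicator_of_mem (by simpa using h)]
    congr 1
    rw [Finset.prod_congr rfl fun j _ => Set.indicator_of_mem (Set.mem_Ici.2 (h j)) _]
    simp
  · rw [Set.indicator_of_notMem (by simpa using h)]
    push Not at h
    obtain ⟨j, hj⟩ := h
    rw [Finset.prod_eq_zero (Finset.mem_univ j), ENNReal.ofReal_zero]
    exact Set.indicator_of_notMem (by simpa using hj) _

/-- Both densities are simplex integrals of products of wave kernels. In dimension one the product
is constant on the set where each `s j` exceeds its side, and the volume of that set is
`volume_bary_ge`. -/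
theorem polygonMeasure_eq_withDensity (hd : 1 ≤ d) (hd' : d ≤ 2) (n : ℕ) :
    polygonMeasure d n = volume.withDensity fun u => ENNReal.ofReal (2 / ((n + 2 : ℕ) : ℝ)) *
      ∫⁻ s in simplex (n + 2), ENNReal.ofReal (polygonWeight u fun j => bary (k := n + 2) s j) := by
  interval_cases d
  · change volume.withDensity _ = _
    congr 1
    ext u
    have h1 : ∀ s : Fin (n + 1) → ℝ,
        ENNReal.ofReal (polygonWeight u fun j => bary (k := n + 2) s j)
        = Set.indicator {s : Fin (n + 1) → ℝ | ∀ j : Fin (n + 2),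
          polygonSide u j ≤ bary (k := n + 2) s j} (fun _ => ENNReal.ofReal ((1 / 2) ^ (n + 2))) s :=
      fun s => by
        simp only [polygonWeight, waveWeight, OfNat.one_ne_ofNat, if_false]
        rw [ofReal_prod_indicator]
        rfl
    have hA : MeasurableSet {s : Fin (n + 1) → ℝ | ∀ j : Fin (n + 2),
        polygonSide u j ≤ bary (k := n + 2) s j} := by
      rw [Set.ofPred_forall]
      exact MeasurableSet.iInter fun j => measurableSet_le measurable_const (measurable_bary j)
    have hsub : {s : Fin (n + 1) → ℝ | ∀ j : Fin (n + 2),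
        polygonSide u j ≤ bary (k := n + 2) s j} ⊆ simplex (n + 2) := fun s hs =>
      (mem_simplex s).2 fun j => (polygonSide_nonneg u j).trans (hs j)
    change ENNReal.ofReal ((2 ^ (n + 1) * ((n + 2).factorial : ℝ))⁻¹ *
      (max (1 - perimeter (k := n + 2) u) 0) ^ (n + 1)) = ENNReal.ofReal (2 / ((n + 2 : ℕ) : ℝ)) *
        ∫⁻ s : Fin (n + 1) → ℝ in simplex (n + 2),
          ENNReal.ofReal (polygonWeight u fun j => bary (k := n + 2) s j)
    rw [lintegral_congr h1, lintegral_indicator hA, Measure.restrict_restrict hA,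
      Set.inter_eq_self_of_subset_left hsub, setLIntegral_const, volume_bary_ge,
      ← ENNReal.ofReal_mul (by positivity), ← ENNReal.ofReal_mul (by positivity),
      ← perimeter_eq_sum]
    -- The constants match: `2/(n+2) · 2^{-(n+2)} / (n+1)! = 1 / (2^{n+1} (n+2)!)`.
    congr 1
    rw [Nat.factorial_succ (n + 1), pow_succ (1 / 2 : ℝ), one_div, inv_pow]
    push_cast
    field_simp
    ring
  · change volume.withDensity _ = _
    congr 1
    ext u
    change ENNReal.ofReal (2 / (((n + 2 : ℕ) : ℝ) * (2 * Real.pi) ^ (n + 2))) *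
      ∫⁻ s : Fin (n + 1) → ℝ in simplex (n + 2), ∏ i ∈ Finset.range (n + 2),
        ENNReal.ofReal (Real.sqrt (bary (k := n + 2) s i ^ 2 - side (k := n + 2) u i ^ 2))⁻¹
      = ENNReal.ofReal (2 / ((n + 2 : ℕ) : ℝ)) * ∫⁻ s : Fin (n + 1) → ℝ in simplex (n + 2),
          ENNReal.ofReal (polygonWeight u fun j => bary (k := n + 2) s j)
    have h1 : ∀ s : Fin (n + 1) → ℝ,
        ENNReal.ofReal (polygonWeight u fun j => bary (k := n + 2) s j)
        = ENNReal.ofReal (((2 * Real.pi) ^ (n + 2))⁻¹) * ∏ i ∈ Finset.range (n + 2),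
        ENNReal.ofReal (Real.sqrt (bary (k := n + 2) s i ^ 2 - side (k := n + 2) u i ^ 2))⁻¹ :=
      fun s => by
        simp only [polygonWeight, waveWeight, Nat.reduceEqDiff, if_false, if_true]
        rw [Finset.prod_mul_distrib, Finset.prod_const, Finset.card_univ, Fintype.card_fin,
          ENNReal.ofReal_mul (by positivity), ENNReal.ofReal_prod_of_nonneg
          fun _ _ => by positivity, Finset.prod_range, inv_pow]
        rfl
    rw [lintegral_congr h1, lintegral_const_mul' _ _ ENNReal.ofReal_ne_top, ← mul_assoc,
      ← ENNReal.ofReal_mul (by positivity)]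
    congr 2
    field_simp

theorem waveWeight_smul (hd : 1 ≤ d) (hd' : d ≤ 2) {t : ℝ} (ht : 0 < t) (r b : ℝ) :
    t ^ (d - 1) * waveWeight d (t * r) (t * b) = waveWeight d r b := by
  interval_cases d
  · simp only [waveWeight, OfNat.one_ne_ofNat, if_false, tsub_self, pow_zero, one_mul,
      Set.indicator_apply, Set.mem_Ici, mul_le_mul_iff_right₀ ht]
  · simp only [waveWeight, Nat.reduceEqDiff, if_false, if_true, Nat.add_one_sub_one, pow_one]
    rw [mul_pow, mul_pow, ← mul_sub, Real.sqrt_mul (by positivity), Real.sqrt_sq ht.le, mul_inv]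
    field_simp

theorem pi_waveBase (hd : d ≤ 2) (m : ℕ) : (Measure.pi fun _ : Fin m => waveBase d)
    = volume.restrict (Set.univ.pi fun _ => Set.Ici 0) := by
  rw [volume_pi, Measure.restrict_pi_pi]
  congr 1
  ext1 i
  rw [waveBase, if_neg (by omega), Measure.restrict_congr_set Ioi_ae_eq_Ici]

/-- The total delay is taken as the radial variable `t`, and both the delays and the polygon are
scaled by it. -/
theorem lintegral_polygonMeasure_of_le_two (hd : 1 ≤ d) (hd' : d ≤ 2) (n : ℕ)
    {F : ℝ × (Fin (n + 1) → E d) → ℝ≥0∞} (hF : Measurable F) :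
    ∫⁻ t in Set.Ioi (0 : ℝ), ENNReal.ofReal (t ^ (2 * (n + 2) - d)) *
        ∫⁻ u, F (t, t • u) ∂polygonMeasure d n
      = ENNReal.ofReal (2 / ((n + 2 : ℕ) : ℝ)) * ∫⁻ u, ∫⁻ v,
        ENNReal.ofReal (polygonDelay u v * polygonWeight u v) * F (polygonDelay u v, u)
          ∂(Measure.pi fun _ : Fin (n + 2) => waveBase d) := by
  have hdelay : ∀ (u : Fin (n + 1) → E d) (v : Fin (n + 2) → ℝ), polygonDelay u v = ∑ j, v j :=
    fun u v => by simp [polygonDelay, waveDelay, show d ≠ 3 by omega]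
  have hw : Measurable fun p : ((Fin (n + 1) → E d) × ℝ) × (Fin (n + 1) → ℝ) =>
      ENNReal.ofReal (p.1.2 * polygonWeight p.1.1 fun j => p.1.2 * bary (k := n + 2) p.2 j) := by
    refine (Measurable.mul (by fun_prop) ((measurable_polygonWeight d n).comp
      (f := fun p : ((Fin (n + 1) → E d) × ℝ) × (Fin (n + 1) → ℝ) =>
        (p.1.1, fun j : Fin (n + 2) => p.1.2 * bary (k := n + 2) p.2 j)) ?_)).ennreal_ofReal
    refine (by fun_prop : Measurable fun p : ((Fin (n + 1) → E d) × ℝ) × (Fin (n + 1) → ℝ) =>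
      p.1.1).prodMk (measurable_pi_lambda _ fun j => ?_)
    exact (by fun_prop : Measurable fun p : ((Fin (n + 1) → E d) × ℝ) × (Fin (n + 1) → ℝ) =>
      p.1.2).mul ((measurable_bary j).comp measurable_snd)
  have hW : Measurable fun p : (Fin (n + 1) → E d) × ℝ => ∫⁻ s in simplex (n + 2),
      ENNReal.ofReal (p.2 * polygonWeight p.1 fun j => p.2 * bary (k := n + 2) s j) :=
    hw.lintegral_prod_right'
  have hWF : Measurable fun p : (Fin (n + 1) → E d) × ℝ => ENNReal.ofReal (p.2 ^ (n + 1)) *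
      ((∫⁻ s in simplex (n + 2), ENNReal.ofReal (p.2 * polygonWeight p.1 fun j =>
        p.2 * bary (k := n + 2) s j)) * F (p.2, p.1)) :=
    Measurable.mul (by fun_prop) (hW.mul (hF.comp measurable_swap))
  have h1 : ∀ u : Fin (n + 1) → E d, ∫⁻ v,
      ENNReal.ofReal (polygonDelay u v * polygonWeight u v) * F (polygonDelay u v, u)
        ∂(Measure.pi fun _ : Fin (n + 2) => waveBase d)
      = ∫⁻ t in Set.Ioi (0 : ℝ), ENNReal.ofReal (t ^ (n + 1)) *
        ((∫⁻ s in simplex (n + 2), ENNReal.ofReal (t * polygonWeight u fun j =>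
          t * bary (k := n + 2) s j)) * F (t, u)) := by
    intro u
    have hm : Measurable fun v : Fin (n + 2) → ℝ =>
        ENNReal.ofReal ((∑ j, v j) * polygonWeight u v) * F (∑ j, v j, u) := by
      have hs : Measurable fun v : Fin (n + 2) → ℝ => ∑ j, v j := by fun_prop
      exact (hs.mul ((measurable_polygonWeight d n).comp
        (measurable_const.prodMk measurable_id))).ennreal_ofReal.mul
        (hF.comp (hs.prodMk measurable_const))
    simp only [hdelay]
    rw [pi_waveBase hd', lintegral_orthant hm]
    refine lintegral_congr fun t => ?_
    congr 1
    rw [← lintegral_mul_const]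
    · refine lintegral_congr fun s => ?_
      rw [← Finset.mul_sum, sum_bary, mul_one]
    · exact hw.comp ((measurable_const (a := (u, t))).prodMk measurable_id)
  rw [lintegral_congr h1, lintegral_lintegral_swap hWF.aemeasurable,
    ← lintegral_const_mul' _ _ ENNReal.ofReal_ne_top]
  refine setLIntegral_congr_fun measurableSet_Ioi fun t (ht : 0 < t) => ?_
  have hmt : Measurable fun u : Fin (n + 1) → E d => ENNReal.ofReal (t ^ (n + 1)) *
      ((∫⁻ s in simplex (n + 2), ENNReal.ofReal (t * polygonWeight u fun j =>
        t * bary (k := n + 2) s j)) * F (t, u)) :=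
    hWF.comp (measurable_id.prodMk measurable_const)
  have hD : Measurable fun u : Fin (n + 1) → E d => ENNReal.ofReal (2 / ((n + 2 : ℕ) : ℝ)) *
      ∫⁻ s in simplex (n + 2), ENNReal.ofReal (polygonWeight u fun j => bary (k := n + 2) s j) := by
    have h2 := hW.comp (measurable_id.prodMk (measurable_const (a := (1 : ℝ))))
    simp only [Function.comp_def, one_mul, id] at h2
    exact h2.const_mul _
  have hFt : Measurable fun u : Fin (n + 1) → E d => F (t, t • u) :=
    hF.comp (measurable_const.prodMk (measurable_const_smul t))
  rw [lintegral_eq_mul_lintegral_smul volume hmt ht, finrank_polygon,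
    polygonMeasure_eq_withDensity hd hd', lintegral_withDensity_eq_lintegral_mul _ hD hFt,
    ← lintegral_const_mul' _ _ ENNReal.ofReal_ne_top,
    ← lintegral_const_mul' _ _ ENNReal.ofReal_ne_top,
    ← lintegral_const_mul' _ _ ENNReal.ofReal_ne_top]
  refine lintegral_congr fun u => ?_
  -- The count of powers: `(n+1) d` from scaling the polygon, `n + 1` from polar coordinates, `1`
  -- from the delay and `(1 - d)(n + 2)` from the kernels add up to `2(n+2) - d`.
  have h3 : ∀ s : Fin (n + 1) → ℝ, ENNReal.ofReal (t ^ ((n + 1) * d)) *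
      (ENNReal.ofReal (t ^ (n + 1)) * ENNReal.ofReal (t * polygonWeight (t • u) fun j =>
        t * bary (k := n + 2) s j)) = ENNReal.ofReal (t ^ (2 * (n + 2) - d)) *
        ENNReal.ofReal (polygonWeight u fun j => bary (k := n + 2) s j) := fun s => by
    rw [← ENNReal.ofReal_mul (by positivity), ← ENNReal.ofReal_mul (by positivity),
      ← ENNReal.ofReal_mul (by positivity)]
    congr 1
    have h4 : polygonWeight u (fun j => bary (k := n + 2) s j) = (t ^ (d - 1)) ^ (n + 2) *
        polygonWeight (t • u) fun j => t * bary (k := n + 2) s j := by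
      simp only [polygonWeight, polygonSide_smul ht.le]
      have hc : (t ^ (d - 1)) ^ (n + 2) = ∏ _j : Fin (n + 2), t ^ (d - 1) := by simp
      rw [hc, ← Finset.prod_mul_distrib]
      exact Finset.prod_congr rfl fun j _ => (waveWeight_smul hd hd' ht _ _).symm
    rw [h4, ← mul_assoc, ← mul_assoc, ← mul_assoc, ← pow_add, ← pow_succ, ← pow_mul, ← pow_add]
    congr 2
    interval_cases d <;> omega
  have hms : Measurable fun s : Fin (n + 1) → ℝ => ENNReal.ofReal (t * polygonWeight (t • u)
      fun j => t * bary (k := n + 2) s j) :=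
    hw.comp ((measurable_const (a := (t • u, t))).prodMk measurable_id)
  have h5 : ENNReal.ofReal (t ^ ((n + 1) * d)) * (ENNReal.ofReal (t ^ (n + 1)) *
      ∫⁻ s in simplex (n + 2), ENNReal.ofReal (t * polygonWeight (t • u) fun j =>
        t * bary (k := n + 2) s j)) = ENNReal.ofReal (t ^ (2 * (n + 2) - d)) *
        ∫⁻ s in simplex (n + 2),
          ENNReal.ofReal (polygonWeight u fun j => bary (k := n + 2) s j) := by
    rw [← lintegral_const_mul' _ _ ENNReal.ofReal_ne_top,
      ← lintegral_const_mul' _ _ ENNReal.ofReal_ne_top,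
      ← lintegral_const_mul' _ _ ENNReal.ofReal_ne_top]
    exact lintegral_congr h3
  rw [Pi.mul_apply]
  calc _ = ENNReal.ofReal (2 / ((n + 2 : ℕ) : ℝ)) * (ENNReal.ofReal (t ^ (2 * (n + 2) - d)) *
        ∫⁻ s in simplex (n + 2),
          ENNReal.ofReal (polygonWeight u fun j => bary (k := n + 2) s j)) * F (t, t • u) := by ring
    _ = _ := by
      rw [← h5]
      ring

end WaveTrace

end

/-! ### The polar identity in dimension three, and the common statement. -/

noncomputable section

namespace WaveTrace

open Filter Topology

variable {d : ℕ}

/-! ### The measures `σ_k` in dimension three -/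

/-- In dimension three the delays are determined by the sides, so the delay variables carry no
freedom. -/
theorem pi_waveBase_three (m : ℕ) :
    (Measure.pi fun _ : Fin m => waveBase 3) = Measure.dirac 0 := by
  refine Measure.pi_eq fun s hs => ?_
  simp only [waveBase, if_true]
  rw [Measure.dirac_apply' _ (MeasurableSet.univ_pi hs)]
  simp only [Measure.dirac_apply' _ (hs _)]
  by_cases h : ∀ i, (0 : ℝ) ∈ s i
  · rw [Set.indicator_of_mem (by simpa using h)]
    simp [h]
  · rw [Set.indicator_of_notMem (by simpa using h)]
    push Not at h
    obtain ⟨i, hi⟩ := h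
    exact (Finset.prod_eq_zero (Finset.mem_univ i) (Set.indicator_of_notMem hi _)).symm

/-- This radial integral produces the `2n + 1 = 2k - 3` that the normalization in `sigmaThree`
cancels. -/
theorem lintegral_Ioi_inv_pow (n : ℕ) {p : ℝ} (hp : 0 < p) :
    ∫⁻ s in Set.Ioi p, ENNReal.ofReal ((s ^ (2 * n + 2))⁻¹)
      = ENNReal.ofReal ((p ^ (2 * n + 1))⁻¹ * (2 * n + 1 : ℝ)⁻¹) := by
  have ha : (-(2 * n + 2 : ℕ) : ℝ) < -1 := by
    push_cast
    linarith [(Nat.cast_nonneg n : (0 : ℝ) ≤ n)]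
  have h1 := integrableOn_Ioi_rpow_of_lt ha hp
  have h2 := integral_Ioi_rpow_of_lt ha hp
  have e : ∀ s ∈ Set.Ioi p, s ^ (-(2 * n + 2 : ℕ) : ℝ) = (s ^ (2 * n + 2))⁻¹ := fun s hs => by
    rw [Real.rpow_neg (hp.le.trans (le_of_lt hs)), Real.rpow_natCast]
  rw [setIntegral_congr_fun measurableSet_Ioi e] at h2
  rw [← ofReal_integral_eq_lintegral_ofReal (h1.congr_fun e measurableSet_Ioi), h2]
  · congr 1
    have e2 : (-(2 * n + 2 : ℕ) : ℝ) + 1 = -((2 * n + 1 : ℕ) : ℝ) := by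
      push_cast
      ring
    rw [e2, Real.rpow_neg hp.le, Real.rpow_natCast, neg_div_neg_eq, div_eq_mul_inv]
    push_cast
    rfl
  · exact (ae_restrict_iff' measurableSet_Ioi).2 (Eventually.of_forall fun s hs => by
      have : (0 : ℝ) < s := hp.trans hs
      positivity)

/-- The perimeter of the polygon with vertices `0, u`. -/
def polygonPerimeter {n : ℕ} (u : Fin (n + 1) → E d) : ℝ := ∑ j, polygonSide u j

/-- The inverse of the product of the lengths of the sides of a polygon. -/
def polygonInv {n : ℕ} (u : Fin (n + 1) → E d) : ℝ := (∏ j, polygonSide u j)⁻¹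

theorem continuous_polygonPerimeter (d n : ℕ) :
    Continuous fun u : Fin (n + 1) → E d => polygonPerimeter u :=
  continuous_finsetSum _ fun j _ => continuous_polygonSide j

theorem measurable_polygonInv (d n : ℕ) :
    Measurable fun u : Fin (n + 1) → E d => polygonInv u :=
  (Finset.measurable_prod _ fun j _ => (continuous_polygonSide j).measurable).inv

theorem polygonPerimeter_nonneg {n : ℕ} (u : Fin (n + 1) → E d) : 0 ≤ polygonPerimeter u :=
  Finset.sum_nonneg fun j _ => polygonSide_nonneg u j

theorem polygonInv_nonneg {n : ℕ} (u : Fin (n + 1) → E d) : 0 ≤ polygonInv u :=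
  inv_nonneg.2 (Finset.prod_nonneg fun j _ => polygonSide_nonneg u j)

theorem polygonInv_eq_zero {n : ℕ} {u : Fin (n + 1) → E d} (h : polygonPerimeter u = 0) :
    polygonInv u = 0 := by
  have h1 := (Finset.sum_eq_zero_iff_of_nonneg fun j _ => polygonSide_nonneg u j).1 h
  rw [polygonInv, Finset.prod_eq_zero (Finset.mem_univ 0) (h1 0 (Finset.mem_univ 0)), inv_zero]

theorem polygonPerimeter_smul {n : ℕ} {t : ℝ} (ht : 0 ≤ t) (u : Fin (n + 1) → E d) :
    polygonPerimeter (t • u) = t * polygonPerimeter u := by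
  simp only [polygonPerimeter, polygonSide_smul ht, Finset.mul_sum]

theorem polygonInv_smul {n : ℕ} {t : ℝ} (ht : 0 ≤ t) (u : Fin (n + 1) → E d) :
    polygonInv (t • u) = (t ^ (n + 2))⁻¹ * polygonInv u := by
  simp only [polygonInv, polygonSide_smul ht]
  rw [Finset.prod_mul_distrib, mul_inv, Finset.prod_const, Finset.card_univ, Fintype.card_fin]

theorem lintegral_polygonMeasure_three_eq (n : ℕ) {G : (Fin (n + 1) → E 3) → ℝ≥0∞}
    (hG : Measurable G) :
    ∫⁻ u, G u ∂polygonMeasure 3 n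
      = ENNReal.ofReal ((2 * n + 1) * (2 / (((n + 2 : ℕ) : ℝ) * (4 * Real.pi) ^ (n + 2)))) *
        ∫⁻ u, Set.indicator {u : Fin (n + 1) → E 3 | polygonPerimeter u < 1}
          (fun u => ENNReal.ofReal (polygonInv u) * G ((polygonPerimeter u)⁻¹ • u)) u := by
  have hA : MeasurableSet {u : Fin (n + 1) → E 3 | polygonPerimeter u < 1} :=
    measurableSet_lt (continuous_polygonPerimeter 3 n).measurable measurable_const
  have hp : Measurable fun u : Fin (n + 1) → E 3 => (polygonPerimeter u)⁻¹ • u :=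
    (continuous_polygonPerimeter 3 n).measurable.inv.smul measurable_id
  have hw := (measurable_polygonInv 3 n).ennreal_ofReal
  have e : polygonMeasure 3 n = ENNReal.ofReal ((2 * n + 1) *
      (2 / (((n + 2 : ℕ) : ℝ) * (4 * Real.pi) ^ (n + 2)))) •
      Measure.map (fun u : Fin (n + 1) → E 3 => (polygonPerimeter u)⁻¹ • u)
      ((volume.withDensity fun u => ENNReal.ofReal (polygonInv u)).restrict
        {u | polygonPerimeter u < 1}) := by
    change ENNReal.ofReal ((2 * ((n + 2 : ℕ) : ℝ) - 3) *
      (2 / (((n + 2 : ℕ) : ℝ) * (4 * Real.pi) ^ (n + 2)))) •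
      Measure.map (fun u : Fin (n + 1) → E 3 => (perimeter (k := n + 2) u)⁻¹ • u)
      ((volume.withDensity fun u : Fin (n + 1) → E 3 =>
          ENNReal.ofReal (∏ i ∈ Finset.range (n + 2), side (k := n + 2) u i)⁻¹).restrict
          {u | perimeter (k := n + 2) u < 1}) = _
    simp only [perimeter_eq_sum, Finset.prod_range]
    congr 3
    push_cast
    ring
  have hGp : Measurable fun u : Fin (n + 1) → E 3 => G ((polygonPerimeter u)⁻¹ • u) := hG.comp hp
  rw [e, lintegral_smul_measure, smul_eq_mul, lintegral_map hG hp, restrict_withDensity hA,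
    lintegral_withDensity_eq_lintegral_mul _ hw hGp, lintegral_indicator hA]
  rfl

-- The radial projection in the definition of the measure is undone by two substitutions, `t = P(u)
-- s` and then `y = s u`. The auxiliary variable `s` ends up on `(P y, ∞)` and is integrated out.
set_option maxHeartbeats 1000000 in
theorem lintegral_polygonMeasure_three (n : ℕ) {F : ℝ × (Fin (n + 1) → E 3) → ℝ≥0∞}
    (hF : Measurable F) :
    ∫⁻ t in Set.Ioi (0 : ℝ), ENNReal.ofReal (t ^ (2 * (n + 2) - 3)) *
        ∫⁻ u, F (t, t • u) ∂polygonMeasure 3 n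
      = ENNReal.ofReal (2 / ((n + 2 : ℕ) : ℝ)) * ∫⁻ u, ∫⁻ v,
        ENNReal.ofReal (polygonDelay u v * polygonWeight u v) * F (polygonDelay u v, u)
          ∂(Measure.pi fun _ : Fin (n + 2) => waveBase 3) := by
  have hP := (continuous_polygonPerimeter 3 n).measurable
  have hQ := measurable_polygonInv 3 n
  set P : (Fin (n + 1) → E 3) → ℝ := polygonPerimeter with hP_def
  set Q : (Fin (n + 1) → E 3) → ℝ := polygonInv with hQ_def
  have hP0 : ∀ u, 0 ≤ P u := polygonPerimeter_nonneg
  have hQ0 : ∀ u, 0 ≤ Q u := polygonInv_nonneg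
  have hexp : 2 * (n + 2) - 3 = 2 * n + 1 := by omega
  rw [hexp]
  set c : ℝ := (2 * n + 1) * (2 / (((n + 2 : ℕ) : ℝ) * (4 * Real.pi) ^ (n + 2))) with hc
  have hc0 : 0 ≤ c := by positivity
  have hA : MeasurableSet {u : Fin (n + 1) → E 3 | P u < 1} := measurableSet_lt hP measurable_const
  -- `f1` is the integrand as defined, `f2` the one after `t = P(u) s`, and `f3` the one after `y =
  -- s u`.
  let f1 : (Fin (n + 1) → E 3) → ℝ → ℝ≥0∞ := fun u t =>
    Set.indicator {u : Fin (n + 1) → E 3 | P u < 1} (fun u => ENNReal.ofReal (Q u) *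
      (ENNReal.ofReal (t ^ (2 * n + 1)) * F (t, t • (P u)⁻¹ • u))) u
  let f2 : (Fin (n + 1) → E 3) → ℝ → ℝ≥0∞ := fun u s =>
    Set.indicator {u : Fin (n + 1) → E 3 | P u < 1} (fun u => ENNReal.ofReal (Q u *
      (P u ^ (2 * n + 2) * s ^ (2 * n + 1))) * F (P u * s, s • u)) u
  let f3 : (Fin (n + 1) → E 3) → ℝ → ℝ≥0∞ := fun y s =>
    Set.indicator {p : (Fin (n + 1) → E 3) × ℝ | P p.1 < p.2} (fun p => ENNReal.ofReal (Q p.1 *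
      (P p.1 ^ (2 * n + 2) * (p.2 ^ (2 * n + 2))⁻¹)) * F (P p.1, p.1)) (y, s)
  have hmA : MeasurableSet {p : (Fin (n + 1) → E 3) × ℝ | P p.1 < 1} :=
    measurableSet_lt (hP.comp measurable_fst) measurable_const
  have hPf : Measurable fun p : (Fin (n + 1) → E 3) × ℝ => P p.1 := hP.comp measurable_fst
  have hQf : Measurable fun p : (Fin (n + 1) → E 3) × ℝ => Q p.1 := hQ.comp measurable_fst
  have hm1 : Measurable (Function.uncurry f1) := by
    have h : Function.uncurry f1 = Set.indicator {p : (Fin (n + 1) → E 3) × ℝ | P p.1 < 1}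
        fun p => ENNReal.ofReal (Q p.1) *
          (ENNReal.ofReal (p.2 ^ (2 * n + 1)) * F (p.2, p.2 • (P p.1)⁻¹ • p.1)) := rfl
    rw [h]
    refine Measurable.indicator (hQf.ennreal_ofReal.mul (Measurable.mul (by fun_prop)
      (hF.comp (measurable_snd.prodMk ?_)))) hmA
    exact measurable_snd.smul (hPf.inv.smul measurable_fst)
  have hm2 : Measurable (Function.uncurry f2) := by
    have h : Function.uncurry f2 = Set.indicator {p : (Fin (n + 1) → E 3) × ℝ | P p.1 < 1}
        fun p => ENNReal.ofReal (Q p.1 * (P p.1 ^ (2 * n + 2) * p.2 ^ (2 * n + 1))) *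
          F (P p.1 * p.2, p.2 • p.1) := rfl
    rw [h]
    refine Measurable.indicator (Measurable.mul (hQf.mul ((hPf.pow_const _).mul
      (measurable_snd.pow_const _))).ennreal_ofReal
      (hF.comp ((hPf.mul measurable_snd).prodMk (measurable_snd.smul measurable_fst)))) hmA
  have hm3 : Measurable (Function.uncurry f3) := by
    refine Measurable.indicator (Measurable.mul (hQf.mul ((hPf.pow_const _).mul
      (measurable_snd.pow_const _).inv)).ennreal_ofReal
      (hF.comp (hPf.prodMk measurable_fst))) (measurableSet_lt hPf measurable_snd)
  have h12 : ∀ u, ∫⁻ t in Set.Ioi (0 : ℝ), f1 u t = ∫⁻ s in Set.Ioi (0 : ℝ), f2 u s := by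
    intro u
    -- A degenerate polygon of perimeter zero has weight `0`, by the convention `0⁻¹ = 0`.
    rcases (hP0 u).eq_or_lt with h0 | h0
    · have hq : Q u = 0 := polygonInv_eq_zero h0.symm
      refine lintegral_congr fun t => ?_
      simp only [f1, f2, Set.indicator_apply, hq, zero_mul, ENNReal.ofReal_zero]
    · rw [lintegral_Ioi_eq_mul_lintegral (hm1.of_uncurry_left (x := u)) h0,
        ← lintegral_const_mul' _ _ ENNReal.ofReal_ne_top]
      refine setLIntegral_congr_fun measurableSet_Ioi fun s (hs : 0 < s) => ?_
      by_cases hu : P u < 1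
      · simp only [f1, f2]
        rw [Set.indicator_of_mem (show u ∈ {u : Fin (n + 1) → E 3 | P u < 1} from hu),
          Set.indicator_of_mem (show u ∈ {u : Fin (n + 1) → E 3 | P u < 1} from hu),
          smul_smul, mul_comm (P u) s, mul_assoc s, mul_inv_cancel₀ h0.ne', mul_one, ← mul_assoc,
          ← mul_assoc, ← ENNReal.ofReal_mul (hP0 u),
          ← ENNReal.ofReal_mul (mul_nonneg (hP0 u) (hQ0 u))]
        congr 2
        ring
      · simp only [f1, f2]
        rw [Set.indicator_of_notMem (show u ∉ {u : Fin (n + 1) → E 3 | P u < 1} from hu),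
          Set.indicator_of_notMem (show u ∉ {u : Fin (n + 1) → E 3 | P u < 1} from hu), mul_zero]
  have h23 : ∀ s ∈ Set.Ioi (0 : ℝ), ∫⁻ u, f2 u s = ∫⁻ y, f3 y s := by
    intro s hs
    have hs' : (0 : ℝ) < s := hs
    rw [lintegral_eq_mul_lintegral_smul volume
      (hm3.of_uncurry_right (y := s)) hs',
      finrank_polygon, ← lintegral_const_mul' _ _ ENNReal.ofReal_ne_top]
    refine lintegral_congr fun u => ?_
    have e1 : P (s • u) = s * P u := polygonPerimeter_smul hs'.le u
    have e2 : Q (s • u) = (s ^ (n + 2))⁻¹ * Q u := polygonInv_smul hs'.le u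
    by_cases hu : P u < 1
    · have hu' : P (s • u) < s := by
        rw [e1]
        exact mul_lt_of_lt_one_right hs' hu
      simp only [f2, f3]
      rw [Set.indicator_of_mem (show u ∈ {u : Fin (n + 1) → E 3 | P u < 1} from hu),
        Set.indicator_of_mem (show (s • u, s) ∈
          {p : (Fin (n + 1) → E 3) × ℝ | P p.1 < p.2} from hu'),
        ← mul_assoc (ENNReal.ofReal _), ← ENNReal.ofReal_mul (by positivity)]
      simp only [e1, e2, mul_comm s (P u)]
      congr 2
      have e3 : s ^ ((n + 1) * 3) = s ^ (n + 2) * s ^ (2 * n + 1) := by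
        rw [← pow_add]
        congr 1
        ring
      rw [e3, mul_pow]
      field_simp
    · have hu' : ¬ P (s • u) < s := by
        rw [e1, not_lt]
        exact le_mul_of_one_le_right hs'.le (not_lt.1 hu)
      simp only [f2, f3]
      rw [Set.indicator_of_notMem (show u ∉ {u : Fin (n + 1) → E 3 | P u < 1} from hu),
        Set.indicator_of_notMem (show (s • u, s) ∉
          {p : (Fin (n + 1) → E 3) × ℝ | P p.1 < p.2} from hu'), mul_zero]
  have h3 : ∀ y, ∫⁻ s in Set.Ioi (0 : ℝ), f3 y s
      = ENNReal.ofReal (Q y * (P y * (2 * n + 1 : ℝ)⁻¹)) * F (P y, y) := by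
    intro y
    have e1 : ∫⁻ s in Set.Ioi (0 : ℝ), f3 y s = ∫⁻ s in Set.Ioi (P y),
        ENNReal.ofReal (Q y * P y ^ (2 * n + 2)) * F (P y, y)
          * ENNReal.ofReal ((s ^ (2 * n + 2))⁻¹) := by
      rw [← lintegral_indicator measurableSet_Ioi, ← lintegral_indicator measurableSet_Ioi]
      refine lintegral_congr fun s => ?_
      by_cases hs : P y < s
      · rw [Set.indicator_of_mem (Set.mem_Ioi.2 ((hP0 y).trans_lt hs)),
          Set.indicator_of_mem (Set.mem_Ioi.2 hs)]
        simp only [f3]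
        rw [Set.indicator_of_mem (show (y, s) ∈
          {p : (Fin (n + 1) → E 3) × ℝ | P p.1 < p.2} from hs), ← mul_assoc (Q y),
          ENNReal.ofReal_mul (mul_nonneg (hQ0 y) (pow_nonneg (hP0 y) _))]
        ring
      · have h0 : f3 y s = 0 := Set.indicator_of_notMem (show (y, s) ∉
          {p : (Fin (n + 1) → E 3) × ℝ | P p.1 < p.2} from hs) _
        rw [Set.indicator_of_notMem (s := Set.Ioi (P y)) (by simpa using hs)]
        simp [Set.indicator_apply, h0]
    rw [e1]
    rcases (hP0 y).eq_or_lt with h0 | h0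
    · have hq : Q y = 0 := polygonInv_eq_zero h0.symm
      simp [hq]
    · rw [lintegral_const_mul _ (by fun_prop), lintegral_Ioi_inv_pow n h0, mul_right_comm,
        ← ENNReal.ofReal_mul (mul_nonneg (hQ0 y) (pow_nonneg (hP0 y) _))]
      congr 2
      field_simp
      ring
  have hL : ∫⁻ t in Set.Ioi (0 : ℝ), ENNReal.ofReal (t ^ (2 * n + 1)) *
        ∫⁻ u, F (t, t • u) ∂polygonMeasure 3 n
      = ENNReal.ofReal c * ∫⁻ y, ENNReal.ofReal (Q y * (P y * (2 * n + 1 : ℝ)⁻¹)) * F (P y, y) := by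
    have e1 : ∀ t : ℝ, ENNReal.ofReal (t ^ (2 * n + 1)) * ∫⁻ u, F (t, t • u) ∂polygonMeasure 3 n
        = ENNReal.ofReal c * ∫⁻ u, f1 u t := by
      intro t
      have hFt : Measurable fun u : Fin (n + 1) → E 3 => F (t, t • u) :=
        hF.comp (measurable_const.prodMk (measurable_const_smul t))
      rw [lintegral_polygonMeasure_three_eq n hFt, mul_left_comm, ← lintegral_const_mul' _ _ ENNReal.ofReal_ne_top]
      congr 1
      refine lintegral_congr fun u => ?_
      simp only [f1, Set.indicator_apply]
      split_ifs
      · ring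
      · rw [mul_zero]
    simp only [e1]
    rw [lintegral_const_mul' _ _ ENNReal.ofReal_ne_top, ← lintegral_lintegral_swap hm1.aemeasurable,
      lintegral_congr h12, lintegral_lintegral_swap hm2.aemeasurable,
      setLIntegral_congr_fun measurableSet_Ioi h23, ← lintegral_lintegral_swap hm3.aemeasurable,
      lintegral_congr h3]
  rw [hL, pi_waveBase_three, ← lintegral_const_mul' _ _ ENNReal.ofReal_ne_top,
    ← lintegral_const_mul' _ _ ENNReal.ofReal_ne_top]
  refine lintegral_congr fun y => ?_
  have hdl : polygonDelay y (0 : Fin (n + 2) → ℝ) = P y := by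
    simp [polygonDelay, waveDelay, hP_def, polygonPerimeter]
  have hwt : polygonWeight y (0 : Fin (n + 2) → ℝ) = ((4 * Real.pi) ^ (n + 2))⁻¹ * Q y := by
    simp only [polygonWeight, waveWeight, if_true, hQ_def, polygonInv]
    rw [Finset.prod_inv_distrib, Finset.prod_mul_distrib, Finset.prod_const, Finset.card_univ,
      Fintype.card_fin, mul_inv]
  rw [lintegral_dirac, hdl, hwt, ← mul_assoc (ENNReal.ofReal _),
    ← mul_assoc (ENNReal.ofReal _), ← ENNReal.ofReal_mul hc0,
    ← ENNReal.ofReal_mul (by positivity)]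
  congr 2
  rw [hc]
  have : (0 : ℝ) < 2 * n + 1 := by positivity
  field_simp

theorem lintegral_polygonMeasure (hd : 1 ≤ d) (hd' : d ≤ 3) (n : ℕ)
    {F : ℝ × (Fin (n + 1) → E d) → ℝ≥0∞} (hF : Measurable F) :
    ∫⁻ t in Set.Ioi (0 : ℝ), ENNReal.ofReal (t ^ (2 * (n + 2) - d)) *
        ∫⁻ u, F (t, t • u) ∂polygonMeasure d n
      = ENNReal.ofReal (2 / ((n + 2 : ℕ) : ℝ)) * ∫⁻ u, ∫⁻ v,
        ENNReal.ofReal (polygonDelay u v * polygonWeight u v) * F (polygonDelay u v, u)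
          ∂(Measure.pi fun _ : Fin (n + 2) => waveBase d) := by
  rcases hd'.lt_or_eq with h | h
  · exact lintegral_polygonMeasure_of_le_two hd (by omega) n hF
  · subst h
    exact lintegral_polygonMeasure_three n hF

end WaveTrace

end

/-! ### Finiteness of `σ_k` and the polar identity for measures. -/

noncomputable section

namespace WaveTrace

open Filter Topology

variable {d : ℕ}

/-! ### Finiteness of `σ_k` -/

theorem measurable_prod_greenBound (n : ℕ) (y x : E d) :
    Measurable fun v : Fin n → E d => ∏ i, greenBound d
      ‖(Fin.snoc v x : Fin (n + 1) → E d) i - (Fin.cons y v : Fin (n + 1) → E d) i‖ := by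
  have hs : ∀ i, Measurable fun v : Fin n → E d =>
      (Fin.snoc v x : Fin (n + 1) → E d) i := fun i => by
    refine Fin.lastCases ?_ (fun i => ?_) i
    · simp
    · simp only [Fin.snoc_castSucc]
      fun_prop
  have hc : ∀ i, Measurable fun v : Fin n → E d =>
      (Fin.cons y v : Fin (n + 1) → E d) i := fun i => by
    refine Fin.cases ?_ (fun i => ?_) i
    · simp
    · simp only [Fin.cons_succ]
      fun_prop
  exact Finset.measurable_prod _ fun i _ => (measurable_greenBound d).comp ((hs i).sub (hc i)).norm

theorem boundChain_eq_lintegral (n : ℕ) (y x : E d) :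
    boundChain d n y x = ∫⁻ v : Fin n → E d, ∏ i, greenBound d
      ‖(Fin.snoc v x : Fin (n + 1) → E d) i - (Fin.cons y v : Fin (n + 1) → E d) i‖ := by
  induction n generalizing y with
  | zero =>
    simp only [boundChain]
    rw [lintegral_unique, volume_pi, Measure.pi_univ]
    simp [Fin.snoc]
  | succ n ih =>
    rw [lintegral_finCons (measurable_prod_greenBound (n + 1) y x), boundChain]
    refine lintegral_congr fun a => ?_
    have h1 : ∀ (v : Fin n → E d) (i : Fin (n + 1)), (Fin.snoc (Fin.cons a v : Fin (n + 1) → E d) x :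
        Fin (n + 2) → E d) i.succ = (Fin.snoc v x : Fin (n + 1) → E d) i := fun v i => by
      rw [← Fin.cons_snoc_eq_snoc_cons, Fin.cons_succ]
    have h0 : ∀ v : Fin n → E d, (Fin.snoc (Fin.cons a v : Fin (n + 1) → E d) x :
        Fin (n + 2) → E d) 0 = a := fun v => by
      rw [← Fin.cons_snoc_eq_snoc_cons, Fin.cons_zero]
    simp only [Fin.prod_univ_succ (n := n + 1), h0, h1, Fin.cons_zero, Fin.cons_succ]
    rw [lintegral_const_mul _ (measurable_prod_greenBound n a x), ih]

/-- A closed polygon based at the origin is a chain from `0` to `0`. -/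
theorem lintegral_prod_greenBound_lt_top (hd : 1 ≤ d) (hd' : d ≤ 3) (n : ℕ) :
    ∫⁻ u : Fin (n + 1) → E d, ∏ j, greenBound d (polygonSide u j) < ∞ := by
  obtain ⟨M, hM, h⟩ := exists_boundChain_le hd hd' n
  refine lt_of_eq_of_lt ?_ ((h 0 0).trans_lt hM)
  rw [boundChain_eq_lintegral]
  refine lintegral_congr fun u => Finset.prod_congr rfl fun j _ => ?_
  have h1 : (Fin.snoc u 0 : Fin (n + 2) → E d) j = (Fin.cons 0 u : Fin (n + 2) → E d) (j + 1) := by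
    refine Fin.lastCases ?_ (fun j => ?_) j
    · rw [Fin.last_add_one, Fin.snoc_last, Fin.cons_zero]
    · rw [Fin.coeSucc_eq_succ, Fin.snoc_castSucc, Fin.cons_succ]
  rw [h1, polygonSide, side, vertex_eq_cons, vertex_add_one_eq_cons]

theorem lintegral_polygonWeight_exp {n : ℕ} (u : Fin (n + 1) → E d) :
    ∫⁻ v, ENNReal.ofReal (polygonWeight u v * Real.exp (-(1 / 2) * polygonDelay u v))
      ∂(Measure.pi fun _ : Fin (n + 2) => waveBase d) = ∏ j, greenBound d (polygonSide u j) := by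
  have h1 : ∀ j, Measurable fun s : ℝ => ENNReal.ofReal (waveWeight d (polygonSide u j) s *
      Real.exp (-(1 / 2) * waveDelay d (polygonSide u j) s)) := fun j =>
    ((measurable_weight_exp d (1 / 2)).comp
      (measurable_const.prodMk measurable_id)).ennreal_ofReal
  simp only [greenBound]
  rw [← lintegral_pi_prod (waveBase d) h1]
  refine lintegral_congr fun v => ?_
  rw [polygonWeight, polygonDelay, Finset.mul_sum, Real.exp_sum, ← Finset.prod_mul_distrib,
    ENNReal.ofReal_prod_of_nonneg fun j _ => mul_nonneg
      (waveWeight_nonneg d (polygonSide_nonneg u j) (v j)) (Real.exp_pos _).le]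

/-- The polar identity is tested on `e^{-t}`. One side is a nonzero factorial times the total mass;
the other is dominated by the integral of products of the majorant. -/
theorem sigma_univ_lt_top (hd : 1 ≤ d) (hd' : d ≤ 3) (n : ℕ) :
    polygonMeasure d n Set.univ < ∞ := by
  have hF : Measurable fun p : ℝ × (Fin (n + 1) → E d) => ENNReal.ofReal (Real.exp (-p.1)) := by
    fun_prop
  have h1 := lintegral_polygonMeasure hd hd' n hF
  simp only [lintegral_const] at h1
  have h2 : ∀ (u : Fin (n + 1) → E d) v, ENNReal.ofReal (polygonDelay u v * polygonWeight u v) *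
      ENNReal.ofReal (Real.exp (-polygonDelay u v)) ≤ 2 *
        ENNReal.ofReal (polygonWeight u v * Real.exp (-(1 / 2) * polygonDelay u v)) := by
    intro u v
    have h3 := mul_exp_neg_le (δ := 1) (s := polygonDelay u v) one_pos
    rw [← ENNReal.ofReal_mul' (Real.exp_pos _).le, ← ENNReal.ofReal_ofNat,
      ← ENNReal.ofReal_mul zero_le_two]
    refine ENNReal.ofReal_le_ofReal ?_
    have h4 := mul_le_mul_of_nonneg_left h3 (polygonWeight_nonneg u v)
    have h5 : -(1 : ℝ) * polygonDelay u v = -polygonDelay u v := by ring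
    rw [h5] at h4
    linarith
  have h3 : ENNReal.ofReal (2 / ((n + 2 : ℕ) : ℝ)) * ∫⁻ u : Fin (n + 1) → E d, ∫⁻ v,
        ENNReal.ofReal (polygonDelay u v * polygonWeight u v) *
          ENNReal.ofReal (Real.exp (-polygonDelay u v))
          ∂(Measure.pi fun _ : Fin (n + 2) => waveBase d) < ∞ := by
    refine ENNReal.mul_lt_top ENNReal.ofReal_lt_top (lt_of_le_of_lt ?_
      (ENNReal.mul_lt_top (a := 2) (by simp) (lintegral_prod_greenBound_lt_top hd hd' n)))
    rw [← lintegral_const_mul' _ _ (by simp)]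
    refine lintegral_mono fun u => ?_
    rw [← lintegral_polygonWeight_exp, ← lintegral_const_mul' _ _ (by simp)]
    exact lintegral_mono (h2 u)
  rw [← h1] at h3
  have h4 : ∫⁻ t in Set.Ioi (0 : ℝ), ENNReal.ofReal (t ^ (2 * (n + 2) - d)) *
      (ENNReal.ofReal (Real.exp (-t)) * polygonMeasure d n Set.univ) =
      ENNReal.ofReal ((2 * (n + 2) - d).factorial) * polygonMeasure d n Set.univ := by
    rw [← lintegral_pow_mul_exp_neg, ← lintegral_mul_const _ (by fun_prop)]
    refine setLIntegral_congr_fun measurableSet_Ioi fun t (ht : 0 < t) => ?_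
    rw [ENNReal.ofReal_mul (by positivity), mul_assoc]
  rw [h4] at h3
  refine (ENNReal.lt_top_of_mul_ne_top_right h3.ne ?_)
  simpa using Nat.factorial_ne_zero (2 * (n + 2) - d)

/-! ### Passage to Bochner integrals -/

/-- An identity of measures, unlike one of nonnegative integrals, carries over directly to complex
integrands. -/
theorem map_polygonMeasure_eq (hd : 1 ≤ d) (hd' : d ≤ 3) (n : ℕ) :
    Measure.map (fun p : ℝ × (Fin (n + 1) → E d) => (p.1, p.1 • p.2))
      (((volume.restrict (Set.Ioi (0 : ℝ))).withDensity fun t =>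
        ENNReal.ofReal (t ^ (2 * (n + 2) - d))).prod (polygonMeasure d n))
    = Measure.map (fun p : (Fin (n + 1) → E d) × (Fin (n + 2) → ℝ) => (polygonDelay p.1 p.2, p.1))
      ((volume.prod (Measure.pi fun _ : Fin (n + 2) => waveBase d)).withDensity fun p =>
        ENNReal.ofReal (2 / ((n + 2 : ℕ) : ℝ)) *
          ENNReal.ofReal (polygonDelay p.1 p.2 * polygonWeight p.1 p.2)) := by
  have : IsFiniteMeasure (polygonMeasure d n) := ⟨sigma_univ_lt_top hd hd' n⟩
  have hD := measurable_polygonDelay d n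
  have hW := measurable_polygonWeight d n
  refine Measure.ext_of_lintegral _ fun F hF => ?_
  have hm : Measurable fun p : ℝ × (Fin (n + 1) → E d) => (p.1, p.1 • p.2) := by fun_prop
  have hg : Measurable fun p : (Fin (n + 1) → E d) × (Fin (n + 2) → ℝ) =>
      (polygonDelay p.1 p.2, p.1) := hD.prodMk measurable_fst
  have hk : Measurable fun p : (Fin (n + 1) → E d) × (Fin (n + 2) → ℝ) =>
      ENNReal.ofReal (2 / ((n + 2 : ℕ) : ℝ)) *
          ENNReal.ofReal (polygonDelay p.1 p.2 * polygonWeight p.1 p.2) :=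
    (hD.mul hW).ennreal_ofReal.const_mul _
  have hFm : Measurable fun p : ℝ × (Fin (n + 1) → E d) => F (p.1, p.1 • p.2) := hF.comp hm
  have hFg : Measurable fun p : (Fin (n + 1) → E d) × (Fin (n + 2) → ℝ) =>
      F (polygonDelay p.1 p.2, p.1) := hF.comp hg
  have ht : Measurable fun t : ℝ => ENNReal.ofReal (t ^ (2 * (n + 2) - d)) := by fun_prop
  rw [lintegral_map hF hm, lintegral_map hF hg, lintegral_prod _ hFm.aemeasurable,
    lintegral_withDensity_eq_lintegral_mul _ ht hFm.lintegral_prod_right',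
    lintegral_withDensity_eq_lintegral_mul _ hk hFg, lintegral_prod _ (hk.mul hFg).aemeasurable]
  simp only [Pi.mul_apply]
  rw [lintegral_polygonMeasure hd hd' n hF, ← lintegral_const_mul' _ _ ENNReal.ofReal_ne_top]
  refine lintegral_congr fun u => ?_
  rw [← lintegral_const_mul' _ _ ENNReal.ofReal_ne_top]
  simp only [mul_assoc]

end WaveTrace

end

/-! ### The integral against `σ_k` as an inverse Laplace transform. -/

noncomputable section

namespace WaveTrace

open Filter Topology

variable {d : ℕ}

/-! ### The Laplace transform of the trace -/

theorem ae_polygon_delay_nonneg {n : ℕ} (u : Fin (n + 1) → E d) :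
    ∀ᵐ v ∂(Measure.pi fun _ : Fin (n + 2) => waveBase d),
      ∀ j, 0 ≤ waveDelay d (polygonSide u j) (v j) :=
  ae_all_iff.2 fun j => (Measure.quasiMeasurePreserving_eval (fun _ => waveBase d) j).ae
    (ae_waveDelay_nonneg d (polygonSide_nonneg u j))

/-- The factor `polygonDelay` is the sum of the delays of the sides. Each summand gives a product of
functions of one variable, integrated factor by factor, with the delay sitting on the differentiated
one. -/
theorem integral_polygonWeight_cexp (w : ℝ) {n : ℕ} {u : Fin (n + 1) → E d}
    (hu : ∏ j, greenBound d (polygonSide u j) < ∞) :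
    ∫ v, ((polygonDelay u v * polygonWeight u v : ℝ) : ℂ) *
        Complex.exp (-zline w * polygonDelay u v) ∂(Measure.pi fun _ : Fin (n + 2) => waveBase d)
      = polygonGreen w u := by
  have hD : Measurable fun v => polygonDelay u v :=
    (measurable_polygonDelay d n).of_uncurry_left (f := polygonDelay)
  have hW : Measurable fun v => polygonWeight u v :=
    (measurable_polygonWeight d n).of_uncurry_left (f := polygonWeight)
  have hb : Integrable (fun v => polygonWeight u v * Real.exp (-(1 / 2) * polygonDelay u v))
      (Measure.pi fun _ : Fin (n + 2) => waveBase d) := by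
    refine (lintegral_ofReal_ne_top_iff_integrable (by fun_prop) (Eventually.of_forall fun v =>
      mul_nonneg (polygonWeight_nonneg u v) (Real.exp_pos _).le)).1 ?_
    rw [lintegral_polygonWeight_exp]
    exact hu.ne
  let f : Fin (n + 2) → Fin (n + 2) → ℝ → ℂ := fun i j s =>
    (if j = i then (waveDelay d (polygonSide u j) s : ℂ) else 1) *
      (waveWeight d (polygonSide u j) s *
        Complex.exp (-zline w * waveDelay d (polygonSide u j) s))
  have hf : ∀ i (v : Fin (n + 2) → ℝ), ∏ j, f i j (v j) =
      waveDelay d (polygonSide u i) (v i) * (polygonWeight u v *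
        Complex.exp (-zline w * polygonDelay u v)) := by
    intro i v
    simp only [f]
    rw [Finset.prod_mul_distrib, Finset.prod_mul_distrib, Finset.prod_ite_eq' Finset.univ i,
      if_pos (Finset.mem_univ i), ← Complex.exp_sum, ← Finset.mul_sum, polygonWeight, polygonDelay]
    push_cast
    rfl
  have hd : ∀ i, Measurable fun v : Fin (n + 2) → ℝ => waveDelay d (polygonSide u i) (v i) :=
    fun i => (continuous_waveDelay d).measurable.comp
      (f := fun v : Fin (n + 2) → ℝ => (polygonSide u i, v i)) (by fun_prop)
  have hI : ∀ i, Integrable (fun v : Fin (n + 2) → ℝ => ∏ j, f i j (v j))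
      (Measure.pi fun _ : Fin (n + 2) => waveBase d) := by
    intro i
    simp only [hf]
    refine (hb.const_mul 2).mono' (by fun_prop) ?_
    filter_upwards [ae_polygon_delay_nonneg u] with v hv
    have h1 : waveDelay d (polygonSide u i) (v i) ≤ polygonDelay u v :=
      Finset.single_le_sum (f := fun j => waveDelay d (polygonSide u j) (v j))
        (fun j _ => hv j) (Finset.mem_univ i)
    rw [norm_mul, norm_mul, norm_cexp_zline, Complex.norm_real, Complex.norm_real,
      Real.norm_of_nonneg (hv i), Real.norm_of_nonneg (polygonWeight_nonneg u v)]
    have h2 := mul_exp_neg_le (δ := 1) (s := polygonDelay u v) one_pos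
    rw [neg_one_mul] at h2
    have h3 := mul_le_mul_of_nonneg_left h2 (polygonWeight_nonneg u v)
    have h4 := mul_le_mul_of_nonneg_right h1
      (mul_nonneg (polygonWeight_nonneg u v) (Real.exp_pos (-polygonDelay u v)).le)
    linarith
  have h1 : ∀ v, ((polygonDelay u v * polygonWeight u v : ℝ) : ℂ) *
      Complex.exp (-zline w * polygonDelay u v) = ∑ i, ∏ j, f i j (v j) := by
    intro v
    simp only [hf]
    rw [← Finset.sum_mul]
    conv_lhs => rw [Complex.ofReal_mul, mul_assoc]
    congr 1
    rw [polygonDelay]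
    push_cast
    rfl
  simp only [h1]
  rw [integral_finsetSum _ fun i _ => hI i, polygonGreen]
  refine Finset.sum_congr rfl fun i _ => ?_
  rw [integral_fintype_prod_eq_prod, cycleTerm]
  refine Finset.prod_congr rfl fun j _ => ?_
  simp only [f]
  split_ifs
  · rfl
  · simp only [one_mul]
    rfl

theorem integral_cexp_polygonMeasure (hd : 1 ≤ d) (hd' : d ≤ 3) (n : ℕ)
    {H : (Fin (n + 1) → E d) → ℂ} (hH : Measurable H) {C : ℝ} (hC : ∀ u, ‖H u‖ ≤ C) (w : ℝ) :
    ∫ t in Set.Ioi (0 : ℝ), (t : ℂ) ^ (2 * (n + 2) - d) * (Complex.exp (-zline w * t) *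
        ∫ u, H (t • u) ∂polygonMeasure d n)
      = (2 / ((n + 2 : ℕ) : ℂ)) * ∫ u, H u * polygonGreen w u := by
  have : IsFiniteMeasure (polygonMeasure d n) := ⟨sigma_univ_lt_top hd hd' n⟩
  have hD := measurable_polygonDelay d n
  have hW := measurable_polygonWeight d n
  set m := 2 * (n + 2) - d
  -- This function is integrated against the two descriptions of the measure in
  -- `map_polygonMeasure_eq`.
  let G : ℝ × (Fin (n + 1) → E d) → ℂ := fun p => Complex.exp (-zline w * p.1) * H p.2
  have hG : Measurable G := by fun_prop
  have hm : Measurable fun p : ℝ × (Fin (n + 1) → E d) => (p.1, p.1 • p.2) := by fun_prop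
  have hg : Measurable fun p : (Fin (n + 1) → E d) × (Fin (n + 2) → ℝ) =>
      (polygonDelay p.1 p.2, p.1) := hD.prodMk measurable_fst
  have hk : Measurable fun p : (Fin (n + 1) → E d) × (Fin (n + 2) → ℝ) =>
      ENNReal.ofReal (2 / ((n + 2 : ℕ) : ℝ)) *
          ENNReal.ofReal (polygonDelay p.1 p.2 * polygonWeight p.1 p.2) :=
    (hD.mul hW).ennreal_ofReal.const_mul _
  have ht : Measurable fun t : ℝ => ENNReal.ofReal (t ^ m) := by fun_prop
  have hexp : Integrable (fun t : ℝ => Real.exp (-t))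
      ((volume.restrict (Set.Ioi (0 : ℝ))).withDensity fun t => ENNReal.ofReal (t ^ m)) := by
    refine (lintegral_ofReal_ne_top_iff_integrable (by fun_prop) (Eventually.of_forall fun v =>
      (Real.exp_pos _).le)).1 ?_
    rw [lintegral_withDensity_eq_lintegral_mul _ ht (by fun_prop)]
    have h1 : ∫⁻ t in Set.Ioi (0 : ℝ), ENNReal.ofReal (t ^ m) * ENNReal.ofReal (Real.exp (-t))
        = ∫⁻ t in Set.Ioi (0 : ℝ), ENNReal.ofReal (t ^ m * Real.exp (-t)) :=
      setLIntegral_congr_fun measurableSet_Ioi fun t (ht : 0 < t) => by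
        rw [ENNReal.ofReal_mul (by positivity)]
    simp only [Pi.mul_apply, h1, lintegral_pow_mul_exp_neg]
    exact ENNReal.ofReal_ne_top
  have hI1 : Integrable (fun p : ℝ × (Fin (n + 1) → E d) => G (p.1, p.1 • p.2))
      (((volume.restrict (Set.Ioi (0 : ℝ))).withDensity fun t =>
        ENNReal.ofReal (t ^ m)).prod (polygonMeasure d n)) := by
    refine ((hexp.comp_fst (polygonMeasure d n)).const_mul C).mono'
      (hG.comp hm).aestronglyMeasurable (Eventually.of_forall fun p => ?_)
    simp only [G]
    rw [norm_mul, norm_cexp_zline, mul_comm]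
    exact mul_le_mul_of_nonneg_right (hC _) (Real.exp_pos _).le
  have hI2 : Integrable G (Measure.map (fun p : ℝ × (Fin (n + 1) → E d) => (p.1, p.1 • p.2))
      (((volume.restrict (Set.Ioi (0 : ℝ))).withDensity fun t =>
        ENNReal.ofReal (t ^ m)).prod (polygonMeasure d n))) :=
    (integrable_map_measure hG.aestronglyMeasurable hm.aemeasurable).2 hI1
  have hlt : ∀ᵐ p : (Fin (n + 1) → E d) × (Fin (n + 2) → ℝ)
      ∂(volume.prod (Measure.pi fun _ : Fin (n + 2) => waveBase d)),
      ENNReal.ofReal (2 / ((n + 2 : ℕ) : ℝ)) *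
          ENNReal.ofReal (polygonDelay p.1 p.2 * polygonWeight p.1 p.2) < ∞ :=
    Eventually.of_forall fun p => ENNReal.mul_lt_top ENNReal.ofReal_lt_top ENNReal.ofReal_lt_top
  have hI3 := hI2
  rw [map_polygonMeasure_eq hd hd' n, integrable_map_measure hG.aestronglyMeasurable
    hg.aemeasurable, integrable_withDensity_iff_integrable_smul' hk hlt] at hI3
  simp only [Function.comp_def] at hI3
  have e1 : ∫ t in Set.Ioi (0 : ℝ), (t : ℂ) ^ m * (Complex.exp (-zline w * t) *
        ∫ u, H (t • u) ∂polygonMeasure d n) =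
      ∫ p, G p ∂(Measure.map (fun p : ℝ × (Fin (n + 1) → E d) => (p.1, p.1 • p.2))
      (((volume.restrict (Set.Ioi (0 : ℝ))).withDensity fun t =>
        ENNReal.ofReal (t ^ m)).prod (polygonMeasure d n))) := by
    rw [integral_map hm.aemeasurable hG.aestronglyMeasurable, integral_prod _ hI1,
      integral_withDensity_eq_integral_toReal_smul ht
        (Eventually.of_forall fun t => ENNReal.ofReal_lt_top)]
    refine setIntegral_congr_fun measurableSet_Ioi fun t (ht : 0 < t) => ?_
    simp only [G]
    rw [integral_const_mul, ENNReal.toReal_ofReal (by positivity), Complex.real_smul]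
    push_cast
    rfl
  rw [e1, map_polygonMeasure_eq hd hd' n, integral_map hg.aemeasurable hG.aestronglyMeasurable,
    integral_withDensity_eq_integral_toReal_smul hk hlt, integral_prod _ hI3,
    ← integral_const_mul]
  -- The inner integral over the delays is only evaluated for the almost every polygon on which the
  -- majorant is finite.
  have hfin := ae_lt_top (Finset.measurable_prod _ fun j _ =>
    (measurable_greenBound d).comp (continuous_polygonSide (d := d) (n := n) j).measurable)
    (lintegral_prod_greenBound_lt_top hd hd' n).ne
  refine integral_congr_ae ?_
  filter_upwards [hfin] with u hu
  rw [← integral_polygonWeight_cexp w hu, ← integral_const_mul, ← integral_const_mul]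
  refine integral_congr_ae ?_
  filter_upwards [ae_polygon_delay_nonneg u] with v hv
  have h0 : 0 ≤ polygonDelay u v * polygonWeight u v :=
    mul_nonneg (Finset.sum_nonneg fun j _ => hv j) (polygonWeight_nonneg u v)
  simp only [G]
  rw [ENNReal.toReal_mul, ENNReal.toReal_ofReal (by positivity), ENNReal.toReal_ofReal h0,
    Complex.real_smul]
  push_cast
  ring

end WaveTrace

end

/-! ### Correlation functions: continuity and Hölder bounds. -/

noncomputable section

namespace WaveTrace

open Filter Topology

variable {d : ℕ}

/-! ### Correlation functions -/

/-- A measurable representative bounded at every point removes almost-everywhere conditions from the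
estimates on products of translates. -/
theorem exists_bounded_representative (V : Linfty d) :
    ∃ q : E d → ℂ, Measurable q ∧ (∀ x, ‖q x‖ ≤ ‖V‖) ∧ V =ᵐ[volume] q := by
  have hm : Measurable (V : E d → ℂ) := (Lp.stronglyMeasurable V).measurable
  refine ⟨{x | ‖V x‖ ≤ ‖V‖}.indicator V,
    hm.indicator (measurableSet_le hm.norm measurable_const), fun x => ?_, ?_⟩
  · by_cases h : ‖V x‖ ≤ ‖V‖
    · rwa [Set.indicator_of_mem (show x ∈ {x | ‖V x‖ ≤ ‖V‖} from h)]
    · rw [Set.indicator_of_notMem (show x ∉ {x | ‖V x‖ ≤ ‖V‖} from h), norm_zero]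
      exact norm_nonneg V
  · filter_upwards [ae_norm_le V] with x hx
    rw [Set.indicator_of_mem (show x ∈ {x | ‖V x‖ ≤ ‖V‖} from hx)]

theorem norm_prod_le_pow {ι : Type} (s : Finset ι) {a : ι → ℂ} {M : ℝ} (ha : ∀ i, ‖a i‖ ≤ M) :
    ‖∏ i ∈ s, a i‖ ≤ M ^ s.card := by
  rw [norm_prod, ← Finset.prod_const]
  exact Finset.prod_le_prod (fun i _ => norm_nonneg _) fun i _ => ha i

/-- Telescoping, one factor at a time. The condition `1 ≤ M` allows every partial product to be
bounded by the same power. -/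
theorem norm_prod_sub_prod_le {ι : Type} (s : Finset ι) {a b : ι → ℂ} {M : ℝ} (hM : 1 ≤ M)
    (ha : ∀ i, ‖a i‖ ≤ M) (hb : ∀ i, ‖b i‖ ≤ M) :
    ‖∏ i ∈ s, a i - ∏ i ∈ s, b i‖ ≤ M ^ s.card * ∑ i ∈ s, ‖a i - b i‖ := by
  induction s using Finset.cons_induction with
  | empty => simp
  | cons i s hi ih =>
    rw [Finset.prod_cons, Finset.prod_cons, Finset.sum_cons, Finset.card_cons]
    have e : a i * ∏ j ∈ s, a j - b i * ∏ j ∈ s, b j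
        = a i * (∏ j ∈ s, a j - ∏ j ∈ s, b j) + (a i - b i) * ∏ j ∈ s, b j := by ring
    have h1 : ‖∏ j ∈ s, b j‖ ≤ M ^ s.card := norm_prod_le_pow s hb
    have hM0 : 0 ≤ M := zero_le_one.trans hM
    have h2 : M ^ s.card ≤ M ^ (s.card + 1) := pow_le_pow_right₀ hM (Nat.le_succ _)
    calc _ ≤ ‖a i‖ * ‖∏ j ∈ s, a j - ∏ j ∈ s, b j‖ + ‖a i - b i‖ * ‖∏ j ∈ s, b j‖ := by
          rw [e, ← norm_mul, ← norm_mul]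
          exact norm_add_le _ _
      _ ≤ M * (M ^ s.card * ∑ j ∈ s, ‖a j - b j‖) + ‖a i - b i‖ * M ^ (s.card + 1) := by
          gcongr
          · exact ha i
          · exact h1.trans h2
      _ = _ := by ring

theorem tendsto_integral_norm_translate_sub {q : E d → ℂ} (hi : Integrable q) (u₀ : E d) :
    Tendsto (fun u => ∫ x, ‖q (x + u) - q (x + u₀)‖) (𝓝 u₀) (𝓝 0) := by
  let g : E d → C(E d, E d) := fun u => ⟨fun x => x + u, by fun_prop⟩
  have hg : Continuous g :=
    (ContinuousMap.curry ⟨fun p : E d × E d => p.2 + p.1, by fun_prop⟩).continuous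
  have hm : ∀ u, MeasurePreserving (g u) volume volume := fun u =>
    measurePreserving_add_right volume u
  let f : Lp ℂ 1 (volume : Measure (E d)) := hi.toL1 q
  have hc : Continuous fun u => Lp.compMeasurePreserving (g u) (hm u) f :=
    continuous_const.compMeasurePreservingLp hg hm ENNReal.one_ne_top
  have h1 : Tendsto (fun u => ‖Lp.compMeasurePreserving (g u) (hm u) f -
      Lp.compMeasurePreserving (g u₀) (hm u₀) f‖) (𝓝 u₀) (𝓝 0) := by
    have := (hc.sub continuous_const).norm.tendsto (x := u₀)
      (f := fun u => ‖Lp.compMeasurePreserving (g u) (hm u) f -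
        Lp.compMeasurePreserving (g u₀) (hm u₀) f‖)
    simpa using this
  have h2 : ∀ u, Lp.compMeasurePreserving (g u) (hm u) f =ᵐ[volume] fun x => q (x + u) := fun u =>
    (Lp.coeFn_compMeasurePreserving f (hm u)).trans
      ((hm u).quasiMeasurePreserving.ae_eq_comp hi.coeFn_toL1)
  refine h1.congr fun u => ?_
  rw [L1.norm_eq_integral_norm]
  refine integral_congr_ae ?_
  filter_upwards [Lp.coeFn_sub (Lp.compMeasurePreserving (g u) (hm u) f)
    (Lp.compMeasurePreserving (g u₀) (hm u₀) f), h2 u, h2 u₀] with x h3 h4 h5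
  rw [h3, Pi.sub_apply, h4, h5]

variable {q : E d → ℂ} {C : ℝ} {m : ℕ}

theorem integrable_correlation (hq : Measurable q) (hC : ∀ x, ‖q x‖ ≤ C) (hi : Integrable q)
    (u : Fin m → E d) : Integrable fun x => q x * ∏ j, q (x + u j) := by
  refine (hi.norm.mul_const (C ^ m)).mono' (by fun_prop) (Eventually.of_forall fun x => ?_)
  rw [norm_mul]
  have h := norm_prod_le_pow Finset.univ fun j => hC (x + u j)
  rw [Finset.card_univ, Fintype.card_fin] at h
  gcongr

theorem norm_correlation_le (hC : ∀ x, ‖q x‖ ≤ C) (hi : Integrable q) (u : Fin m → E d) :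
    ‖correlation q u‖ ≤ (∫ x, ‖q x‖) * C ^ m := by
  rw [correlation, ← integral_mul_const]
  refine norm_integral_le_of_norm_le (hi.norm.mul_const _) (Eventually.of_forall fun x => ?_)
  rw [norm_mul]
  have h := norm_prod_le_pow Finset.univ fun j => hC (x + u j)
  rw [Finset.card_univ, Fintype.card_fin] at h
  gcongr

/-- Telescoping reduces the difference to `L¹` norms of differences of translates, with all other
factors bounded. -/
theorem continuous_correlation (hq : Measurable q) (hC : ∀ x, ‖q x‖ ≤ C) (hi : Integrable q) :
    Continuous fun u : Fin m → E d => correlation q u := by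
  set M := max C 1
  have hM : ∀ x, ‖q x‖ ≤ M := fun x => (hC x).trans (le_max_left _ _)
  have hM1 : 1 ≤ M := le_max_right _ _
  have hM0 : 0 ≤ M := zero_le_one.trans hM1
  refine continuous_iff_continuousAt.2 fun u₀ => ?_
  have h1 : ∀ a b : E d, Integrable fun x => ‖q (x + a) - q (x + b)‖ := fun a b =>
    ((hi.comp_add_right a).sub (hi.comp_add_right b)).norm
  have h2 : Tendsto (fun u : Fin m → E d => M * M ^ m * ∑ j, ∫ x, ‖q (x + u j) - q (x + u₀ j)‖)
      (𝓝 u₀) (𝓝 0) := by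
    have h3 : Tendsto (fun u : Fin m → E d => ∑ j, ∫ x, ‖q (x + u j) - q (x + u₀ j)‖)
        (𝓝 u₀) (𝓝 (∑ _j : Fin m, 0)) := tendsto_finsetSum _ fun j _ =>
      (tendsto_integral_norm_translate_sub hi (u₀ j)).comp ((continuous_apply j).tendsto u₀)
    simpa using h3.const_mul (M * M ^ m)
  rw [ContinuousAt, tendsto_iff_norm_sub_tendsto_zero]
  refine squeeze_zero (fun u => norm_nonneg _) (fun u => ?_) h2
  rw [correlation, correlation, ← integral_sub (integrable_correlation hq hC hi u)
    (integrable_correlation hq hC hi u₀), ← integral_finsetSum _ fun j _ => h1 _ _,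
    ← integral_const_mul]
  refine norm_integral_le_of_norm_le ((integrable_finsetSum _ fun j _ => h1 _ _).const_mul _)
    (Eventually.of_forall fun x => ?_)
  rw [← mul_sub, norm_mul, mul_assoc]
  have h4 := norm_prod_sub_prod_le Finset.univ hM1 (fun j => hM (x + u j)) fun j => hM (x + u₀ j)
  rw [Finset.card_univ, Fintype.card_fin] at h4
  exact mul_le_mul (hM x) h4 (norm_nonneg _) hM0

theorem correlation_congr {V : E d → ℂ} (h : V =ᵐ[volume] q) (u : Fin m → E d) :
    ∫ x, V x * ∏ j, V (x + u j) = correlation q u := by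
  refine integral_congr_ae ?_
  have h1 : ∀ᵐ x, ∀ j, V (x + u j) = q (x + u j) := ae_all_iff.2 fun j =>
    (measurePreserving_add_right volume (u j)).quasiMeasurePreserving.ae h
  filter_upwards [h, h1] with x hx hx1
  rw [hx]
  congr 1
  exact Finset.prod_congr rfl fun j _ => hx1 j

/-! ### Hölder's inequality -/

/-- Induction on Hölder's inequality for two factors. For the empty product the exponent is `0⁻¹ =
∞`, and the constant `1` has norm at most `1`. -/
theorem eLpNorm_prod_le {α ι : Type} [MeasurableSpace α] {μ : Measure α} (s : Finset ι)
    {f : ι → α → ℂ} {p : ι → ℝ≥0∞} (hf : ∀ i, AEStronglyMeasurable (f i) μ) :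
    eLpNorm (fun x => ∏ i ∈ s, f i x) (∑ i ∈ s, (p i)⁻¹)⁻¹ μ ≤ ∏ i ∈ s, eLpNorm (f i) (p i) μ := by
  induction s using Finset.cons_induction with
  | empty =>
    simp only [Finset.prod_empty, Finset.sum_empty, ENNReal.inv_zero, eLpNorm_exponent_top]
    refine eLpNormEssSup_le_of_ae_enorm_bound (Eventually.of_forall fun x => ?_)
    simp
  | cons i s hi ih =>
    simp only [Finset.prod_cons, Finset.sum_cons]
    have hm : AEStronglyMeasurable (fun x => ∏ j ∈ s, f j x) μ :=
      Finset.aestronglyMeasurable_fun_prod _ fun j _ => hf j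
    refine (eLpNorm_smul_le_mul_eLpNorm hm (hf i) (r := ((p i)⁻¹ + ∑ j ∈ s, (p j)⁻¹)⁻¹)
      (p := p i) (q := (∑ j ∈ s, (p j)⁻¹)⁻¹) (hpqr := ⟨by simp⟩)).trans ?_
    exact mul_le_mul_right ih _

theorem norm_correlation_le_prod (hq : Measurable q) {p : Fin (m + 1) → ℝ≥0∞}
    (hp : ∑ j, (p j)⁻¹ = 1) (hL : ∀ j, MemLp q (p j) volume) (u : Fin m → E d) :
    ‖correlation q u‖ ≤ ∏ j, (eLpNorm q (p j) volume).toReal := by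
  let f : Fin (m + 1) → E d → ℂ := Fin.cons q fun j x => q (x + u j)
  have hf : ∀ j, AEStronglyMeasurable (f j) volume := fun j => by
    refine Fin.cases ?_ (fun j => ?_) j
    · exact hq.aestronglyMeasurable
    · exact (hq.comp (measurable_add_const (u j))).aestronglyMeasurable
  have hn : ∀ j, eLpNorm (f j) (p j) volume = eLpNorm q (p j) volume := fun j => by
    refine Fin.cases rfl (fun j => ?_) j
    exact eLpNorm_comp_measurePreserving hq.aestronglyMeasurable
      (measurePreserving_add_right volume (u j))
  have h1 := eLpNorm_prod_le Finset.univ (p := p) hf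
  rw [hp, inv_one, Finset.prod_congr rfl fun j _ => hn j] at h1
  have h2 : ‖correlation q u‖ₑ ≤ eLpNorm (fun x => ∏ j, f j x) 1 volume := by
    rw [eLpNorm_one_eq_lintegral_enorm]
    refine (enorm_integral_le_lintegral_enorm _).trans (lintegral_mono fun x => ?_)
    rw [Fin.prod_univ_succ]
    rfl
  have h3 := ENNReal.toReal_mono (ENNReal.prod_lt_top fun j _ => (hL j).2).ne (h2.trans h1)
  rwa [toReal_enorm, ENNReal.toReal_prod] at h3

end WaveTrace

end

/-! ### The trace density, its Laplace transform and the smeared formula. -/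

noncomputable section

namespace WaveTrace

open Filter Topology

variable {d : ℕ}

/-! ### The trace formula -/

/-- The function `∫ ∫ q(x) ∏ q(x + t uⱼ) dx dσ(u)`. -/
def traceDensity (q : E d → ℂ) (n : ℕ) (t : ℝ) : ℂ :=
  ∫ u, correlation q (t • u) ∂polygonMeasure d n

variable {q : E d → ℂ} {C : ℝ} {n : ℕ}

theorem norm_traceDensity_le (hd : 1 ≤ d) (hd' : d ≤ 3) {B : ℝ}
    (hB : ∀ u : Fin (n + 1) → E d, ‖correlation q u‖ ≤ B) (t : ℝ) :
    ‖traceDensity q n t‖ ≤ (polygonMeasure d n Set.univ).toReal * B := by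
  have : IsFiniteMeasure (polygonMeasure d n) := ⟨sigma_univ_lt_top hd hd' n⟩
  rw [mul_comm]
  exact norm_integral_le_of_norm_le_const (Eventually.of_forall fun u => hB _)

theorem continuous_traceDensity (hd : 1 ≤ d) (hd' : d ≤ 3) (hq : Measurable q)
    (hC : ∀ x, ‖q x‖ ≤ C) (hi : Integrable q) : Continuous (traceDensity q n) := by
  have : IsFiniteMeasure (polygonMeasure d n) := ⟨sigma_univ_lt_top hd hd' n⟩
  have hc := continuous_correlation (m := n + 1) hq hC hi
  refine continuous_of_dominated (bound := fun _ => (∫ x, ‖q x‖) * C ^ (n + 1))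
    (fun t => (hc.comp (continuous_const_smul t)).aestronglyMeasurable)
    (fun t => Eventually.of_forall fun u => norm_correlation_le hC hi _) (integrable_const _)
    (Eventually.of_forall fun u => hc.comp (by fun_prop))

/-- The constant `2 / k` built into `σ_k` meets the factor `k` from the cyclic symmetry and leaves
the `2` from time reversal. -/
theorem two_mul_bornTrace (hd : 1 ≤ d) (hd' : d ≤ 3) {V : Linfty d} (hqV : V =ᵐ[volume] q)
    (hq : Measurable q) (hC : ∀ x, ‖q x‖ ≤ C) (hi : Integrable q) (w : ℝ) :
    2 * bornTrace hd' V n w = ∫ t in Set.Ioi (0 : ℝ), (t : ℂ) ^ (2 * (n + 2) - d) *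
      (Complex.exp (-zline w * t) * traceDensity q n t) := by
  have h1 := natCast_mul_integral_closedChain (integrable_closedChain hd hd' hq hC hi w n)
  simp only [traceDensity]
  rw [integral_cexp_polygonMeasure hd hd' n (continuous_correlation hq hC hi).measurable
    (norm_correlation_le hC hi) w, ← h1, bornTrace_eq_integral hd hd' hqV hq hC hi w n]
  have h2 : ((n + 2 : ℕ) : ℂ) ≠ 0 := Nat.cast_ne_zero.2 (by omega)
  rw [← mul_assoc, div_mul_cancel₀ _ h2]

/-- Fubini in `(w, t)`, dominated by `|ψ(w)| t^{2k-d} e^{-t}` times a bound for the density; the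
integral over `w` then reassembles `φ(t)`. -/
theorem two_mul_integral_bornTrace (hd : 1 ≤ d) (hd' : d ≤ 3) {V : Linfty d}
    (hqV : V =ᵐ[volume] q) (hq : Measurable q) (hC : ∀ x, ‖q x‖ ≤ C) (hi : Integrable q)
    {φ : ℝ → ℂ} {ψ : 𝓢(ℝ, ℂ)} (hφ : ∀ t : ℝ, φ t = ∫ w, ψ w * Complex.exp (-zline w * t)) :
    2 * ∫ w, ψ w * bornTrace hd' V n w
      = ∫ t in Set.Ioi (0 : ℝ), (t : ℂ) ^ (2 * (n + 2) - d) * traceDensity q n t * φ t := by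
  set m := 2 * (n + 2) - d with hm
  set B := (polygonMeasure d n Set.univ).toReal * ((∫ x, ‖q x‖) * C ^ (n + 1))
  have hB : ∀ t, ‖traceDensity q n t‖ ≤ B :=
    norm_traceDensity_le hd hd' (norm_correlation_le hC hi)
  have hc := continuous_traceDensity (n := n) hd hd' hq hC hi
  have hz : Continuous zline := by
    unfold zline
    fun_prop
  have hexp : Integrable (fun t : ℝ => t ^ m * Real.exp (-t))
      (volume.restrict (Set.Ioi (0 : ℝ))) := by
    refine (lintegral_ofReal_ne_top_iff_integrable (by fun_prop)
      ((ae_restrict_iff' measurableSet_Ioi).2 (Eventually.of_forall fun t (ht : 0 < t) => ?_))).1 ?_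
    · exact mul_nonneg (pow_nonneg ht.le m) (Real.exp_pos _).le
    · rw [lintegral_pow_mul_exp_neg]
      exact ENNReal.ofReal_ne_top
  have hI : Integrable (Function.uncurry fun (w t : ℝ) =>
      ψ w * ((t : ℂ) ^ m * (Complex.exp (-zline w * t) * traceDensity q n t)))
      (volume.prod (volume.restrict (Set.Ioi (0 : ℝ)))) := by
    have hcont : Continuous (Function.uncurry fun (w t : ℝ) =>
        ψ w * ((t : ℂ) ^ m * (Complex.exp (-zline w * t) * traceDensity q n t))) := by
      have := ψ.continuous
      simp only [Function.uncurry_def]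
      fun_prop
    refine (ψ.integrable.norm.mul_prod (hexp.norm.mul_const B)).mono' hcont.aestronglyMeasurable
      (Eventually.of_forall fun p => ?_)
    simp only [Function.uncurry_def]
    rw [norm_mul, norm_mul, norm_mul, norm_cexp_zline, norm_pow, Complex.norm_real, norm_mul,
      norm_pow, Real.norm_of_nonneg (Real.exp_pos _).le, mul_assoc (‖p.2‖ ^ m)]
    gcongr
    exact hB p.2
  rw [← integral_const_mul]
  have h1 : ∀ w, 2 * (ψ w * bornTrace hd' V n w) = ∫ t in Set.Ioi (0 : ℝ),
      ψ w * ((t : ℂ) ^ m * (Complex.exp (-zline w * t) * traceDensity q n t)) := fun w => by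
    rw [integral_const_mul, ← two_mul_bornTrace hd hd' hqV hq hC hi]
    ring
  simp only [h1]
  rw [integral_integral_swap hI]
  refine integral_congr_ae (Eventually.of_forall fun t => ?_)
  simp only [hφ t]
  rw [← integral_const_mul]
  refine integral_congr_ae (Eventually.of_forall fun w => ?_)
  simp only
  ring

end WaveTrace

end

theorem mainTheorem7 (d : ℕ) (hd : 1 ≤ d) (hd' : d ≤ 3) (k : ℕ) (hk : 2 ≤ k)
    (V : WaveTrace.Linfty d)
    (hV : ∃ K : Set (WaveTrace.E d), IsCompact K ∧ ∀ᵐ x, x ∉ K → V x = 0) :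
    WaveTrace.sigma d k Set.univ < ∞ ∧
    ∃ a : ℝ → ℂ, ContinuousOn a (Set.Ici 0) ∧
      (∀ t : ℝ, 0 ≤ t →
        a t = ∫ u : Fin (k - 1) → WaveTrace.E d,
          (∫ x : WaveTrace.E d, V x * ∏ j, V (x + t • u j)) ∂WaveTrace.sigma d k) ∧
      (∀ φ : ℝ → ℂ, ContDiff ℝ (⊤ : ℕ∞) φ → HasCompactSupport φ → (∀ t, φ (-t) = φ t) →
        ∃ T : WaveTrace.Energy d →L[ℂ] WaveTrace.Energy d,
          WaveTrace.IsSmearedDuhamel V k φ T ∧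
          WaveTrace.HasTrace (H := WaveTrace.Energy d) T
            (∫ t in Set.Ioi (0 : ℝ), (t : ℂ) ^ (2 * k - d) * a t * φ t)) ∧
      ∀ p : Fin k → ℝ≥0∞, (∀ j, 1 ≤ p j) → ∑ j, (p j)⁻¹ = 1 →
        ∀ t : ℝ, 0 ≤ t →
          ‖a t‖ ≤ (WaveTrace.sigma d k Set.univ).toReal *
            ∏ j, (eLpNorm V (p j) volume).toReal := by
  obtain ⟨K, hK, hV⟩ := hV
  obtain ⟨n, rfl⟩ : ∃ n, k = n + 2 := ⟨k - 2, by omega⟩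
  -- All analysis of correlations is done with `q`; compact support makes it a member of every
  -- `L^p`, and `V` is restored through almost everywhere equality.
  obtain ⟨q, hq, hC, hqV⟩ := WaveTrace.exists_bounded_representative V
  have hL : ∀ p, MemLp q p volume := fun p =>
    (memLp_congr_ae hqV).1 (WaveTrace.memLp_of_compact_support hK hV p)
  have hi : Integrable q := memLp_one_iff_integrable.1 (hL 1)
  refine ⟨WaveTrace.sigma_univ_lt_top hd hd' n, WaveTrace.traceDensity q n,
    (WaveTrace.continuous_traceDensity hd hd' hq hC hi).continuousOn, fun t _ => ?_,
    fun φ hs hc he => ?_, fun p _ hp t _ => ?_⟩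
  · exact integral_congr_ae
      (Filter.Eventually.of_forall fun u => (WaveTrace.correlation_congr hqV (t • u)).symm)
  · obtain ⟨ψ, hψ⟩ := WaveTrace.exists_exponential_representation hs hc
    rw [← WaveTrace.two_mul_integral_bornTrace hd hd' hqV hq hC hi hψ]
    exact WaveTrace.exists_smeared_hasTrace hd' hK hV n hs.continuous hc he hψ
  · rw [Finset.prod_congr rfl fun j _ => by rw [eLpNorm_congr_ae hqV]]
    exact WaveTrace.norm_traceDensity_le hd hd'
      (WaveTrace.norm_correlation_le_prod hq hp fun j => hL (p j)) t
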